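/- Let $\mathcal G$ be a connected undirected graph on the agents $\{1,\dots,n\}$, and let $d_{iq}=d_{qi}$ be adaptive gains with $d_{iq}>0$ on the edges. For each $i$ let $f_i:\mathbb R^l\to\mathbb R$ be twice differentiable and strongly convex. For $1\le i\le n$, $1\le k\le l$ and $1\le j\le m^{ik}$ let $g^{ik}_j:\mathbb R\to\mathbb R$ be convex and differentiable, and assume Slater's condition: some $v\in\mathbb R^l$ satisfies $g^{ik}_j(v_k)<0$ for all $i,k,j$. The optimization problem is to minimize $f(x)=\sum_i f_i(x_i)$ over $x=(x_1,\dots,x_n)\in\mathbb R^{ln}$ subject to $x_1=\dots=x_n$ and $g^{ik}_j(x_{ik})\le 0$. Coupling weights are numbers $a_{iq}=a_{qi}$ that are positive on edges and zero off the edges. Let $L=L(a)$ be the corresponding weighted Laplacian, so that $((L\otimes I_l)x)_i=\sum_q a_{iq}(x_i-x_q)$. For $\alpha\in\mathbb R^{ln}$ and $\theta=(\theta^{ik}_j)\ge 0$ put $$\mathcal L_a(x,\alpha,\theta)=f(x)+\alpha^T(L\otimes I_l)x+\sum_{i,k,j}\theta^{ik}_j g^{ik}_j(x_{ik}),\qquad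 \bar{\mathcal L}_a=\mathcal L_a+x^T(L\otimes I_l)x .$$ The hybrid network dynamics for the state $(x,a,\alpha,\theta)$ is $$\dot x_{ik}=-\partial_k f_i(x_i)-\big((L\otimes I_l)x\big)_{ik}-\big((L\otimes I_l)\alpha\big)_{ik}-\sum_j\theta^{ik}_j (g^{ik}_j)'(x_{ik}),$$ $$\dot a_{iq}=d_{iq}\big(\|x_i-x_q\|^2+\|\dot x_i-\dot x_q\|^2\big)\ \text{ on the edges},\qquad \dot\alpha=(L\otimes I_l)x,\qquad \dot\theta^{ik}_j=[g^{ik}_j(x_{ik})]^+_{\theta^{ik}_j},$$ with $L=L(a(t))$, where $[v]^+_y=v$ if $y>0$ or $v>0$ and $[v]^+_y=0$ otherwise. Trajectories are understood in the sense of Carathéodory, with initial states such that $a(0)$ is a coupling weight and $\theta(0)\ge 0$. 1. (Convergence.) Every trajectory $(x(t),a(t),\alpha(t),\theta(t))$ on $[0,\infty)$ converges as $t\to\infty$ to some $(x^*,a^\infty,\alpha^*,\theta^*)$, where $a^\infty$ is a coupling weight and $(x^*,\alpha^*,\theta^*)$ is a saddle point of both $\mathcal L_{a^\infty}$ and $\bar{\mathcal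 L}_{a^\infty}$ (minimum over $x\in\mathbb R^{ln}$, maximum over $\alpha\in\mathbb R^{ln}$ and $\theta\ge 0$) and satisfies the KKT conditions $$\partial_k f_i(x_i^*)+\sum_q a^\infty_{iq}(\alpha^*_{ik}-\alpha^*_{qk})+\sum_j(\theta^{ik}_j)^*(g^{ik}_j)'(x^*_{ik})=0,$$ $$g^{ik}_j(x^*_{ik})\le 0,\quad (\theta^{ik}_j)^*\ge 0,\quad (\theta^{ik}_j)^*g^{ik}_j(x^*_{ik})=0,\quad x^*_{ik}=x^*_{qk}\qquad\text{for all } i,q,k,j .$$ 2. (Asymptotic stability.) Let $S$ be the set of states $(x^*,a^*,\alpha^*,\theta^*)$ such that $a^*$ is a coupling weight and $(x^*,\alpha^*,\theta^*)$ is a saddle point of $\bar{\mathcal L}_{a^*}$. Then $S$ is asymptotically stable in the following sense. Every $z^*\in S$ is Lyapunov stable: for every $\varepsilon>0$ there is $\delta>0$ such that every trajectory on an interval $[0,T]$ that starts within distance $\delta$ of $z^*$ stays within distance $\varepsilon$ of $z^*$ on $[0,T]$. Moreover every $z^*\in S$ has a neighbourhood such that every trajectory on $[0,\infty)$ that starts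 in it converges to a point of $S$. -/

import Mathlib

open Filter Topology MeasureTheory Set

noncomputable section

namespace ADPDD

/-- Stacked vectors `x = (x_1, …, x_n)` with blocks `x_i ∈ ℝ^l`. -/
abbrev Vec (n l : ℕ) : Type := Fin n → EuclideanSpace ℝ (Fin l)

/-- The data: a communication graph `G` on the `n` agents, adaptive gains `d i q`, local costs
`f i : ℝ^l → ℝ`, and for each scalar `x_{ik}` a family of `m i k` scalar inequality constraints
`g i k j (x_{ik}) ≤ 0`. -/
structure Problem (n l : ℕ) where
  G : SimpleGraph (Fin n)
  d : Fin n → Fin n → ℝ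
  f : Fin n → EuclideanSpace ℝ (Fin l) → ℝ
  m : Fin n → Fin l → ℕ
  g : (i : Fin n) → (k : Fin l) → Fin (m i k) → ℝ → ℝ

/-- The action of `L ⊗ I_l` on a stacked vector, where `L` is the Laplacian (degree matrix minus
adjacency matrix) of the symmetric weights `a`: block `i` is `∑_q a_{iq} (x_i - x_q)`. -/
def lap {n l : ℕ} (a : Fin n → Fin n → ℝ) (x : Vec n l) : Vec n l :=
  fun i => ∑ q, a i q • (x i - x q)

/-- The bilinear form `y^T (L ⊗ I_l) x`. -/
def lapForm {n l : ℕ} (a : Fin n → Fin n → ℝ) (y x : Vec n l) : ℝ :=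
  ∑ i, inner ℝ (y i) (lap a x i)

/-- `[v]^+_y`, equal to `v` if `y > 0` or `v > 0`, and to `0` otherwise. -/
def proj (v y : ℝ) : ℝ := if 0 < y ∨ 0 < v then v else 0

namespace Problem

variable {n l : ℕ} (P : Problem n l)

/-- The multipliers `θ^{ik}_j` of the inequality constraints. -/
abbrev Mult : Type := (i : Fin n) → (k : Fin l) → Fin (P.m i k) → ℝ

/-- States `(x, a, α, θ)`, with the (sup) product metric. -/
abbrev State : Type := Vec n l × (Fin n → Fin n → ℝ) × Vec n l × P.Mult

variable {P} in
/-- The primal component of a state. -/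
abbrev State.x (z : P.State) : Vec n l := z.1

variable {P} in
/-- The coupling weights of a state. -/
abbrev State.a (z : P.State) : Fin n → Fin n → ℝ := z.2.1

variable {P} in
/-- The consensus multipliers of a state. -/
abbrev State.α (z : P.State) : Vec n l := z.2.2.1

variable {P} in
/-- The inequality multipliers of a state. -/
abbrev State.θ (z : P.State) : P.Mult := z.2.2.2

/-- Coupling weights of the graph: symmetric, positive on edges, zero off the edges. -/
structure IsWeight (a : Fin n → Fin n → ℝ) : Prop where
  symm : ∀ i q, a i q = a q i
  pos : ∀ i q, P.G.Adj i q → 0 < a i q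
  zero : ∀ i q, ¬ P.G.Adj i q → a i q = 0

/-- Admissible states: `a` is a coupling weight of the graph and `θ ≥ 0`. -/
def IsAdmissible (z : P.State) : Prop :=
  P.IsWeight z.a ∧ ∀ i k j, 0 ≤ z.θ i k j

/-- The Lagrangian `∑_i f_i(x_i) + α^T (L ⊗ I_l) x + ∑_{i,k,j} θ^{ik}_j g^{ik}_j(x_{ik})`. -/
def lagrangian (a : Fin n → Fin n → ℝ) (x α : Vec n l) (θ : P.Mult) : ℝ :=
  ∑ i, P.f i (x i) + lapForm a α x + ∑ i, ∑ k, ∑ j, θ i k j * P.g i k j (x i k)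

/-- The augmented Lagrangian, with the extra term `x^T (L ⊗ I_l) x`. -/
def augLagrangian (a : Fin n → Fin n → ℝ) (x α : Vec n l) (θ : P.Mult) : ℝ :=
  P.lagrangian a x α θ + lapForm a x x

variable {P} in
/-- `(x, α, θ)` with `θ ≥ 0` is a saddle point of `Φ`: it minimizes over `x ∈ ℝ^{ln}` and maximizes
over `α ∈ ℝ^{ln}` and `θ ≥ 0`. -/
def IsSaddlePoint (Φ : Vec n l → Vec n l → P.Mult → ℝ) (x α : Vec n l) (θ : P.Mult) : Prop :=
  (∀ i k j, 0 ≤ θ i k j) ∧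
  (∀ (α' : Vec n l) (θ' : P.Mult), (∀ i k j, 0 ≤ θ' i k j) → Φ x α' θ' ≤ Φ x α θ) ∧
  (∀ x' : Vec n l, Φ x α θ ≤ Φ x' α θ)

/-- The Karush-Kuhn-Tucker conditions of the consensus problem, for the coupling weights `a`. -/
structure KKT (a : Fin n → Fin n → ℝ) (x α : Vec n l) (θ : P.Mult) : Prop where
  stationary : ∀ i k, gradient (P.f i) (x i) k + ∑ q, a i q * (α i k - α q k)
    + ∑ j, θ i k j * deriv (P.g i k j) (x i k) = 0
  feasible : ∀ i k j, P.g i k j (x i k) ≤ 0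
  nonneg : ∀ i k j, 0 ≤ θ i k j
  complementary : ∀ i k j, θ i k j * P.g i k j (x i k) = 0
  consensus : ∀ i q k, x i k = x q k

/-- The output of the inequality-multiplier subsystem: entry `(i, k)` is
`∑_j θ^{ik}_j (g^{ik}_j)'(x_{ik})`. -/
def yH3 (z : P.State) : Vec n l :=
  fun i => WithLp.toLp 2 fun k => ∑ j, z.θ i k j * deriv (P.g i k j) (z.x i k)

/-- The right-hand side of the primal dynamics,
`-∇f(x) - (L ⊗ I_l) x - (L ⊗ I_l) α - y_{H_3}`. -/
def xField (z : P.State) : Vec n l :=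
  fun i => -gradient (P.f i) (z.x i) - lap z.a z.x i - lap z.a z.α i - P.yH3 z i

open Classical in
/-- The adaptive coupling law `d_{iq} (e_{iq}^T e_{iq} + ė_{iq}^T ė_{iq})` on the edges, where
`e_{iq} = x_i - x_q` and `ė_{iq}` is its time derivative along the primal dynamics. -/
def aField (z : P.State) (i q : Fin n) : ℝ :=
  if P.G.Adj i q then
    P.d i q * (‖z.x i - z.x q‖ ^ 2 + ‖P.xField z i - P.xField z q‖ ^ 2)
  else 0

/-- The right-hand side `[g^{ik}_j(x_{ik})]^+_{θ^{ik}_j}` of the projected multiplier dynamics. -/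
def θField (z : P.State) (i : Fin n) (k : Fin l) (j : Fin (P.m i k)) : ℝ :=
  proj (P.g i k j (z.x i k)) (z.θ i k j)

/-- Trajectories of the hybrid network dynamics on a time interval `J` with left endpoint `0`, in
the sense of Carathéodory. The right-hand side of the `θ`-equation is discontinuous, so that
equation is imposed in integral form; along a trajectory the other right-hand sides are continuous
in time, so those equations hold at every time (one-sidedly at the endpoints of `J`). -/
structure IsTrajectoryOn (J : Set ℝ) (z : ℝ → P.State) : Prop where
  primal : ∀ t ∈ J, HasDerivWithinAt (fun s => (z s).x) (P.xField (z t)) J t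
  weights : ∀ t ∈ J, HasDerivWithinAt (fun s => (z s).a) (P.aField (z t)) J t
  dual : ∀ t ∈ J, HasDerivWithinAt (fun s => (z s).α) (lap (z t).a (z t).x) J t
  multipliers : ∀ t ∈ J, ∀ i k j,
    IntervalIntegrable (fun s => P.θField (z s) i k j) volume 0 t ∧
    (z t).θ i k j = (z 0).θ i k j + ∫ s in (0 : ℝ)..t, P.θField (z s) i k j

/-- The saddle-point states: admissible `(x, a, α, θ)` such that `(x, α, θ)` is a saddle point of
the augmented Lagrangian with coupling weights `a`. -/
def saddleSet : Set P.State :=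
  {z | P.IsAdmissible z ∧ IsSaddlePoint (P.augLagrangian z.a) z.x z.α z.θ}

/-- Lyapunov stability of the state `zs`, among trajectories starting at admissible states. -/
def IsLyapunovStable (zs : P.State) : Prop :=
  ∀ ε > 0, ∃ δ > 0, ∀ T ≥ 0, ∀ z : ℝ → P.State, P.IsTrajectoryOn (Icc 0 T) z →
    P.IsAdmissible (z 0) → dist (z 0) zs < δ → ∀ t ∈ Icc 0 T, dist (z t) zs < ε

/-- Asymptotic stability of a (not necessarily isolated) family `S` of equilibria: each point of `S`
is Lyapunov stable, and has a neighbourhood from which every trajectory converges to a point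
of `S`. -/
def IsAsymptoticallyStable (S : Set P.State) : Prop :=
  ∀ zs ∈ S, P.IsLyapunovStable zs ∧
    ∃ δ > 0, ∀ z : ℝ → P.State, P.IsTrajectoryOn (Ici 0) z → P.IsAdmissible (z 0) →
      dist (z 0) zs < δ → ∃ zl ∈ S, Tendsto z atTop (𝓝 zl)

end Problem

end ADPDD

end

/-! The obstacle is that the weights are part of the state and grow by an amount not known in
advance. Fix a primal-dual solution of the consensus problem, and let `h` be the forces the coupling
must supply at it. For each weight `a` the matching multiplier is a potential `β(a)` with `lap a
β(a) = h`, so the target of `α` moves with `a`. The function `lyap`, half the squared distance of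
`(x, α, θ)` to `(xs, β(a), θs)`, decreases at rate `diss` up to the drift of `β`. Kirchhoff's bound
`mul_norm_sub_le_sum_norm_lap` estimates potential differences over an edge by a constant over
`a_{iq}`. By `abs_dot_potential_deriv_le` the drift is then controlled by `∑ a'/a²`, the time
derivative of `-∑ 1/a`, whose integral is finite even if the weights diverge. An exponential factor
in `∑ 1/a` absorbs it: `energy` is nonincreasing, and `x`, `α`, `θ` are bounded.

The weight law also contains `‖ẋ_i - ẋ_q‖²`, which `diss` does not see. This is what `descent` is
for: it is essentially the Lagrangian plus half the quadratic augmentation, its `x`-gradient is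
`-xField`, and so its derivative contains `-‖ẋ‖²`. The main difficulty is to bound the weights.
Uniformly in their size, `exists_nsq_lt` gives `x → xs`; then `exists_weights_bound` combines
`descent`, the energy and the total weight `W` into a decreasing function. Its term `2W(E - e)`,
where `E` is the energy and `e` its infimum, absorbs the error `W · xᵀLx`, which is large when the
weights are.

Bounded weights make the orbit precompact, and along suitable times `‖ẋ‖²` and `diss` tend to zero,
so some limit point satisfies KKT. Near any KKT state, `lyap + η descent + κW` is a local Lyapunov
function. This proves `Regular.stable`, and stability of the limit point upgrades subsequential
convergence to convergence of the whole trajectory. The saddle-point statements follow from the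
equivalence of KKT points and saddle points of the augmented Lagrangian. -/

noncomputable section

namespace ADPDD

variable {n l : ℕ}

/-! ### Euclidean structure on stacked vectors. -/

/-- The Euclidean inner product of stacked vectors. -/
def dot (u v : Vec n l) : ℝ := ∑ i, inner ℝ (u i) (v i)

/-- The squared Euclidean norm of a stacked vector. -/
def nsq (u : Vec n l) : ℝ := ∑ i, ‖u i‖ ^ 2

lemma dot_self (u : Vec n l) : dot u u = nsq u := by simp [dot, nsq]

lemma nsq_nonneg (u : Vec n l) : 0 ≤ nsq u := Finset.sum_nonneg fun _ _ => by positivity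

lemma norm_sq_le_nsq (u : Vec n l) (i : Fin n) : ‖u i‖ ^ 2 ≤ nsq u :=
  Finset.single_le_sum (f := fun i => ‖u i‖ ^ 2) (fun _ _ => by positivity) (Finset.mem_univ i)

lemma dot_comm (u v : Vec n l) : dot u v = dot v u := by
  simp [dot, real_inner_comm]

lemma dot_add_left (u v w : Vec n l) : dot (u + v) w = dot u w + dot v w := by
  simp [dot, inner_add_left, Finset.sum_add_distrib]

lemma dot_sub_left (u v w : Vec n l) : dot (u - v) w = dot u w - dot v w := by
  simp [dot, inner_sub_left, Finset.sum_sub_distrib]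

lemma dot_neg_left (u v : Vec n l) : dot (-u) v = -dot u v := by simp [dot]

lemma dot_add_right (u v w : Vec n l) : dot u (v + w) = dot u v + dot u w := by
  simp [dot, inner_add_right, Finset.sum_add_distrib]

lemma dot_sub_right (u v w : Vec n l) : dot u (v - w) = dot u v - dot u w := by
  simp [dot, inner_sub_right, Finset.sum_sub_distrib]

lemma dot_neg_right (u v : Vec n l) : dot u (-v) = -dot u v := by simp [dot]

lemma dot_smul_left (c : ℝ) (u v : Vec n l) : dot (c • u) v = c * dot u v := by
  simp [dot, inner_smul_left, Finset.mul_sum]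

lemma dot_const_right (u : Vec n l) (w : EuclideanSpace ℝ (Fin l)) :
    dot u (fun _ => w) = inner ℝ (∑ i, u i) w := by
  simp [dot, sum_inner]

lemma nsq_add_smul_nonneg (c : ℝ) (u v : Vec n l) :
    0 ≤ c ^ 2 * nsq u + 2 * c * dot u v + nsq v := by
  have h := nsq_nonneg (c • u + v)
  rw [← dot_self, dot_add_left, dot_add_right, dot_add_right, dot_smul_left, dot_smul_left,
    dot_comm u (c • u), dot_comm v (c • u), dot_smul_left, dot_smul_left, dot_self, dot_self] at h
  linarith

lemma two_mul_abs_dot_le {c : ℝ} (hc : 0 < c) (u v : Vec n l) :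
    2 * |dot u v| ≤ c * nsq u + nsq v / c := by
  have h1 := nsq_add_smul_nonneg c u v
  have h2 := nsq_add_smul_nonneg (-c) u v
  have : c * (2 * |dot u v|) ≤ c * (c * nsq u + nsq v / c) := by
    rw [mul_add, mul_div_cancel₀ _ hc.ne']
    rcases abs_cases (dot u v) with ⟨h, _⟩ | ⟨h, _⟩ <;> rw [h] <;> nlinarith
  exact le_of_mul_le_mul_left this hc

lemma sum_norm_le (u : Vec n l) : 2 * ∑ i, ‖u i‖ ≤ n + nsq u := by
  have : ∑ i, 2 * ‖u i‖ ≤ ∑ i, (1 + ‖u i‖ ^ 2) :=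
    Finset.sum_le_sum fun i _ => by nlinarith [sq_nonneg (‖u i‖ - 1)]
  simpa [Finset.mul_sum, Finset.sum_add_distrib, nsq] using this

lemma norm_sub_sq_le_nsq (u : Vec n l) (i q : Fin n) : ‖u i - u q‖ ^ 2 ≤ 4 * nsq u := by
  have h := norm_sub_le (u i) (u q)
  have h1 := norm_sq_le_nsq u i
  have h2 := norm_sq_le_nsq u q
  have h0 := norm_nonneg (u i - u q)
  nlinarith [sq_nonneg (‖u i‖ - ‖u q‖)]

/-! ### The Laplacian -/

lemma lapForm_eq_dot (a : Fin n → Fin n → ℝ) (y x : Vec n l) : lapForm a y x = dot y (lap a x) :=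
  rfl

lemma lap_add (a : Fin n → Fin n → ℝ) (x y : Vec n l) : lap a (x + y) = lap a x + lap a y := by
  funext i
  simp only [lap, Pi.add_apply, ← Finset.sum_add_distrib, ← smul_add]
  exact Finset.sum_congr rfl fun q _ => by congr 1; abel

lemma lap_sub (a : Fin n → Fin n → ℝ) (x y : Vec n l) : lap a (x - y) = lap a x - lap a y := by
  funext i
  simp only [lap, Pi.sub_apply, ← Finset.sum_sub_distrib, ← smul_sub]
  exact Finset.sum_congr rfl fun q _ => by congr 1; abel

lemma lap_smul (a : Fin n → Fin n → ℝ) (c : ℝ) (x : Vec n l) : lap a (c • x) = c • lap a x := by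
  funext i
  simp only [lap, Pi.smul_apply, Finset.smul_sum, ← smul_sub]
  exact Finset.sum_congr rfl fun q _ => smul_comm _ _ _

lemma lap_of_consensus (a : Fin n → Fin n → ℝ) {x : Vec n l} (hx : ∀ i q, x i = x q) :
    lap a x = 0 := by
  funext i
  simp only [lap, Pi.zero_apply]
  exact Finset.sum_eq_zero fun q _ => by rw [hx i q, sub_self, smul_zero]

/-- Symmetrized form of the Laplacian bilinear form. -/
lemma lapForm_eq_sum {a : Fin n → Fin n → ℝ} (ha : ∀ i q, a i q = a q i) (y x : Vec n l) :
    lapForm a y x = 2⁻¹ * ∑ i, ∑ q, a i q * inner ℝ (y i - y q) (x i - x q) := by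
  have h1 : lapForm a y x = ∑ i, ∑ q, a i q * inner ℝ (y i) (x i - x q) := by
    simp [lapForm, lap, inner_sum, inner_smul_right]
  have h2 : lapForm a y x = ∑ i, ∑ q, a i q * inner ℝ (-y q) (x i - x q) := by
    rw [h1, Finset.sum_comm]
    refine Finset.sum_congr rfl fun i _ => Finset.sum_congr rfl fun q _ => ?_
    rw [ha q i, ← neg_sub (x i) (x q), inner_neg_right, inner_neg_left]
  have h3 : 2 * lapForm a y x = ∑ i, ∑ q, a i q * inner ℝ (y i - y q) (x i - x q) := by
    rw [two_mul]
    nth_rewrite 1 [h1]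
    rw [h2, ← Finset.sum_add_distrib]
    refine Finset.sum_congr rfl fun i _ => ?_
    rw [← Finset.sum_add_distrib]
    refine Finset.sum_congr rfl fun q _ => ?_
    rw [sub_eq_add_neg (y i), inner_add_left, mul_add]
  linarith

lemma lapForm_comm {a : Fin n → Fin n → ℝ} (ha : ∀ i q, a i q = a q i) (y x : Vec n l) :
    lapForm a y x = lapForm a x y := by
  rw [lapForm_eq_sum ha, lapForm_eq_sum ha]
  simp_rw [real_inner_comm]

lemma dot_lap_comm {a : Fin n → Fin n → ℝ} (ha : ∀ i q, a i q = a q i) (y x : Vec n l) :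
    dot y (lap a x) = dot (lap a y) x := by
  rw [dot_comm (lap a y)]
  exact lapForm_comm ha y x

lemma lapForm_add_left (a : Fin n → Fin n → ℝ) (y z x : Vec n l) :
    lapForm a (y + z) x = lapForm a y x + lapForm a z x := dot_add_left _ _ _

lemma lapForm_smul_left (a : Fin n → Fin n → ℝ) (c : ℝ) (y x : Vec n l) :
    lapForm a (c • y) x = c * lapForm a y x := dot_smul_left _ _ _

lemma lapForm_self_eq {a : Fin n → Fin n → ℝ} (ha : ∀ i q, a i q = a q i) (x : Vec n l) :
    lapForm a x x = 2⁻¹ * ∑ i, ∑ q, a i q * ‖x i - x q‖ ^ 2 := by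
  rw [lapForm_eq_sum ha]
  simp_rw [real_inner_self_eq_norm_sq]

lemma lapForm_self_nonneg {a : Fin n → Fin n → ℝ} (ha : ∀ i q, a i q = a q i)
    (h0 : ∀ i q, 0 ≤ a i q) (x : Vec n l) : 0 ≤ lapForm a x x := by
  rw [lapForm_self_eq ha]
  exact mul_nonneg (by norm_num) (Finset.sum_nonneg fun i _ => Finset.sum_nonneg fun q _ =>
    mul_nonneg (h0 i q) (by positivity))

lemma two_mul_abs_lapForm_le {a : Fin n → Fin n → ℝ} (ha : ∀ i q, a i q = a q i)
    (h0 : ∀ i q, 0 ≤ a i q) {c : ℝ} (hc : 0 < c) (y x : Vec n l) :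
    2 * |lapForm a y x| ≤ c * lapForm a y y + lapForm a x x / c := by
  have key : ∀ s : ℝ, 0 ≤ s ^ 2 * lapForm a y y + 2 * s * lapForm a y x + lapForm a x x := by
    intro s
    have h := lapForm_self_nonneg ha h0 (s • y + x)
    rw [lapForm_add_left, lapForm_smul_left, lapForm_comm ha y, lapForm_comm ha x,
      lapForm_add_left, lapForm_add_left, lapForm_smul_left, lapForm_smul_left,
      lapForm_comm ha x y] at h
    linarith
  have h1 := key c
  have h2 := key (-c)
  have : c * (2 * |lapForm a y x|) ≤ c * (c * lapForm a y y + lapForm a x x / c) := by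
    rw [mul_add, mul_div_cancel₀ _ hc.ne']
    rcases abs_cases (lapForm a y x) with ⟨h, _⟩ | ⟨h, _⟩ <;> rw [h] <;> nlinarith
  exact le_of_mul_le_mul_left this hc

lemma sum_lap {a : Fin n → Fin n → ℝ} (ha : ∀ i q, a i q = a q i) (x : Vec n l) :
    ∑ i, lap a x i = 0 := by
  have h : ∑ i, lap a x i = -∑ i, lap a x i := by
    conv_lhs => simp only [lap]; rw [Finset.sum_comm]
    simp only [lap]
    rw [← Finset.sum_neg_distrib]
    refine Finset.sum_congr rfl fun i _ => ?_
    rw [← Finset.sum_neg_distrib]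
    refine Finset.sum_congr rfl fun q _ => ?_
    rw [ha q i, ← smul_neg, neg_sub]
  have h2 : (2 : ℝ) • ∑ i, lap a x i = 0 := by
    rw [two_smul]; exact add_eq_zero_iff_eq_neg.mpr h
  exact (smul_eq_zero.mp h2).resolve_left two_ne_zero

/-- The total weight. -/
def wsum (a : Fin n → Fin n → ℝ) : ℝ := ∑ i, ∑ q, a i q

lemma wsum_nonneg {a : Fin n → Fin n → ℝ} (h0 : ∀ i q, 0 ≤ a i q) : 0 ≤ wsum a :=
  Finset.sum_nonneg fun i _ => Finset.sum_nonneg fun q _ => h0 i q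

lemma le_wsum {a : Fin n → Fin n → ℝ} (h0 : ∀ i q, 0 ≤ a i q) (i q : Fin n) : a i q ≤ wsum a :=
  (Finset.single_le_sum (f := fun q => a i q) (fun q _ => h0 i q) (Finset.mem_univ q)).trans
    (Finset.single_le_sum (f := fun i => ∑ q, a i q)
      (fun i _ => Finset.sum_nonneg fun q _ => h0 i q) (Finset.mem_univ i))

lemma sum_sum_mul_le {a b : Fin n → Fin n → ℝ} {C : ℝ} (h0 : ∀ i q, 0 ≤ a i q)
    (hb : ∀ i q, b i q ≤ C) : ∑ i, ∑ q, a i q * b i q ≤ wsum a * C := by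
  rw [wsum, Finset.sum_mul]
  refine Finset.sum_le_sum fun i _ => ?_
  rw [Finset.sum_mul]
  exact Finset.sum_le_sum fun q _ => mul_le_mul_of_nonneg_left (hb i q) (h0 i q)

lemma lapForm_self_le {a : Fin n → Fin n → ℝ} (ha : ∀ i q, a i q = a q i)
    (h0 : ∀ i q, 0 ≤ a i q) (x : Vec n l) : lapForm a x x ≤ 2 * wsum a * nsq x := by
  rw [lapForm_self_eq ha]
  have := sum_sum_mul_le h0 (fun i q => norm_sub_sq_le_nsq x i q)
  linarith

lemma nsq_lap_le {a : Fin n → Fin n → ℝ} (ha : ∀ i q, a i q = a q i)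
    (h0 : ∀ i q, 0 ≤ a i q) (x : Vec n l) : nsq (lap a x) ≤ 2 * wsum a * lapForm a x x := by
  rw [lapForm_self_eq ha, ← mul_assoc, mul_right_comm 2, mul_inv_cancel₀ two_ne_zero, one_mul,
    Finset.mul_sum]
  refine Finset.sum_le_sum fun i _ => ?_
  have h1 : ‖lap a x i‖ ≤ ∑ q, a i q * ‖x i - x q‖ := by
    refine (norm_sum_le _ _).trans (le_of_eq ?_)
    exact Finset.sum_congr rfl fun q _ => by rw [norm_smul, Real.norm_of_nonneg (h0 i q)]
  have h2 : (∑ q, a i q * ‖x i - x q‖) ^ 2 ≤ (∑ q, a i q) * ∑ q, a i q * ‖x i - x q‖ ^ 2 := by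
    refine Finset.sum_sq_le_sum_mul_sum_of_sq_le_mul _ (fun q _ => h0 i q)
      (fun q _ => mul_nonneg (h0 i q) (by positivity)) (fun q _ => le_of_eq (by ring))
  calc ‖lap a x i‖ ^ 2 ≤ (∑ q, a i q * ‖x i - x q‖) ^ 2 := by gcongr
    _ ≤ _ := h2
    _ ≤ wsum a * ∑ q, a i q * ‖x i - x q‖ ^ 2 := by
      gcongr
      · exact Finset.sum_nonneg fun q _ => mul_nonneg (h0 i q) (by positivity)
      · exact Finset.single_le_sum (f := fun i => ∑ q, a i q)
          (fun i _ => Finset.sum_nonneg fun q _ => h0 i q) (Finset.mem_univ i)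

/-! ### Kirchhoff's bound and connectivity. -/

/-- Kirchhoff's bound: the current in an edge is at most the total size of the sources. -/
lemma mul_norm_sub_le_sum_norm_lap {a : Fin n → Fin n → ℝ} (ha : ∀ i q, a i q = a q i)
    (h0 : ∀ i q, 0 ≤ a i q) (φ : Vec n l) (i q : Fin n) :
    a i q * ‖φ i - φ q‖ ≤ ∑ s, ‖lap a φ s‖ := by
  classical
  set w := φ i - φ q with hw
  rcases eq_or_ne w 0 with hw0 | hw0
  · rw [hw0, norm_zero, mul_zero]
    exact Finset.sum_nonneg fun _ _ => norm_nonneg _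
  have hwpos : 0 < ‖w‖ := norm_pos_iff.mpr hw0
  set ψ : Fin n → ℝ := fun s => inner ℝ (φ s) w with hψ
  have hψiq : ψ i - ψ q = ‖w‖ ^ 2 := by
    simp only [hψ]
    rw [← inner_sub_left, ← hw, real_inner_self_eq_norm_sq]
  -- Project the potential onto `w` and cut the network at the level of `i`. Currents inside `S`
  -- cancel by symmetry, and all currents out of `S` are nonnegative. The current from `i` to `q` is
  -- one of them, hence at most the total source in `S`.
  set S : Finset (Fin n) := Finset.univ.filter fun s => ψ i ≤ ψ s with hS
  have hi : i ∈ S := by simp [hS]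
  have hq : q ∈ Sᶜ := by
    simp only [hS, Finset.mem_compl, Finset.mem_filter, Finset.mem_univ, true_and, not_le]
    nlinarith [pow_pos hwpos 2]
  have e1 : ∑ s ∈ S, inner ℝ (lap a φ s) w = ∑ s ∈ S, ∑ t, a s t * (ψ s - ψ t) := by
    refine Finset.sum_congr rfl fun s _ => ?_
    simp only [lap, sum_inner, inner_smul_left, inner_sub_left, hψ]
    rfl
  have e2 : ∑ s ∈ S, ∑ t, a s t * (ψ s - ψ t)
      = ∑ s ∈ S, ∑ t ∈ S, a s t * (ψ s - ψ t) + ∑ s ∈ S, ∑ t ∈ Sᶜ, a s t * (ψ s - ψ t) := by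
    rw [← Finset.sum_add_distrib]
    exact Finset.sum_congr rfl fun s _ => (Finset.sum_add_sum_compl S _).symm
  have e3 : ∑ s ∈ S, ∑ t ∈ S, a s t * (ψ s - ψ t) = 0 := by
    have : ∑ s ∈ S, ∑ t ∈ S, a s t * (ψ s - ψ t) = -∑ s ∈ S, ∑ t ∈ S, a s t * (ψ s - ψ t) := by
      conv_lhs => rw [Finset.sum_comm]
      rw [← Finset.sum_neg_distrib]
      refine Finset.sum_congr rfl fun s _ => ?_
      rw [← Finset.sum_neg_distrib]
      refine Finset.sum_congr rfl fun t _ => ?_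
      rw [ha t s]; ring
    linarith
  have hnn : ∀ s ∈ S, ∀ t ∈ Sᶜ, 0 ≤ a s t * (ψ s - ψ t) := by
    intro s hs t ht
    simp only [hS, Finset.mem_compl, Finset.mem_filter, Finset.mem_univ, true_and, not_le] at hs ht
    exact mul_nonneg (h0 s t) (by linarith)
  have e4 : a i q * (ψ i - ψ q) ≤ ∑ s ∈ S, ∑ t ∈ Sᶜ, a s t * (ψ s - ψ t) :=
    (Finset.single_le_sum (f := fun t => a i t * (ψ i - ψ t)) (hnn i hi) hq).trans
      (Finset.single_le_sum (f := fun s => ∑ t ∈ Sᶜ, a s t * (ψ s - ψ t))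
        (fun s hs => Finset.sum_nonneg (hnn s hs)) hi)
  have e5 : ∑ s ∈ S, inner ℝ (lap a φ s) w ≤ (∑ s, ‖lap a φ s‖) * ‖w‖ := by
    calc ∑ s ∈ S, inner ℝ (lap a φ s) w ≤ ∑ s ∈ S, ‖lap a φ s‖ * ‖w‖ :=
          Finset.sum_le_sum fun s _ => real_inner_le_norm _ _
      _ ≤ ∑ s, ‖lap a φ s‖ * ‖w‖ :=
          Finset.sum_le_sum_of_subset_of_nonneg (Finset.subset_univ _)
            (fun s _ _ => by positivity)
      _ = _ := by rw [Finset.sum_mul]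
  rw [hψiq] at e4
  have : (a i q * ‖w‖) * ‖w‖ ≤ (∑ s, ‖lap a φ s‖) * ‖w‖ := by
    rw [e1, e2, e3] at e5; nlinarith
  exact le_of_mul_le_mul_right this hwpos

/-- On a connected graph, differences along edges control all differences. -/
lemma exists_norm_sub_le {G : SimpleGraph (Fin n)} (hG : G.Connected) :
    ∃ D : ℝ, 0 ≤ D ∧ ∀ (v : Vec n l) (C : ℝ), 0 ≤ C → (∀ i q, G.Adj i q → ‖v i - v q‖ ≤ C) →
      ∀ i q, ‖v i - v q‖ ≤ D * C := by
  have walk : ∀ (v : Vec n l) (C : ℝ), (∀ i q, G.Adj i q → ‖v i - v q‖ ≤ C) →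
      ∀ i q (p : G.Walk i q), ‖v i - v q‖ ≤ p.length * C := by
    intro v C h i q p
    induction p with
    | nil => simp
    | cons hadj p ih =>
      rename_i u w z
      have : v u - v z = (v u - v w) + (v w - v z) := by abel
      rw [this]
      refine (norm_add_le _ _).trans ?_
      have := h _ _ hadj
      push_cast [SimpleGraph.Walk.length_cons]
      linarith
  have hp : ∀ i q, Nonempty (G.Walk i q) := fun i q => hG.preconnected i q
  -- The sum of the lengths of one chosen walk per pair dominates each single length.
  refine ⟨∑ i, ∑ q, ((hp i q).some.length : ℝ), by positivity, fun v C hC h i q => ?_⟩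
  refine (walk v C h i q (hp i q).some).trans (mul_le_mul_of_nonneg_right ?_ hC)
  exact le_wsum (a := fun i q => ((hp i q).some.length : ℝ)) (fun _ _ => by positivity) i q

/-! ### Potentials of a weighted network and their drift. -/

/-- The contribution of the ordered pair `(i, q)` to the Laplacian. -/
def edgeMap (i q : Fin n) : Vec n l →L[ℝ] Vec n l :=
  (ContinuousLinearMap.single ℝ (fun _ : Fin n => EuclideanSpace ℝ (Fin l)) i).comp
    (ContinuousLinearMap.proj (R := ℝ) (φ := fun _ : Fin n => EuclideanSpace ℝ (Fin l)) i
      - ContinuousLinearMap.proj q)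

/-- The map sending `v` to the constant vector with blocks `∑ v_i`. -/
def totalMap : Vec n l →L[ℝ] Vec n l :=
  ContinuousLinearMap.pi fun _ => ∑ i, ContinuousLinearMap.proj i

/-- The Laplacian, made invertible by adding the sum on the consensus directions. -/
def lapMap (a : Fin n → Fin n → ℝ) : Vec n l →L[ℝ] Vec n l :=
  totalMap + ∑ i, ∑ q, a i q • edgeMap i q

lemma lapMap_apply (a : Fin n → Fin n → ℝ) (v : Vec n l) :
    lapMap a v = lap a v + fun _ => ∑ i, v i := by
  funext s
  have : (∑ i, ∑ q, a i q • edgeMap i q v) s = lap a v s := by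
    simp only [Finset.sum_apply, lap]
    rw [Finset.sum_eq_single s]
    · simp [edgeMap]
    · intro b _ hb
      simp [edgeMap, hb.symm]
    · simp
  simp only [lapMap, add_apply, sum_apply,
    smul_apply, Pi.add_apply, this]
  rw [add_comm]
  simp [totalMap]

/-- The linear part of `lapMap`. -/
lemma sum_edgeMap_apply (a : Fin n → Fin n → ℝ) (v : Vec n l) :
    (∑ i, ∑ q, a i q • edgeMap i q : Vec n l →L[ℝ] Vec n l) v = lap a v := by
  have h := lapMap_apply a v
  rw [lapMap, add_apply, add_comm] at h
  have h0 : totalMap v = fun _ => ∑ i, v i := by funext s; simp [totalMap]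
  rw [h0] at h
  exact add_right_cancel h

lemma sum_lapMap {a : Fin n → Fin n → ℝ} (ha : ∀ i q, a i q = a q i) (v : Vec n l) :
    ∑ i, lapMap a v i = (n : ℝ) • ∑ i, v i := by
  rw [lapMap_apply]
  simp only [Pi.add_apply, Finset.sum_add_distrib, sum_lap ha, zero_add, Finset.sum_const,
    Finset.card_univ, Fintype.card_fin]
  rw [Nat.cast_smul_eq_nsmul]

lemma continuous_lapMap : Continuous (lapMap : (Fin n → Fin n → ℝ) → Vec n l →L[ℝ] Vec n l) := by
  unfold lapMap; fun_prop

lemma hasDerivWithinAt_lapMap {a : ℝ → Fin n → Fin n → ℝ} {a' : Fin n → Fin n → ℝ} {s : Set ℝ}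
    {t : ℝ} (h : HasDerivWithinAt a a' s t) :
    HasDerivWithinAt (fun t => (lapMap (a t) : Vec n l →L[ℝ] Vec n l))
      (∑ i, ∑ q, a' i q • edgeMap i q) s t := by
  unfold lapMap
  refine HasDerivWithinAt.const_add _ (HasDerivWithinAt.fun_sum fun i _ =>
    HasDerivWithinAt.fun_sum fun q _ => ?_)
  have h1 : HasDerivWithinAt (fun t => a t i q) (a' i q) s t :=
    hasDerivWithinAt_pi.mp (hasDerivWithinAt_pi.mp h i) q
  exact h1.smul_const (edgeMap i q : Vec n l →L[ℝ] Vec n l)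

namespace Problem

variable {P : Problem n l}

lemma IsWeight.nonneg {a : Fin n → Fin n → ℝ} (h : P.IsWeight a) (i q : Fin n) : 0 ≤ a i q := by
  by_cases hadj : P.G.Adj i q
  · exact (h.pos i q hadj).le
  · exact (h.zero i q hadj).ge

lemma IsWeight.consensus_of_lapForm_eq_zero {a : Fin n → Fin n → ℝ} (h : P.IsWeight a)
    (hG : P.G.Connected) {v : Vec n l} (hv : lapForm a v v = 0) (i q : Fin n) : v i = v q := by
  obtain ⟨D, -, hD⟩ := exists_norm_sub_le (l := l) hG
  have hedge : ∀ i q, P.G.Adj i q → ‖v i - v q‖ ≤ 0 := by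
    intro i q hadj
    rw [lapForm_self_eq h.symm] at hv
    have hs := le_wsum (a := fun i q => a i q * ‖v i - v q‖ ^ 2)
      (fun i q => mul_nonneg (h.nonneg i q) (by positivity)) i q
    have : wsum (fun i q => a i q * ‖v i - v q‖ ^ 2) = 0 := by unfold wsum; linarith
    rw [this] at hs
    have h2 : ‖v i - v q‖ ^ 2 ≤ 0 := by
      by_contra hc
      have := mul_pos (h.pos i q hadj) (not_le.mp hc)
      exact absurd hs (not_le.mpr this)
    nlinarith [norm_nonneg (v i - v q)]
  have := hD v 0 le_rfl hedge i q
  rw [mul_zero] at this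
  exact sub_eq_zero.mp (norm_eq_zero.mp (le_antisymm this (norm_nonneg _)))

/-- The Laplacian has range of total zero and, by connectivity, only consensus vectors in its
kernel. The added total is injective on exactly these, so the sum of the two maps is injective and,
in finite dimension, invertible. -/
lemma IsWeight.isUnit_lapMap {a : Fin n → Fin n → ℝ} (h : P.IsWeight a) (hG : P.G.Connected) :
    IsUnit (lapMap a : Vec n l →L[ℝ] Vec n l) := by
  have : Nonempty (Fin n) := hG.nonempty
  have hinj : Function.Injective (lapMap a : Vec n l →L[ℝ] Vec n l) := by
    rw [injective_iff_map_eq_zero]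
    intro v hv
    have hn : (n : ℝ) ≠ 0 := by
      have := Fin.pos_iff_nonempty.mpr this
      positivity
    have hsum : ∑ i, v i = 0 := by
      have h1 := sum_lapMap h.symm v
      rw [hv] at h1
      simp only [Pi.zero_apply, Finset.sum_const_zero] at h1
      exact (smul_eq_zero.mp h1.symm).resolve_left hn
    have hlap : lap a v = 0 := by
      rw [lapMap_apply, hsum] at hv
      simpa [← Pi.zero_def] using hv
    have hc := h.consensus_of_lapForm_eq_zero hG (v := v) (by
      rw [lapForm_eq_dot, hlap]; simp [dot])
    funext i
    have h2 : ∑ q, v q = (n : ℝ) • v i := by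
      rw [Finset.sum_congr rfl fun q _ => hc q i]
      simp [Nat.cast_smul_eq_nsmul]
    rw [hsum] at h2
    exact (smul_eq_zero.mp h2.symm).resolve_left hn
  rw [ContinuousLinearMap.isUnit_iff_bijective]
  exact ⟨hinj, (LinearMap.injective_iff_surjective
    (f := (lapMap a : Vec n l →L[ℝ] Vec n l).toLinearMap)).mp hinj⟩

end Problem

/-- The potential with sources `c` in the weighted network: the solution of `lapMap a v = c`. -/
def potential (c : Vec n l) (a : Fin n → Fin n → ℝ) : Vec n l := Ring.inverse (lapMap a) c

lemma lapMap_potential {a : Fin n → Fin n → ℝ} (ha : IsUnit (lapMap a : Vec n l →L[ℝ] Vec n l))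
    (c : Vec n l) : lapMap a (potential c a) = c := by
  have h := Ring.mul_inverse_cancel _ ha
  exact congrArg (fun T : Vec n l →L[ℝ] Vec n l => T c) h

lemma eq_potential {a : Fin n → Fin n → ℝ} (ha : IsUnit (lapMap a : Vec n l →L[ℝ] Vec n l))
    {c v : Vec n l} (h : lapMap a v = c) : potential c a = v := by
  have h1 := Ring.inverse_mul_cancel _ ha
  rw [← h]
  exact congrArg (fun T : Vec n l →L[ℝ] Vec n l => T v) h1

lemma continuousAt_potential {a : Fin n → Fin n → ℝ}
    (ha : IsUnit (lapMap a : Vec n l →L[ℝ] Vec n l)) (c : Vec n l) :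
    ContinuousAt (potential c) a := by
  obtain ⟨u, hu⟩ := ha
  have h1 : ContinuousAt Ring.inverse (lapMap a : Vec n l →L[ℝ] Vec n l) := by
    rw [← hu]; exact (hasFDerivAt_ringInverse (𝕜 := ℝ) u).continuousAt
  have h2 := ContinuousAt.comp (f := fun a => (lapMap a : Vec n l →L[ℝ] Vec n l)) h1
    continuous_lapMap.continuousAt
  exact h2.clm_apply continuousAt_const

/-- Along varying weights the potential is differentiable, and its derivative `b` satisfies
`lapMap a b = - lap a' (potential c a)`. -/
lemma hasDerivWithinAt_potential {a : ℝ → Fin n → Fin n → ℝ} {a' : Fin n → Fin n → ℝ} {s : Set ℝ}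
    {t : ℝ} (h : HasDerivWithinAt a a' s t) (c : Vec n l)
    (ha : IsUnit (lapMap (a t) : Vec n l →L[ℝ] Vec n l)) :
    HasDerivWithinAt (fun t => potential c (a t)) (potential (-lap a' (potential c (a t))) (a t))
      s t := by
  obtain ⟨u, hu⟩ := ha
  have h1 := hasFDerivAt_ringInverse (𝕜 := ℝ) u
  rw [hu] at h1
  have h2 := h1.comp_hasDerivWithinAt t (hasDerivWithinAt_lapMap (l := l) h)
  have h3 := h2.clm_apply (hasDerivWithinAt_const t s c)
  refine h3.congr_deriv ?_
  have hinv : (↑u⁻¹ : Vec n l →L[ℝ] Vec n l) = Ring.inverse (lapMap (a t)) := by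
    rw [← hu, Ring.inverse_unit]
  simp only [hinv, map_zero, add_zero, neg_apply,
    ContinuousLinearMap.mulLeftRight_apply, mul_apply_eq_comp, sum_edgeMap_apply,
    potential, map_neg]

lemma sum_potential {a : Fin n → Fin n → ℝ} (ha : ∀ i q, a i q = a q i)
    (hu : IsUnit (lapMap a : Vec n l →L[ℝ] Vec n l)) (c : Vec n l) :
    (n : ℝ) • ∑ i, potential c a i = ∑ i, c i := by
  rw [← sum_lapMap ha, lapMap_potential hu]

/-- `lapMap a v` and `lap a v` differ by the total of `v` in each of `n` blocks. Since the blocks of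
`lapMap a v` add up to `n` times this total, the correction costs one more copy of the right-hand
sum. -/
lemma sum_norm_lap_le {a : Fin n → Fin n → ℝ} (ha : ∀ i q, a i q = a q i) (v : Vec n l) :
    ∑ i, ‖lap a v i‖ ≤ 2 * ∑ i, ‖lapMap a v i‖ := by
  have h1 : ∀ i, lap a v i = lapMap a v i - ∑ q, v q := fun i => by
    rw [lapMap_apply, Pi.add_apply, add_sub_cancel_right]
  have h2 : (n : ℝ) * ‖∑ q, v q‖ ≤ ∑ i, ‖lapMap a v i‖ := by
    have := congrArg norm (sum_lapMap ha v)
    rw [norm_smul, Real.norm_natCast] at this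
    rw [← this]
    exact norm_sum_le _ _
  calc ∑ i, ‖lap a v i‖ ≤ ∑ i, (‖lapMap a v i‖ + ‖∑ q, v q‖) :=
        Finset.sum_le_sum fun i _ => by rw [h1]; exact norm_sub_le _ _
    _ = ∑ i, ‖lapMap a v i‖ + n * ‖∑ q, v q‖ := by simp [Finset.sum_add_distrib]
    _ ≤ _ := by linarith

/-- The drift of the potential, tested against an arbitrary vector `w`. -/
lemma abs_dot_potential_deriv_le {a a' : Fin n → Fin n → ℝ} (ha : ∀ i q, a i q = a q i)
    (h0 : ∀ i q, 0 ≤ a i q) (ha' : ∀ i q, a' i q = a' q i) (h0' : ∀ i q, 0 ≤ a' i q)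
    (hz : ∀ i q, a i q = 0 → a' i q = 0)
    (hu : IsUnit (lapMap a : Vec n l →L[ℝ] Vec n l)) (β w : Vec n l) :
    |dot w (potential (-lap a' β) a)|
      ≤ (∑ s, ‖lap a β s‖) * (∑ s, ‖w s‖) * ∑ i, ∑ q, a' i q / a i q ^ 2 := by
  set b := potential (-lap a' β) a with hb
  -- The source `-lap a' β` has total zero, so the potential changes without moving its total.
  have hsum0 : ∑ i, b i = 0 ∨ n = 0 := by
    have h := sum_potential ha hu (-lap a' β)
    simp only [Pi.neg_apply, Finset.sum_neg_distrib, sum_lap ha', neg_zero] at h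
    rcases smul_eq_zero.mp h with h | h
    · right; exact_mod_cast h
    · left; exact h
  rcases hsum0 with hsum0 | hn
  swap
  · subst hn; simp [dot]
  -- Duality: with `w` as the source of a second potential `γ`, self-adjointness turns `dot w b`
  -- into the form of `a'` at `γ` and `β`. Both are potentials for `a`, so Kirchhoff's bound applies
  -- to each.
  set γ := potential w a with hγ
  have hMγ : lapMap a γ = w := lapMap_potential hu w
  have hlapb : lap a b = -lap a' β := by
    have := lapMap_potential hu (-lap a' β)
    rw [lapMap_apply, ← hb, hsum0] at this
    rw [← this]; funext i; simp
  have e1 : dot w b = dot (lap a γ) b := by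
    rw [← hMγ, lapMap_apply, dot_add_left, dot_comm (fun _ => ∑ i, γ i) b, dot_const_right, hsum0,
      inner_zero_left, add_zero]
  have e2 : dot w b = -(2⁻¹ * ∑ i, ∑ q, a' i q * inner ℝ (γ i - γ q) (β i - β q)) := by
    rw [e1, ← dot_lap_comm ha, hlapb, dot_neg_right, ← lapForm_eq_dot, lapForm_eq_sum ha']
  have hγb : ∑ s, ‖lap a γ s‖ ≤ 2 * ∑ s, ‖w s‖ := by
    have := sum_norm_lap_le ha γ
    rwa [hMγ] at this
  rw [e2, abs_neg, abs_mul, abs_of_pos (by norm_num : (0 : ℝ) < 2⁻¹)]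
  -- Each of the two potential differences contributes a factor `1 / a i q`. The 2 from
  -- `sum_norm_lap_le` later cancels the `2⁻¹` of the symmetrized form.
  have e3 : ∀ i q, |a' i q * inner ℝ (γ i - γ q) (β i - β q)|
      ≤ (2 * ∑ s, ‖w s‖) * (∑ s, ‖lap a β s‖) * (a' i q / a i q ^ 2) := by
    intro i q
    rcases eq_or_ne (a i q) 0 with hz0 | hz0
    · rw [hz i q hz0]; simp
    have hpos : 0 < a i q := lt_of_le_of_ne (h0 i q) hz0.symm
    have k1 := (mul_norm_sub_le_sum_norm_lap ha h0 γ i q).trans hγb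
    have k2 := mul_norm_sub_le_sum_norm_lap ha h0 β i q
    rw [abs_mul, abs_of_nonneg (h0' i q)]
    have k3 : |inner ℝ (γ i - γ q) (β i - β q)| ≤ ‖γ i - γ q‖ * ‖β i - β q‖ :=
      abs_real_inner_le_norm _ _
    have k4 : (a i q * ‖γ i - γ q‖) * (a i q * ‖β i - β q‖)
        ≤ (2 * ∑ s, ‖w s‖) * (∑ s, ‖lap a β s‖) := by
      have : 0 ≤ ∑ s, ‖w s‖ := Finset.sum_nonneg fun _ _ => norm_nonneg _
      gcongr
    rw [← mul_div_assoc, le_div_iff₀ (by positivity)]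
    calc a' i q * |inner ℝ (γ i - γ q) (β i - β q)| * a i q ^ 2
        ≤ a' i q * (‖γ i - γ q‖ * ‖β i - β q‖) * a i q ^ 2 := by
          gcongr
          exact h0' i q
      _ = ((a i q * ‖γ i - γ q‖) * (a i q * ‖β i - β q‖)) * a' i q := by ring
      _ ≤ _ := mul_le_mul_of_nonneg_right k4 (h0' i q)
  have e4 : |∑ i, ∑ q, a' i q * inner ℝ (γ i - γ q) (β i - β q)|
      ≤ (2 * ∑ s, ‖w s‖) * (∑ s, ‖lap a β s‖) * ∑ i, ∑ q, a' i q / a i q ^ 2 := by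
    rw [Finset.mul_sum]
    refine (Finset.abs_sum_le_sum_abs _ _).trans (Finset.sum_le_sum fun i _ => ?_)
    rw [Finset.mul_sum]
    exact (Finset.abs_sum_le_sum_abs _ _).trans (Finset.sum_le_sum fun q _ => e3 i q)
  linarith

/-- Control of a potential by its sources and its sum, uniformly in the weights. -/
lemma mul_norm_le_of_lap {P : Problem n l} {D δ : ℝ}
    (hD : ∀ (v : Vec n l) (C : ℝ), 0 ≤ C → (∀ i q, P.G.Adj i q → ‖v i - v q‖ ≤ C) →
      ∀ i q, ‖v i - v q‖ ≤ D * C) (hδ : 0 < δ)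
    {a : Fin n → Fin n → ℝ} (ha : P.IsWeight a) (hlow : ∀ i q, P.G.Adj i q → δ ≤ a i q)
    (v : Vec n l) (i : Fin n) :
    n * ‖v i‖ ≤ n * (D * ((∑ s, ‖lap a v s‖) / δ)) + ‖∑ q, v q‖ := by
  have hS : 0 ≤ ∑ s, ‖lap a v s‖ := Finset.sum_nonneg fun _ _ => norm_nonneg _
  have hedge : ∀ i q, P.G.Adj i q → ‖v i - v q‖ ≤ (∑ s, ‖lap a v s‖) / δ := by
    intro i q hadj
    rw [le_div_iff₀ hδ, mul_comm]
    exact (mul_le_mul_of_nonneg_right (hlow i q hadj) (norm_nonneg _)).trans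
      (mul_norm_sub_le_sum_norm_lap ha.symm ha.nonneg v i q)
  have hdiff := hD v _ (by positivity) hedge
  have e : (n : ℝ) • v i = ∑ q, (v i - v q) + ∑ q, v q := by
    simp [Finset.sum_sub_distrib, Nat.cast_smul_eq_nsmul]
  have h1 : n * ‖v i‖ = ‖(n : ℝ) • v i‖ := by rw [norm_smul, Real.norm_natCast]
  rw [h1, e]
  refine (norm_add_le _ _).trans (add_le_add_left ((norm_sum_le _ _).trans ?_) _)
  refine (Finset.sum_le_sum fun q _ => hdiff i q).trans (le_of_eq ?_)
  simp

/-! ### First-order convexity and the standing assumptions. -/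

/-- Strong convexity at first order. -/
lemma _root_.StrongConvexOn.add_inner_gradient_le {E : Type*} [NormedAddCommGroup E]
    [InnerProductSpace ℝ E] [CompleteSpace E] {μ : ℝ} {f : E → ℝ}
    (hf : StrongConvexOn univ μ f) (hd : Differentiable ℝ f) (x y : E) :
    f x + inner ℝ (gradient f x) (y - x) + μ / 2 * ‖y - x‖ ^ 2 ≤ f y := by
  have hline : HasDerivAt (fun s : ℝ => f (x + s • (y - x))) (inner ℝ (gradient f x) (y - x)) 0 := by
    have h1 : HasDerivAt (fun s : ℝ => x + s • (y - x)) (y - x) 0 := by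
      simpa using ((hasDerivAt_id (0 : ℝ)).smul_const (y - x)).const_add x
    have h2 : HasFDerivAt f (fderiv ℝ f x) (x + (0 : ℝ) • (y - x)) := by
      simpa using (hd x).hasFDerivAt
    rw [inner_gradient_left]
    exact h2.comp_hasDerivAt (0 : ℝ) h1
  have hslope := (hline.tendsto_slope).mono_left
    (nhdsWithin_mono (0 : ℝ) (fun s (hs : s ∈ Ioi (0 : ℝ)) => ne_of_gt hs))
  have hlim : Tendsto (fun s : ℝ => f y - f x - (1 - s) * (μ / 2 * ‖y - x‖ ^ 2)) (𝓝[>] 0)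
      (𝓝 (f y - f x - (1 - 0) * (μ / 2 * ‖y - x‖ ^ 2))) :=
    (Continuous.tendsto (by fun_prop) _).mono_left nhdsWithin_le_nhds
  have hle : ∀ᶠ s : ℝ in 𝓝[>] 0, slope (fun s : ℝ => f (x + s • (y - x))) 0 s
      ≤ f y - f x - (1 - s) * (μ / 2 * ‖y - x‖ ^ 2) := by
    filter_upwards [Ioo_mem_nhdsGT (zero_lt_one' ℝ)] with s hs
    have h := hf.2 (mem_univ x) (mem_univ y) (sub_nonneg.mpr hs.2.le) hs.1.le (by ring)
    have e : (1 - s) • x + s • y = x + s • (y - x) := by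
      rw [sub_smul, smul_sub, one_smul]; abel
    rw [e, norm_sub_rev] at h
    simp only [slope, zero_smul, add_zero, sub_zero, vsub_eq_sub, smul_eq_mul] at h ⊢
    rw [inv_mul_le_iff₀ hs.1]
    linarith
  have := le_of_tendsto_of_tendsto hslope hlim hle
  linarith

/-- First-order characterization of convexity on the line. -/
lemma _root_.ConvexOn.add_deriv_mul_le {g : ℝ → ℝ} (hg : ConvexOn ℝ univ g)
    (hd : Differentiable ℝ g) (x y : ℝ) : g x + deriv g x * (y - x) ≤ g y := by
  rcases lt_trichotomy x y with h | h | h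
  · have := hg.deriv_le_slope (mem_univ x) (mem_univ y) h (hd x)
    rw [slope_def_field, le_div_iff₀ (by linarith)] at this
    linarith
  · subst h; simp
  · have := hg.slope_le_deriv (mem_univ y) (mem_univ x) h (hd x)
    rw [slope_def_field, div_le_iff₀ (by linarith)] at this
    linarith

/-- The derivative of a differentiable convex function is continuous. -/
lemma _root_.ConvexOn.continuous_deriv {g : ℝ → ℝ} (hg : ConvexOn ℝ univ g)
    (hd : Differentiable ℝ g) : Continuous (deriv g) := by
  have hmono : Monotone (deriv g) := by
    rw [← monotoneOn_univ]; exact hg.monotoneOn_deriv fun x _ => hd x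
  -- Adding `x ^ 2 / 2` makes the monotone derivative unbounded in both directions. Darboux's
  -- theorem then makes it surjective, and a monotone surjection is continuous.
  have hh : ∀ x, HasDerivAt (fun x => g x + x ^ 2 / 2) (deriv g x + x) x := fun x => by
    have h2 : HasDerivAt (fun x : ℝ => x ^ 2 / 2) x x := by
      simpa using (hasDerivAt_pow 2 x).div_const 2
    exact (hd x).hasDerivAt.add h2
  have hsurj : Function.Surjective fun x => deriv g x + x := by
    intro v
    set c := min 0 (v - deriv g 0) with hc
    set d := max 0 (v - deriv g 0) with hd'
    have h1 : deriv g c ≤ deriv g 0 := hmono (min_le_left _ _)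
    have h2 : deriv g 0 ≤ deriv g d := hmono (le_max_left _ _)
    have h3 : c ≤ v - deriv g 0 := min_le_right _ _
    have h4 : v - deriv g 0 ≤ d := le_max_right _ _
    have hcd : c ≤ d := h3.trans h4
    have hord := (ordConnected_Icc (a := c) (b := d)).image_hasDerivWithinAt
      fun x _ => (hh x).hasDerivWithinAt
    obtain ⟨e, -, he⟩ := hord.out (mem_image_of_mem _ (left_mem_Icc.mpr hcd))
      (mem_image_of_mem _ (right_mem_Icc.mpr hcd)) (⟨by linarith, by linarith⟩ : v ∈ Icc _ _)
    exact ⟨e, he⟩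
  have hcont : Continuous fun x => deriv g x + x :=
    Monotone.continuous_of_surjective (fun x y h => add_le_add (hmono h) h) hsurj
  have := hcont.sub continuous_id
  rwa [show (fun x => deriv g x + x) - id = deriv g by ext x; simp] at this

/-- The data satisfy the standing assumptions, in the first-order form used below. -/
structure Problem.Regular (P : Problem n l) (μ : ℝ) : Prop where
  connected : P.G.Connected
  d_symm : ∀ i q, P.d i q = P.d q i
  d_pos : ∀ i q, P.G.Adj i q → 0 < P.d i q
  mu_pos : 0 < μ
  f_diff : ∀ i, Differentiable ℝ (P.f i)
  grad_cont : ∀ i, Continuous (gradient (P.f i))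
  f_lower : ∀ i x y, P.f i x + inner ℝ (gradient (P.f i) x) (y - x) + μ / 2 * ‖y - x‖ ^ 2 ≤ P.f i y
  g_diff : ∀ i k j, Differentiable ℝ (P.g i k j)
  deriv_cont : ∀ i k j, Continuous (deriv (P.g i k j))
  g_lower : ∀ i k j x y, P.g i k j x + deriv (P.g i k j) x * (y - x) ≤ P.g i k j y

namespace Problem

variable {P : Problem n l} {μ : ℝ}

lemma exists_regular (hG : P.G.Connected) (hd_symm : ∀ i q, P.d i q = P.d q i)
    (hd_pos : ∀ i q, P.G.Adj i q → 0 < P.d i q)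
    (hf_diff : ∀ i, Differentiable ℝ (P.f i) ∧ Differentiable ℝ (gradient (P.f i)))
    (hf_conv : ∀ i, ∃ μ : ℝ, 0 < μ ∧ StrongConvexOn Set.univ μ (P.f i))
    (hg_diff : ∀ i k j, Differentiable ℝ (P.g i k j))
    (hg_conv : ∀ i k j, ConvexOn ℝ Set.univ (P.g i k j)) : ∃ μ, P.Regular μ := by
  have : Nonempty (Fin n) := hG.nonempty
  choose ν hν hconv using hf_conv
  -- The smallest modulus serves all agents at once.
  obtain ⟨i0, hi0⟩ := Finite.exists_min ν
  exact ⟨ν i0, hG, hd_symm, hd_pos, hν i0, fun i => (hf_diff i).1,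
    fun i => (hf_diff i).2.continuous,
    fun i x y => ((hconv i).mono (hi0 i)).add_inner_gradient_le (hf_diff i).1 x y,
    hg_diff, fun i k j => (hg_conv i k j).continuous_deriv (hg_diff i k j),
    fun i k j x y => (hg_conv i k j).add_deriv_mul_le (hg_diff i k j) x y⟩

lemma Regular.strong_mono (hP : P.Regular μ) (i : Fin n) (x y : EuclideanSpace ℝ (Fin l)) :
    μ * ‖x - y‖ ^ 2 ≤ inner ℝ (x - y) (gradient (P.f i) x - gradient (P.f i) y) := by
  have h1 := hP.f_lower i x y
  have h2 := hP.f_lower i y x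
  rw [norm_sub_rev, ← neg_sub x y, inner_neg_right] at h1
  rw [inner_sub_right, real_inner_comm _ (x - y), real_inner_comm _ (x - y)]
  linarith

lemma Regular.f_convex (hP : P.Regular μ) (i : Fin n) (x y : EuclideanSpace ℝ (Fin l)) :
    P.f i x + inner ℝ (gradient (P.f i) x) (y - x) ≤ P.f i y := by
  have h1 := hP.f_lower i x y
  have : 0 ≤ μ / 2 * ‖y - x‖ ^ 2 := mul_nonneg (by linarith [hP.mu_pos]) (by positivity)
  linarith

/-! ### Reference solutions and the dissipation inequality. -/

/-- Sums over all inequality constraints. -/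
def csum (P : Problem n l) (w : P.Mult) : ℝ := ∑ i, ∑ k, ∑ j, w i k j

lemma csum_le {v w : P.Mult} (h : ∀ i k j, v i k j ≤ w i k j) : P.csum v ≤ P.csum w :=
  Finset.sum_le_sum fun i _ => Finset.sum_le_sum fun k _ => Finset.sum_le_sum fun j _ => h i k j

lemma csum_nonneg {w : P.Mult} (h : ∀ i k j, 0 ≤ w i k j) : 0 ≤ P.csum w :=
  Finset.sum_nonneg fun i _ => Finset.sum_nonneg fun k _ => Finset.sum_nonneg fun j _ => h i k j

lemma le_csum {w : P.Mult} (h : ∀ i k j, 0 ≤ w i k j) (i : Fin n) (k : Fin l)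
    (j : Fin (P.m i k)) : w i k j ≤ P.csum w := by
  refine (Finset.single_le_sum (f := fun j => w i k j) (fun j _ => h i k j)
    (Finset.mem_univ j)).trans ?_
  refine (Finset.single_le_sum (f := fun k => ∑ j, w i k j)
    (fun k _ => Finset.sum_nonneg fun j _ => h i k j) (Finset.mem_univ k)).trans ?_
  exact Finset.single_le_sum (f := fun i => ∑ k, ∑ j, w i k j)
    (fun i _ => Finset.sum_nonneg fun k _ => Finset.sum_nonneg fun j _ => h i k j)
    (Finset.mem_univ i)

lemma csum_add (v w : P.Mult) : P.csum (fun i k j => v i k j + w i k j) = P.csum v + P.csum w := by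
  simp [csum, Finset.sum_add_distrib]

lemma csum_sub (v w : P.Mult) : P.csum (fun i k j => v i k j - w i k j) = P.csum v - P.csum w := by
  simp [csum, Finset.sum_sub_distrib]

lemma csum_mul_left (c : ℝ) (w : P.Mult) :
    P.csum (fun i k j => c * w i k j) = c * P.csum w := by
  simp [csum, Finset.mul_sum]

/-- The constraint forces `∑_j θ^{ik}_j (g^{ik}_j)'(x_{ik})`. -/
def force (P : Problem n l) (x : Vec n l) (θ : P.Mult) : Vec n l :=
  fun i => WithLp.toLp 2 fun k => ∑ j, θ i k j * deriv (P.g i k j) (x i k)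

/-- The stacked gradients of the local costs. -/
def grad (P : Problem n l) (x : Vec n l) : Vec n l := fun i => gradient (P.f i) (x i)

lemma dot_force (u x : Vec n l) (θ : P.Mult) :
    dot u (P.force x θ) = P.csum fun i k j => u i k * (θ i k j * deriv (P.g i k j) (x i k)) := by
  simp only [dot, force, csum, PiLp.inner_apply]
  refine Finset.sum_congr rfl fun i _ => Finset.sum_congr rfl fun k _ => ?_
  rw [← Finset.mul_sum]
  exact mul_comm _ _

lemma xField_eq (z : P.State) :
    P.xField z = -P.grad z.x - lap z.a z.x - lap z.a z.α - P.force z.x z.θ := rfl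

/-- A primal-dual solution of the consensus problem, with `h` the forces which the coupling has to
supply. -/
structure IsRef (P : Problem n l) (xs h : Vec n l) (θs : P.Mult) : Prop where
  consensus : ∀ i q, xs i = xs q
  source : h = -P.grad xs - P.force xs θs
  sum_source : ∑ i, h i = 0
  feasible : ∀ i k j, P.g i k j (xs i k) ≤ 0
  nonneg : ∀ i k j, 0 ≤ θs i k j
  complementary : ∀ i k j, θs i k j * P.g i k j (xs i k) = 0

/-- The dissipation rate relative to a reference point. -/
def diss (P : Problem n l) (μ : ℝ) (xs : Vec n l) (z : P.State) : ℝ :=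
  μ * nsq (z.x - xs) + lapForm z.a z.x z.x - P.csum fun i k j => z.θ i k j * P.g i k j (xs i k)

/-- The projection acts only when `θ = 0` and `v ≤ 0`. There the right side is `-θs * v ≥ 0`, so
projecting can only help the decrease of the Lyapunov function. -/
lemma mul_proj_le {θ θs v : ℝ} (h : 0 ≤ θ) (hs : 0 ≤ θs) :
    (θ - θs) * proj v θ ≤ (θ - θs) * v := by
  unfold proj
  split_ifs with hc
  · exact le_rfl
  · push Not at hc
    have : θ = 0 := le_antisymm hc.1 h
    subst this
    nlinarith [mul_nonneg hs (neg_nonneg.mpr hc.2)]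

lemma lap_sub_consensus (a : Fin n → Fin n → ℝ) {xs : Vec n l} (hc : ∀ i q, xs i = xs q)
    (x : Vec n l) : lap a (x - xs) = lap a x := by
  rw [lap_sub, lap_of_consensus a hc, sub_zero]

/-- The saddle structure makes the terms bilinear in `x` and `α` cancel, leaving `-dot β (lap a x) =
-dot (x - xs) h`. The equation defining `h` turns this into gradient differences, to which strong
monotonicity applies. This is the decrease of `lyap` for a frozen target `β`. -/
lemma Regular.diss_le (hP : P.Regular μ) {xs h : Vec n l} {θs : P.Mult} (href : P.IsRef xs h θs)
    {z : P.State} (hz : P.IsAdmissible z) {β : Vec n l} (hβ : lap z.a β = h) :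
    dot (z.x - xs) (P.xField z) + dot (z.α - β) (lap z.a z.x)
      + P.csum (fun i k j => (z.θ i k j - θs i k j) * P.θField z i k j) ≤ -P.diss μ xs z := by
  have hsymm := hz.1.symm
  have e1 : dot (z.x - xs) (lap z.a z.x) = lapForm z.a z.x z.x := by
    rw [dot_lap_comm hsymm, lap_sub_consensus _ href.consensus, dot_comm]; rfl
  have e2 : dot (z.x - xs) (lap z.a z.α) = dot z.α (lap z.a z.x) := by
    rw [dot_lap_comm hsymm, lap_sub_consensus _ href.consensus, dot_comm]
  have e3 : dot β (lap z.a z.x) = dot (z.x - xs) h := by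
    rw [← lap_sub_consensus _ href.consensus, dot_lap_comm hsymm, hβ, dot_comm]
  have e4 : μ * nsq (z.x - xs) ≤ dot (z.x - xs) (P.grad z.x) - dot (z.x - xs) (P.grad xs) := by
    rw [← dot_sub_right, nsq, Finset.mul_sum]
    exact Finset.sum_le_sum fun i _ => hP.strong_mono i _ _
  -- Convexity is used at `x` with weight `θ` and at `xs` with weight `θs`; complementarity at the
  -- reference removes `θs * g(xs)`.
  have e5 : P.csum (fun i k j => (z.θ i k j - θs i k j) * P.θField z i k j)
      - dot (z.x - xs) (P.force z.x z.θ) + dot (z.x - xs) (P.force xs θs)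
      ≤ P.csum fun i k j => z.θ i k j * P.g i k j (xs i k) := by
    rw [dot_force, dot_force, ← csum_sub, ← csum_add]
    refine csum_le fun i k j => ?_
    have h1 := mul_proj_le (v := P.g i k j (z.x i k)) (hz.2 i k j) (href.nonneg i k j)
    have h2 := mul_le_mul_of_nonneg_left (hP.g_lower i k j (z.x i k) (xs i k)) (hz.2 i k j)
    have h3 := mul_le_mul_of_nonneg_left (hP.g_lower i k j (xs i k) (z.x i k)) (href.nonneg i k j)
    have h4 := href.complementary i k j
    simp only [Pi.sub_apply, PiLp.sub_apply, θField]
    nlinarith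
  rw [xField_eq, dot_sub_right, dot_sub_right, dot_sub_right, dot_neg_right, dot_sub_left z.α, e1,
    e2, e3, href.source, dot_sub_right, dot_neg_right, diss]
  linarith

lemma Regular.diss_ge (hP : P.Regular μ) {xs h : Vec n l} {θs : P.Mult} (href : P.IsRef xs h θs)
    {z : P.State} (hz : P.IsAdmissible z) :
    0 ≤ μ * nsq (z.x - xs) ∧ 0 ≤ lapForm z.a z.x z.x ∧
      (∀ i k j, 0 ≤ -(z.θ i k j * P.g i k j (xs i k))) ∧
      0 ≤ -(P.csum fun i k j => z.θ i k j * P.g i k j (xs i k)) := by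
  have h3 : ∀ i k j, 0 ≤ -(z.θ i k j * P.g i k j (xs i k)) := fun i k j => by
    have := mul_nonneg (hz.2 i k j) (neg_nonneg.mpr (href.feasible i k j))
    linarith
  refine ⟨mul_nonneg hP.mu_pos.le (nsq_nonneg _), lapForm_self_nonneg hz.1.symm hz.1.nonneg _, h3,
    ?_⟩
  have := csum_nonneg h3
  simpa [csum] using this

end Problem

/-! ### From Carathéodory trajectories to solutions with right derivatives. -/

/-- A function with nonpositive right derivatives does not increase. -/
lemma le_of_right_deriv_nonpos {f f' : ℝ → ℝ} {a b : ℝ} (hab : a ≤ b)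
    (hc : ContinuousOn f (Icc a b)) (hd : ∀ t ∈ Ico a b, HasDerivWithinAt f (f' t) (Ici t) t)
    (hle : ∀ t ∈ Ico a b, f' t ≤ 0) : f b ≤ f a :=
  image_le_of_deriv_right_le_deriv_boundary (B := fun _ => f a) (B' := fun _ => 0) hc hd le_rfl
    continuousOn_const (fun _ _ => hasDerivWithinAt_const _ _ _) hle (right_mem_Icc.mpr hab)

namespace Problem

variable {P : Problem n l} {μ : ℝ}

/-- Admissible solutions on `[t₀, t₁]`, with one-sided derivatives in all components. -/
structure IsSol (P : Problem n l) (z : ℝ → P.State) (t₀ t₁ : ℝ) : Prop where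
  cont : ContinuousOn z (Icc t₀ t₁)
  adm : ∀ t ∈ Icc t₀ t₁, P.IsAdmissible (z t)
  primal : ∀ t ∈ Ico t₀ t₁, HasDerivWithinAt (fun s => (z s).x) (P.xField (z t)) (Ici t) t
  weights : ∀ t ∈ Ico t₀ t₁, HasDerivWithinAt (fun s => (z s).a) (P.aField (z t)) (Ici t) t
  dual : ∀ t ∈ Ico t₀ t₁, HasDerivWithinAt (fun s => (z s).α) (lap (z t).a (z t).x) (Ici t) t
  mult : ∀ t ∈ Ico t₀ t₁, ∀ i k j,
    HasDerivWithinAt (fun s => (z s).θ i k j) (P.θField (z t) i k j) (Ici t) t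

lemma IsSol.mono {z : ℝ → P.State} {t₀ t₁ s₀ s₁ : ℝ} (h : P.IsSol z t₀ t₁) (h0 : t₀ ≤ s₀)
    (h1 : s₁ ≤ t₁) : P.IsSol z s₀ s₁ :=
  ⟨h.cont.mono (Icc_subset_Icc h0 h1), fun t ht => h.adm t (Icc_subset_Icc h0 h1 ht),
    fun t ht => h.primal t (Ico_subset_Ico h0 h1 ht),
    fun t ht => h.weights t (Ico_subset_Ico h0 h1 ht),
    fun t ht => h.dual t (Ico_subset_Ico h0 h1 ht),
    fun t ht => h.mult t (Ico_subset_Ico h0 h1 ht)⟩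

lemma IsTrajectoryOn.mono {J K : Set ℝ} {z : ℝ → P.State} (h : P.IsTrajectoryOn J z)
    (hK : K ⊆ J) : P.IsTrajectoryOn K z :=
  ⟨fun t ht => (h.primal t (hK ht)).mono hK, fun t ht => (h.weights t (hK ht)).mono hK,
    fun t ht => (h.dual t (hK ht)).mono hK, fun t ht => h.multipliers t (hK ht)⟩

lemma aField_symm (hd : ∀ i q, P.d i q = P.d q i) (z : P.State) (i q : Fin n) :
    P.aField z i q = P.aField z q i := by
  classical
  unfold aField
  rw [hd i q, norm_sub_rev (z.x i), norm_sub_rev (P.xField z i)]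
  exact if_congr (P.G.adj_comm i q) rfl rfl

lemma aField_nonneg (hd : ∀ i q, P.G.Adj i q → 0 < P.d i q) (z : P.State) (i q : Fin n) :
    0 ≤ P.aField z i q := by
  unfold aField
  split_ifs with h
  · exact mul_nonneg (hd i q h).le (by positivity)
  · exact le_rfl

/-- Evolution of one inequality multiplier `y`, driven by a continuous signal `v`. -/
lemma proj_nonneg_of_integral {y v : ℝ → ℝ} {T : ℝ} (h0 : 0 ≤ y 0)
    (hint : ∀ t ∈ Icc 0 T, IntervalIntegrable (fun s => proj (v s) (y s)) volume 0 t)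
    (hy : ∀ t ∈ Icc 0 T, y t = y 0 + ∫ s in (0 : ℝ)..t, proj (v s) (y s)) :
    ∀ t ∈ Icc 0 T, 0 ≤ y t := by
  intro t ht
  by_contra! hneg
  have hcont : ContinuousOn y (Icc 0 t) := by
    have h1 : ContinuousOn (fun t => y 0 + ∫ s in (0 : ℝ)..t, proj (v s) (y s)) (Icc 0 t) := by
      refine continuousOn_const.add ?_
      have := intervalIntegral.continuousOn_primitive_interval' (hint t ht) left_mem_uIcc
      rwa [uIcc_of_le ht.1] at this
    exact h1.congr fun s hs => hy s ⟨hs.1, hs.2.trans ht.2⟩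
  -- Take the last time `r` with `y r ≥ 0`. After it `y` is negative, the projected rate is
  -- nonnegative there, and `y` cannot have dropped below `y r`.
  have hclosed : IsCompact (Icc 0 t ∩ y ⁻¹' Ici 0) :=
    isCompact_Icc.of_isClosed_subset (hcont.preimage_isClosed_of_isClosed isClosed_Icc isClosed_Ici)
      inter_subset_left
  obtain ⟨r, hr, hmax⟩ := hclosed.exists_isGreatest ⟨0, left_mem_Icc.mpr ht.1, h0⟩
  have hr0 : 0 ≤ y r := hr.2
  have hrT : r ∈ Icc 0 T := ⟨hr.1.1, hr.1.2.trans ht.2⟩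
  have hdiff : y t - y r = ∫ s in r..t, proj (v s) (y s) := by
    rw [hy t ht, hy r hrT, add_sub_add_left_eq_sub,
      intervalIntegral.integral_interval_sub_left (hint t ht) (hint r hrT)]
  have hpos : 0 ≤ ∫ s in r..t, proj (v s) (y s) := by
    rw [intervalIntegral.integral_of_le hr.1.2]
    refine setIntegral_nonneg measurableSet_Ioc fun s hs => ?_
    have hs0 : y s < 0 := by
      by_contra! hc
      exact absurd (hmax ⟨⟨hr.1.1.trans hs.1.le, hs.2⟩, hc⟩) (not_le.mpr hs.1)
    unfold proj
    split_ifs with hcase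
    · rcases hcase with h | h
      · exact absurd h hs0.not_gt
      · exact h.le
    · exact le_rfl
  linarith

/-- The projected rate can jump when `y` reaches zero, but the right derivative exists at every
time. The integrand is right continuous unless `y t = 0` and `v t < 0`, and in that case `y` stays
zero for a while. This allows monotonicity arguments with no exceptional null set. -/
lemma proj_hasDerivWithinAt_of_integral {y v : ℝ → ℝ} {T : ℝ} (h0 : 0 ≤ y 0)
    (hv : ContinuousOn v (Icc 0 T))
    (hint : ∀ t ∈ Icc 0 T, IntervalIntegrable (fun s => proj (v s) (y s)) volume 0 t)
    (hy : ∀ t ∈ Icc 0 T, y t = y 0 + ∫ s in (0 : ℝ)..t, proj (v s) (y s))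
    {t : ℝ} (ht : t ∈ Ico 0 T) :
    HasDerivWithinAt y (proj (v t) (y t)) (Ici t) t := by
  have htT : t ∈ Icc 0 T := ⟨ht.1, ht.2.le⟩
  have hnn := proj_nonneg_of_integral h0 hint hy
  have hIcc : Icc 0 T ∈ 𝓝[≥] t :=
    mem_of_superset (Ico_mem_nhdsGE ht.2) fun s hs => ⟨ht.1.trans hs.1, hs.2.le⟩
  have hvt : ContinuousWithinAt v (Ici t) t := (hv t htT).mono_of_mem_nhdsWithin hIcc
  have hTT : T ∈ Icc 0 T := ⟨ht.1.trans ht.2.le, le_rfl⟩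
  have hycont : ContinuousWithinAt y (Ici t) t := by
    have h1 : ContinuousOn y (Icc 0 T) := by
      have h1 : ContinuousOn (fun t => y 0 + ∫ s in (0 : ℝ)..t, proj (v s) (y s)) (Icc 0 T) := by
        refine continuousOn_const.add ?_
        have := intervalIntegral.continuousOn_primitive_interval' (hint T hTT) left_mem_uIcc
        rwa [uIcc_of_le hTT.1] at this
      exact h1.congr hy
    exact (h1 t htT).mono_of_mem_nhdsWithin hIcc
  -- If the integrand is right continuous, this is the fundamental theorem of calculus.
  have ftc : ContinuousWithinAt (fun s => proj (v s) (y s)) (Ioi t) t →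
      HasDerivWithinAt y (proj (v t) (y t)) (Ici t) t := by
    intro hc
    have hmeas : StronglyMeasurableAtFilter (fun s => proj (v s) (y s)) (𝓝[>] t) volume := by
      refine ⟨Ioc 0 T, ?_, ?_⟩
      · exact mem_of_superset (Ioc_mem_nhdsGT ht.2) fun s hs => ⟨ht.1.trans_lt hs.1, hs.2⟩
      · exact (hint T hTT).aestronglyMeasurable
    have h1 := intervalIntegral.integral_hasDerivWithinAt_right (s := Ici t) (t := Ioi t)
      (hint t htT) hmeas hc
    have h2 := h1.const_add (y 0)
    exact h2.congr_of_eventuallyEq (mem_of_superset hIcc hy) (hy t htT)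
  rcases (hnn t htT).eq_or_lt with hzero | hpos
  · rcases lt_trichotomy (v t) 0 with hv0 | hv0 | hv0
    · -- The multiplier stays at zero.
      have hp : proj (v t) (y t) = 0 := by
        rw [proj, if_neg]; rw [← hzero]; simp [hv0.le]
      have hev : ∀ᶠ s in 𝓝[≥] t, v s < 0 := hvt.eventually_lt_const hv0
      obtain ⟨u, hu, hsub⟩ := (mem_nhdsGE_iff_exists_Ico_subset).mp (hev.and hIcc)
      have hy0 : ∀ s ∈ Ico t u, y s = 0 := by
        intro s hs
        have hsT := (hsub hs).2
        refine le_antisymm ?_ (hnn s hsT)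
        have hdiff : y s - y t = ∫ r in t..s, proj (v r) (y r) := by
          rw [hy s hsT, hy t htT, add_sub_add_left_eq_sub,
            intervalIntegral.integral_interval_sub_left (hint s hsT) (hint t htT)]
        have hle : ∫ r in t..s, proj (v r) (y r) ≤ 0 := by
          rw [intervalIntegral.integral_of_le hs.1]
          refine setIntegral_nonpos measurableSet_Ioc fun r hr => ?_
          have := (hsub ⟨hr.1.le, hr.2.trans_lt hs.2⟩).1
          unfold proj
          split_ifs
          · exact this.le
          · exact le_rfl
        linarith
      rw [hp]
      refine (hasDerivWithinAt_const t (Ici t) (0 : ℝ)).congr_of_eventuallyEq ?_ hzero.symm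
      exact mem_of_superset (Ico_mem_nhdsGE hu) hy0
    -- Both branches of `proj` may occur near `t`, but `|proj v y| ≤ |v|`, and `v` tends to zero.
    · refine ftc ?_
      have hp : proj (v t) (y t) = 0 := by
        rw [proj]; split_ifs
        · exact hv0
        · rfl
      have hb : ∀ s, |proj (v s) (y s)| ≤ |v s| := by
        intro s; unfold proj; split_ifs
        · exact le_rfl
        · simp
      change Tendsto _ _ (𝓝 (proj (v t) (y t)))
      rw [hp]
      refine squeeze_zero_norm hb ?_
      have := (hvt.mono Ioi_subset_Ici_self).abs
      change Tendsto _ _ (𝓝 |v t|) at this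
      rwa [hv0, abs_zero] at this
    · refine ftc ?_
      refine (hvt.mono Ioi_subset_Ici_self).congr_of_eventuallyEq ?_ (by simp [proj, hv0])
      have hev : ∀ᶠ s in 𝓝[>] t, 0 < v s :=
        (hvt.mono Ioi_subset_Ici_self).eventually_const_lt hv0
      filter_upwards [hev] with s hs
      simp [proj, hs]
  · refine ftc ?_
    refine (hvt.mono Ioi_subset_Ici_self).congr_of_eventuallyEq ?_ (by simp [proj, hpos])
    have hev : ∀ᶠ s in 𝓝[>] t, 0 < y s :=
      (hycont.mono Ioi_subset_Ici_self).eventually_const_lt hpos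
    filter_upwards [hev] with s hs
    simp [proj, hs]

/-- Admissibility persists: the weight rates are symmetric, nonnegative and zero off the edges, and
the integral equation keeps each `θ` nonnegative. -/
lemma IsTrajectoryOn.isSol (hd_symm : ∀ i q, P.d i q = P.d q i)
    (hd_pos : ∀ i q, P.G.Adj i q → 0 < P.d i q) (hg : ∀ i k j, Continuous (P.g i k j))
    {z : ℝ → P.State} {T : ℝ} (h : P.IsTrajectoryOn (Icc 0 T) z) (hz : P.IsAdmissible (z 0)) :
    P.IsSol z 0 T := by
  have hnhds : ∀ t ∈ Ico 0 T, Icc 0 T ∈ 𝓝[≥] t := fun t ht =>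
    mem_of_superset (Ico_mem_nhdsGE ht.2) fun s hs => ⟨ht.1.trans hs.1, hs.2.le⟩
  have hcx : ContinuousOn (fun t => (z t).x) (Icc 0 T) := fun t ht =>
    (h.primal t ht).continuousWithinAt
  have hca : ContinuousOn (fun t => (z t).a) (Icc 0 T) := fun t ht =>
    (h.weights t ht).continuousWithinAt
  have hcα : ContinuousOn (fun t => (z t).α) (Icc 0 T) := fun t ht =>
    (h.dual t ht).continuousWithinAt
  have hweights : ∀ t ∈ Ico 0 T, HasDerivWithinAt (fun s => (z s).a) (P.aField (z t)) (Ici t) t :=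
    fun t ht => (h.weights t ⟨ht.1, ht.2.le⟩).mono_of_mem_nhdsWithin (hnhds t ht)
  have hw : ∀ i q, ∀ t ∈ Ico 0 T,
      HasDerivWithinAt (fun s => (z s).a i q) (P.aField (z t) i q) (Ici t) t := fun i q t ht =>
    hasDerivWithinAt_pi.mp (hasDerivWithinAt_pi.mp (hweights t ht) i) q
  have hwc : ∀ i q, ContinuousOn (fun t => (z t).a i q) (Icc 0 T) := fun i q =>
    continuousOn_pi.mp (continuousOn_pi.mp hca i) q
  have hv : ∀ i k j, ContinuousOn (fun t => P.g i k j ((z t).x i k)) (Icc 0 T) := by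
    intro i k j
    refine (hg i k j).comp_continuousOn ?_
    have h1 : ContinuousOn (fun t => (z t).x i) (Icc 0 T) := continuousOn_pi.mp hcx i
    exact (PiLp.continuous_apply 2 (fun _ : Fin l => ℝ) k).comp_continuousOn h1
  have hθc : ∀ i k j, ContinuousOn (fun t => (z t).θ i k j) (Icc 0 T) := by
    intro i k j t ht
    have hT : T ∈ Icc 0 T := ⟨ht.1.trans ht.2, le_rfl⟩
    have h1 : ContinuousOn (fun t => (z 0).θ i k j + ∫ s in (0 : ℝ)..t, P.θField (z s) i k j)
        (Icc 0 T) := by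
      refine continuousOn_const.add ?_
      have := intervalIntegral.continuousOn_primitive_interval'
        (h.multipliers T hT i k j).1 left_mem_uIcc
      rwa [uIcc_of_le hT.1] at this
    exact (h1.congr fun s hs => (h.multipliers s hs i k j).2) t ht
  refine ⟨?_, ?_, fun t ht => (h.primal t ⟨ht.1, ht.2.le⟩).mono_of_mem_nhdsWithin (hnhds t ht),
    hweights, fun t ht => (h.dual t ⟨ht.1, ht.2.le⟩).mono_of_mem_nhdsWithin (hnhds t ht), ?_⟩
  · have hcθ : ContinuousOn (fun t => (z t).θ) (Icc 0 T) :=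
      continuousOn_pi.mpr fun i => continuousOn_pi.mpr fun k => continuousOn_pi.mpr (hθc i k)
    exact hcx.prodMk (hca.prodMk (hcα.prodMk hcθ))
  · intro t ht
    refine ⟨⟨fun i q => ?_, fun i q hadj => ?_, fun i q hadj => ?_⟩, fun i k j => ?_⟩
    · have := constant_of_has_deriv_right_zero (f := fun t => (z t).a i q - (z t).a q i)
        ((hwc i q).sub (hwc q i)) (fun s hs => by
          refine ((hw i q s hs).sub (hw q i s hs)).congr_deriv ?_
          rw [aField_symm hd_symm, sub_self]) t ht
      simp only [hz.1.symm i q, sub_self] at this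
      exact sub_eq_zero.mp this
    · have := le_of_right_deriv_nonpos (f := fun t => -(z t).a i q) ht.1
        ((hwc i q).neg.mono (Icc_subset_Icc_right ht.2))
        (fun s hs => (hw i q s ⟨hs.1, hs.2.trans_le ht.2⟩).neg)
        (fun s _ => neg_nonpos.mpr (aField_nonneg hd_pos _ _ _))
      linarith [hz.1.pos i q hadj]
    · have := constant_of_has_deriv_right_zero (f := fun t => (z t).a i q) (hwc i q) (fun s hs => by
          refine (hw i q s hs).congr_deriv ?_
          simp [aField, hadj]) t ht
      rw [this, hz.1.zero i q hadj]
    · exact proj_nonneg_of_integral (y := fun t => (z t).θ i k j)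
        (v := fun t => P.g i k j ((z t).x i k)) (hz.2 i k j)
        (fun s hs => (h.multipliers s hs i k j).1) (fun s hs => (h.multipliers s hs i k j).2) t ht
  · intro t ht i k j
    exact proj_hasDerivWithinAt_of_integral (y := fun t => (z t).θ i k j)
      (v := fun t => P.g i k j ((z t).x i k)) (hz.2 i k j) (hv i k j)
      (fun s hs => (h.multipliers s hs i k j).1) (fun s hs => (h.multipliers s hs i k j).2) ht

end Problem

/-! ### Saddle points, KKT conditions and existence of a primal-dual solution. -/

namespace Problem

variable {P : Problem n l} {μ : ℝ}

lemma lapForm_add_right (a : Fin n → Fin n → ℝ) (y x v : Vec n l) :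
    lapForm a y (x + v) = lapForm a y x + lapForm a y v := by
  rw [lapForm_eq_dot, lap_add, dot_add_right]; rfl

lemma lapForm_smul_right (a : Fin n → Fin n → ℝ) (c : ℝ) (y x : Vec n l) :
    lapForm a y (c • x) = c * lapForm a y x := by
  rw [lapForm_eq_dot, lap_smul, dot_comm, dot_smul_left, dot_comm]; rfl

lemma lapForm_consensus_right (a : Fin n → Fin n → ℝ) {x : Vec n l} (hx : ∀ i q, x i = x q)
    (y : Vec n l) : lapForm a y x = 0 := by
  rw [lapForm_eq_dot, lap_of_consensus a hx]; simp [dot]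

lemma stationary_iff {a : Fin n → Fin n → ℝ} {x α : Vec n l} {θ : P.Mult} :
    (∀ i k, gradient (P.f i) (x i) k + ∑ q, a i q * (α i k - α q k)
      + ∑ j, θ i k j * deriv (P.g i k j) (x i k) = 0) ↔
      P.grad x + lap a α + P.force x θ = 0 := by
  constructor
  · intro h
    funext i
    ext k
    have := h i k
    simpa [grad, lap, force] using this
  · intro h i k
    have := congrArg (fun v : EuclideanSpace ℝ (Fin l) => v k) (congrFun h i)
    simpa [grad, lap, force] using this

lemma KKT.isRef {a : Fin n → Fin n → ℝ} {x α : Vec n l} {θ : P.Mult} (h : P.KKT a x α θ)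
    (ha : P.IsWeight a) : P.IsRef x (lap a α) θ := by
  have hs := stationary_iff.mp h.stationary
  refine ⟨fun i q => ?_, ?_, sum_lap ha.symm α, h.feasible, h.nonneg, h.complementary⟩
  · ext k; exact h.consensus i q k
  · rw [eq_sub_iff_add_eq, eq_neg_iff_add_eq_zero, ← hs]; abel

/-- Each KKT condition comes from one competitor: `α + x` gives consensus, `θ` plus the positive
part of `g` feasibility, `θ = 0` complementarity, and a move of `x` along the stationarity residual
gives stationarity. -/
lemma IsSaddlePoint.kkt (hP : P.Regular μ) {a : Fin n → Fin n → ℝ} (ha : P.IsWeight a)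
    {x α : Vec n l} {θ : P.Mult} (h : IsSaddlePoint (P.augLagrangian a) x α θ) :
    P.KKT a x α θ := by
  obtain ⟨hθ, hmax, hmin⟩ := h
  have haug : ∀ x α θ, P.augLagrangian a x α θ = ∑ i, P.f i (x i) + lapForm a α x
      + P.csum (fun i k j => θ i k j * P.g i k j (x i k)) + lapForm a x x := fun _ _ _ => rfl
  have hcons : ∀ i q, x i = x q := by
    refine ha.consensus_of_lapForm_eq_zero hP.connected (le_antisymm ?_
      (lapForm_self_nonneg ha.symm ha.nonneg x))
    have := hmax (α + x) θ hθ
    rw [haug, haug, lapForm_add_left] at this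
    linarith
  have hθ' : ∀ θ' : P.Mult, (∀ i k j, 0 ≤ θ' i k j) →
      P.csum (fun i k j => θ' i k j * P.g i k j (x i k))
        ≤ P.csum (fun i k j => θ i k j * P.g i k j (x i k)) := by
    intro θ' h'
    have := hmax α θ' h'
    rw [haug, haug] at this
    linarith
  have hfeas : ∀ i k j, P.g i k j (x i k) ≤ 0 := by
    have h1 := hθ' (fun i k j => θ i k j + max (P.g i k j (x i k)) 0)
      fun i k j => add_nonneg (hθ i k j) (le_max_right _ _)
    simp only [add_mul] at h1
    rw [csum_add] at h1
    have hnn : ∀ i k j, 0 ≤ max (P.g i k j (x i k)) 0 * P.g i k j (x i k) := by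
      intro i k j
      rcases le_total (P.g i k j (x i k)) 0 with hc | hc
      · rw [max_eq_right hc, zero_mul]
      · rw [max_eq_left hc]; exact mul_self_nonneg _
    intro i k j
    have h2 := le_csum hnn i k j
    by_contra! hc
    rw [max_eq_left hc.le] at h2
    nlinarith
  have hcomp : ∀ i k j, θ i k j * P.g i k j (x i k) = 0 := by
    have h1 := hθ' (fun _ _ _ => 0) fun _ _ _ => le_rfl
    have h0 : P.csum (fun i k j => (0 : ℝ) * P.g i k j (x i k)) = 0 := by simp [csum]
    rw [h0] at h1
    have hnn : ∀ i k j, 0 ≤ -(θ i k j * P.g i k j (x i k)) := fun i k j => by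
      have := mul_nonneg (hθ i k j) (neg_nonneg.mpr (hfeas i k j)); linarith
    intro i k j
    have h2 := le_csum hnn i k j
    have h3 : P.csum (fun i k j => -(θ i k j * P.g i k j (x i k)))
        = -P.csum (fun i k j => θ i k j * P.g i k j (x i k)) := by simp [csum]
    have h4 := hnn i k j
    linarith
  refine ⟨stationary_iff.mpr ?_, hfeas, hθ, hcomp, fun i q k => by rw [hcons i q]⟩
  -- In the direction of the residual `v` the derivative at the minimum is `nsq v`. The augmentation
  -- adds only a term in `s ^ 2`, because `x` is a consensus vector.
  set v := P.grad x + lap a α + P.force x θ with hv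
  have hval : ∀ s : ℝ, P.augLagrangian a (x + s • v) α θ = ∑ i, P.f i (x i + s • v i)
      + (lapForm a α x + s * lapForm a α v)
      + P.csum (fun i k j => θ i k j * P.g i k j (x i k + s * v i k))
      + s ^ 2 * lapForm a v v := by
    intro s
    rw [haug]
    have e : lapForm a (x + s • v) (x + s • v) = s ^ 2 * lapForm a v v := by
      rw [lapForm_add_right, lapForm_consensus_right a hcons, zero_add, lapForm_add_left,
        lapForm_comm ha.symm x, lapForm_consensus_right a hcons, zero_add, lapForm_smul_right,
        lapForm_smul_left]
      ring
    rw [e, lapForm_add_right, lapForm_smul_right]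
    rfl
  have hf : ∀ i, HasDerivAt (fun s : ℝ => P.f i (x i + s • v i))
      (inner ℝ (gradient (P.f i) (x i)) (v i)) 0 := by
    intro i
    have h1 : HasDerivAt (fun s : ℝ => x i + s • v i) (v i) 0 := by
      simpa using ((hasDerivAt_id (0 : ℝ)).smul_const (v i)).const_add (x i)
    have h2 : HasFDerivAt (P.f i) (fderiv ℝ (P.f i) (x i)) (x i + (0 : ℝ) • v i) := by
      simpa using (hP.f_diff i (x i)).hasFDerivAt
    rw [inner_gradient_left]
    exact h2.comp_hasDerivAt (0 : ℝ) h1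
  have hg : ∀ i k j, HasDerivAt (fun s : ℝ => θ i k j * P.g i k j (x i k + s * v i k))
      (v i k * (θ i k j * deriv (P.g i k j) (x i k))) 0 := by
    intro i k j
    have h1 : HasDerivAt (fun s : ℝ => x i k + s * v i k) (v i k) 0 := by
      simpa using ((hasDerivAt_id (0 : ℝ)).mul_const (v i k)).const_add (x i k)
    have h2 : HasDerivAt (P.g i k j) (deriv (P.g i k j) (x i k)) (x i k + (0 : ℝ) * v i k) := by
      simpa using (hP.g_diff i k j (x i k)).hasDerivAt
    exact ((h2.comp (0 : ℝ) h1).const_mul (θ i k j)).congr_deriv (by ring)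
  have hcs : HasDerivAt (fun s : ℝ => P.csum (fun i k j => θ i k j * P.g i k j (x i k + s * v i k)))
      (dot v (P.force x θ)) 0 := by
    rw [dot_force]
    unfold csum
    exact HasDerivAt.fun_sum fun i _ => HasDerivAt.fun_sum fun k _ => HasDerivAt.fun_sum
      fun j _ => hg i k j
  have hder : HasDerivAt (fun s : ℝ => P.augLagrangian a (x + s • v) α θ)
      (∑ i, inner ℝ (gradient (P.f i) (x i)) (v i) + lapForm a α v + dot v (P.force x θ)) 0 := by
    simp_rw [hval]
    have h1 : HasDerivAt (fun s : ℝ => lapForm a α x + s * lapForm a α v) (lapForm a α v) 0 := by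
      simpa using ((hasDerivAt_id (0 : ℝ)).mul_const (lapForm a α v)).const_add (lapForm a α x)
    have h2 : HasDerivAt (fun s : ℝ => s ^ 2 * lapForm a v v) 0 0 := by
      simpa using (hasDerivAt_pow 2 (0 : ℝ)).mul_const (lapForm a v v)
    have h3 := ((HasDerivAt.fun_sum fun i (_ : i ∈ Finset.univ) => hf i).add h1).add hcs |>.add h2
    exact h3.congr_deriv (by ring)
  have hloc : IsLocalMin (fun s : ℝ => P.augLagrangian a (x + s • v) α θ) 0 :=
    Eventually.of_forall fun s => by simpa using hmin (x + s • v)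
  have hz := hloc.hasDerivAt_eq_zero hder
  have e1 : ∑ i, inner ℝ (gradient (P.f i) (x i)) (v i) = dot v (P.grad x) := by
    rw [dot_comm]; rfl
  have e2 : lapForm a α v = dot v (lap a α) := lapForm_comm ha.symm α v
  rw [e1, e2, ← dot_add_right, ← dot_add_right, ← hv, dot_self] at hz
  funext i
  have := norm_sq_le_nsq v i
  rw [hz] at this
  exact norm_eq_zero.mp (by nlinarith [norm_nonneg (v i)])

/-- Consensus annihilates every Laplacian term at `x`, so the maximum over the multipliers reduces
to complementarity. Convexity and stationarity give the minimum. The augmentation vanishes at `x`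
and is nonnegative elsewhere, so it preserves both. -/
lemma KKT.isSaddlePoint (hP : P.Regular μ) {a : Fin n → Fin n → ℝ} (ha : P.IsWeight a)
    {x α : Vec n l} {θ : P.Mult} (h : P.KKT a x α θ) :
    IsSaddlePoint (P.lagrangian a) x α θ ∧ IsSaddlePoint (P.augLagrangian a) x α θ := by
  have hcons : ∀ i q, x i = x q := fun i q => by ext k; exact h.consensus i q k
  have hlag : ∀ x α θ, P.lagrangian a x α θ = ∑ i, P.f i (x i) + lapForm a α x
      + P.csum (fun i k j => θ i k j * P.g i k j (x i k)) := fun _ _ _ => rfl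
  have haug : ∀ x α θ, P.augLagrangian a x α θ = P.lagrangian a x α θ + lapForm a x x :=
    fun _ _ _ => rfl
  have hmax : ∀ (α' : Vec n l) (θ' : P.Mult), (∀ i k j, 0 ≤ θ' i k j) →
      P.lagrangian a x α' θ' ≤ P.lagrangian a x α θ := by
    intro α' θ' h'
    rw [hlag, hlag, lapForm_consensus_right a hcons, lapForm_consensus_right a hcons]
    have : P.csum (fun i k j => θ' i k j * P.g i k j (x i k))
        ≤ P.csum (fun i k j => θ i k j * P.g i k j (x i k)) := by
      refine csum_le fun i k j => ?_
      rw [h.complementary i k j]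
      exact mul_nonpos_of_nonneg_of_nonpos (h' i k j) (h.feasible i k j)
    linarith
  have hmin : ∀ x', P.lagrangian a x α θ ≤ P.lagrangian a x' α θ := by
    intro x'
    have h1 : ∑ i, P.f i (x i) + dot (x' - x) (P.grad x) ≤ ∑ i, P.f i (x' i) := by
      rw [dot_comm, dot, ← Finset.sum_add_distrib]
      exact Finset.sum_le_sum fun i _ => hP.f_convex i _ _
    have h2 : lapForm a α x' = lapForm a α x + dot (x' - x) (lap a α) := by
      rw [← lapForm_eq_dot, lapForm_comm ha.symm (x' - x), ← lapForm_add_right, add_sub_cancel]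
    have h3 : P.csum (fun i k j => θ i k j * P.g i k j (x i k)) + dot (x' - x) (P.force x θ)
        ≤ P.csum (fun i k j => θ i k j * P.g i k j (x' i k)) := by
      rw [dot_force, ← csum_add]
      refine csum_le fun i k j => ?_
      have := mul_le_mul_of_nonneg_left (hP.g_lower i k j (x i k) (x' i k)) (h.nonneg i k j)
      simp only [Pi.sub_apply, PiLp.sub_apply]
      linarith
    have h4 : dot (x' - x) (P.grad x) + dot (x' - x) (lap a α) + dot (x' - x) (P.force x θ) = 0 := by
      rw [← dot_add_right, ← dot_add_right, stationary_iff.mp h.stationary]; simp [dot]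
    rw [hlag, hlag]
    linarith
  refine ⟨⟨h.nonneg, hmax, hmin⟩, h.nonneg, fun α' θ' h' => ?_, fun x' => ?_⟩
  · rw [haug, haug]; linarith [hmax α' θ' h']
  · rw [haug, haug, lapForm_consensus_right a hcons]
    linarith [hmin x', lapForm_self_nonneg ha.symm ha.nonneg x']

/-- Multipliers for a one-dimensional variational inequality under Slater's condition. -/
lemma exists_multiplier {ι : Type*} [Fintype ι] [DecidableEq ι] {g : ι → ℝ → ℝ}
    (hc : ∀ c, Continuous (g c)) (hl : ∀ c x y, g c x + deriv (g c) x * (y - x) ≤ g c y)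
    {t s γ : ℝ} (ht : ∀ c, g c t ≤ 0) (hs : ∀ c, g c s < 0)
    (hvi : ∀ r, (∀ c, g c r ≤ 0) → 0 ≤ γ * (r - t)) :
    ∃ ρ : ι → ℝ, (∀ c, 0 ≤ ρ c) ∧ (∀ c, ρ c * g c t = 0) ∧
      γ + ∑ c, ρ c * deriv (g c) t = 0 := by
  rcases eq_or_ne γ 0 with hγ | hγ
  · exact ⟨fun _ => 0, fun _ => le_rfl, fun _ => zero_mul _, by simp [hγ]⟩
  -- In one dimension a single active constraint can balance `γ`. If none has slope opposite to `γ`,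
  -- then either some constraint is active and the Slater point contradicts the variational
  -- inequality, or none is and a small step against `γ` is feasible.
  have key : ∃ c, g c t = 0 ∧ γ * deriv (g c) t < 0 := by
    by_contra! hno
    by_cases hact : ∃ c, g c t = 0
    · obtain ⟨c, hc0⟩ := hact
      have h1 := hl c t s
      rw [hc0, zero_add] at h1
      have h2 := h1.trans_lt (hs c)
      have h3 := hno c hc0
      have h4 := hvi s fun c => (hs c).le
      rcases h3.eq_or_lt with h5 | h5
      · rcases mul_eq_zero.mp h5.symm with h6 | h6
        · exact hγ h6
        · rw [h6, zero_mul] at h2; exact lt_irrefl _ h2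
      · have h6 : (γ * deriv (g c) t) * (deriv (g c) t * (s - t)) < 0 := mul_neg_of_pos_of_neg h5 h2
        nlinarith [mul_nonneg h4 (sq_nonneg (deriv (g c) t))]
    · push Not at hact
      have hlt : ∀ c, g c t < 0 := fun c => lt_of_le_of_ne (ht c) (hact c)
      have hev : ∀ᶠ η : ℝ in 𝓝[>] 0, ∀ c, g c (t - η * γ) < 0 := by
        rw [eventually_all]
        intro c
        have hcont : Continuous fun η : ℝ => g c (t - η * γ) := (hc c).comp (by fun_prop)
        have h1 : g c (t - 0 * γ) < 0 := by simpa using hlt c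
        exact (hcont.continuousAt.eventually_lt_const h1).filter_mono nhdsWithin_le_nhds
      obtain ⟨η, hη, hη0⟩ := (hev.and self_mem_nhdsWithin).exists
      have h1 := hvi (t - η * γ) fun c => (hη c).le
      have h2 : 0 < η * γ ^ 2 := mul_pos hη0 (by positivity)
      nlinarith
  obtain ⟨c, hc0, hneg⟩ := key
  have hd : deriv (g c) t ≠ 0 := by rintro h; rw [h, mul_zero] at hneg; exact lt_irrefl _ hneg
  refine ⟨Pi.single c (-γ / deriv (g c) t), fun b => ?_, fun b => ?_, ?_⟩
  · rcases eq_or_ne b c with rfl | hb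
    · rw [Pi.single_eq_same]
      have : -γ / deriv (g b) t = -(γ * deriv (g b) t) / deriv (g b) t ^ 2 := by field_simp
      rw [this]
      exact div_nonneg (by linarith) (by positivity)
    · rw [Pi.single_eq_of_ne hb]
  · rcases eq_or_ne b c with rfl | hb
    · rw [hc0, mul_zero]
    · rw [Pi.single_eq_of_ne hb, zero_mul]
  · rw [Finset.sum_eq_single c]
    · rw [Pi.single_eq_same]; field_simp; ring
    · intro b _ hb; rw [Pi.single_eq_of_ne hb, zero_mul]
    · simp

/-- Existence of a primal-dual solution. -/
lemma Regular.exists_isRef (hP : P.Regular μ)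
    (hg_conv : ∀ i k j, ConvexOn ℝ Set.univ (P.g i k j))
    (slater : ∃ v : EuclideanSpace ℝ (Fin l), ∀ i k j, P.g i k j (v k) < 0) :
    ∃ xs h θs, P.IsRef xs h θs := by
  classical
  obtain ⟨v0, hv0⟩ := slater
  have hgc : ∀ i k j, Continuous (P.g i k j) := fun i k j => (hP.g_diff i k j).continuous
  set C : Set (EuclideanSpace ℝ (Fin l)) := {v | ∀ i k j, P.g i k j (v k) ≤ 0} with hC
  have hclosed : IsClosed C := by
    simp only [hC, ofPred_forall]
    refine isClosed_iInter fun i => isClosed_iInter fun k => isClosed_iInter fun j => ?_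
    exact isClosed_le ((hgc i k j).comp (PiLp.continuous_apply 2 (fun _ : Fin l => ℝ) k))
      continuous_const
  have hFc : Continuous fun v => ∑ i, P.f i v :=
    continuous_finsetSum _ fun i _ => (hP.f_diff i).continuous
  -- Beyond distance `2‖∇f_i(v0)‖/μ` the quadratic term of strong convexity outweighs the linear
  -- one; the sum covers all agents.
  set R := ∑ i, 2 * ‖gradient (P.f i) v0‖ / μ with hR
  have hRi : ∀ i, 2 * ‖gradient (P.f i) v0‖ / μ ≤ R := fun i =>
    Finset.single_le_sum (f := fun i => 2 * ‖gradient (P.f i) v0‖ / μ)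
      (fun i _ => div_nonneg (by positivity) hP.mu_pos.le) (Finset.mem_univ i)
  have hcoer : ∀ᶠ v in cocompact (EuclideanSpace ℝ (Fin l)) ⊓ 𝓟 C,
      ∑ i, P.f i v0 ≤ ∑ i, P.f i v := by
    refine Filter.Eventually.filter_mono inf_le_left ?_
    filter_upwards [(isCompact_closedBall v0 R).compl_mem_cocompact] with v hv
    rw [mem_compl_iff, Metric.mem_closedBall, not_le, dist_eq_norm] at hv
    refine Finset.sum_le_sum fun i _ => ?_
    have h1 := hP.f_lower i v0 v
    have h2 := (abs_le.mp (abs_real_inner_le_norm (gradient (P.f i) v0) (v - v0))).1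
    have h3 := (hRi i).trans hv.le
    rw [div_le_iff₀ hP.mu_pos] at h3
    have h4 := mul_le_mul_of_nonneg_right h3 (norm_nonneg (v - v0))
    nlinarith
  obtain ⟨vs, hvs, hmin⟩ := hFc.continuousOn.exists_isMinOn' hclosed
    (show v0 ∈ C from fun i k j => (hv0 i k j).le) hcoer
  set γ : EuclideanSpace ℝ (Fin l) := ∑ i, gradient (P.f i) vs with hγ
  have hvi : ∀ w, vs + w ∈ C → 0 ≤ inner ℝ γ w := by
    intro w hw
    have hseg : ∀ s ∈ Icc (0 : ℝ) 1, vs + s • w ∈ C := by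
      intro s hs i k j
      have h1 := (hg_conv i k j).2 (mem_univ (vs k)) (mem_univ ((vs + w) k))
        (sub_nonneg.mpr hs.2) hs.1 (by ring)
      have e : (1 - s) • vs k + s • (vs + w) k = (vs + s • w) k := by
        simp; ring
      rw [e, smul_eq_mul, smul_eq_mul] at h1
      have h2 := mul_nonneg (sub_nonneg.mpr hs.2) (neg_nonneg.mpr (hvs i k j))
      have h3 := mul_nonneg hs.1 (neg_nonneg.mpr (hw i k j))
      linarith
    have hcont : Continuous fun s : ℝ => inner ℝ (∑ i, gradient (P.f i) (vs + s • w)) w := by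
      refine Continuous.inner (continuous_finsetSum _ fun i _ => (hP.grad_cont i).comp ?_)
        continuous_const
      fun_prop
    have hlim : Tendsto (fun s : ℝ => inner ℝ (∑ i, gradient (P.f i) (vs + s • w)) w) (𝓝[>] 0)
        (𝓝 (inner ℝ (∑ i, gradient (P.f i) (vs + (0 : ℝ) • w)) w)) :=
      (hcont.tendsto 0).mono_left nhdsWithin_le_nhds
    have hnn : ∀ᶠ s : ℝ in 𝓝[>] 0, 0 ≤ inner ℝ (∑ i, gradient (P.f i) (vs + s • w)) w := by
      filter_upwards [Ioo_mem_nhdsGT (zero_lt_one' ℝ)] with s hs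
      have h1 : ∑ i, P.f i vs ≤ ∑ i, P.f i (vs + s • w) := hmin (hseg s ⟨hs.1.le, hs.2.le⟩)
      -- Convexity at the displaced point bounds its directional derivative below by zero.
      -- Continuity of the gradients carries this to `s = 0`.
      have h2 : ∑ i, (P.f i (vs + s • w)
          + inner ℝ (gradient (P.f i) (vs + s • w)) (vs - (vs + s • w))) ≤ ∑ i, P.f i vs :=
        Finset.sum_le_sum fun i _ => hP.f_convex i _ _
      rw [Finset.sum_add_distrib, ← sum_inner, sub_add_cancel_left, inner_neg_right,
        inner_smul_right] at h2
      have h3 : 0 ≤ s * inner ℝ (∑ i, gradient (P.f i) (vs + s • w)) w := by linarith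
      exact nonneg_of_mul_nonneg_right h3 hs.1
    have := ge_of_tendsto hlim hnn
    simpa using this
  have hmult : ∀ k, ∃ ρ : ((i : Fin n) × Fin (P.m i k)) → ℝ, (∀ c, 0 ≤ ρ c) ∧
      (∀ c, ρ c * P.g c.1 k c.2 (vs k) = 0) ∧
      γ k + ∑ c, ρ c * deriv (P.g c.1 k c.2) (vs k) = 0 := by
    intro k
    refine exists_multiplier (g := fun c : ((i : Fin n) × Fin (P.m i k)) => P.g c.1 k c.2)
      (fun c => hgc _ _ _) (fun c => hP.g_lower _ _ _) (fun c => hvs _ _ _)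
      (fun c => hv0 c.1 k c.2) fun r hr => ?_
    -- Each constraint involves one coordinate, so a change of coordinate `k` alone meets only the
    -- constraints on that coordinate and the problem splits into scalar ones.
    have h1 := hvi (EuclideanSpace.single k (r - vs k)) (by
      intro i k' j
      rcases eq_or_ne k' k with rfl | hk
      · simpa using hr ⟨i, j⟩
      · simpa [hk] using hvs i k' j)
    rw [EuclideanSpace.inner_single_right] at h1
    simpa [mul_comm] using h1
  choose ρ hρ0 hρ1 hρ2 using hmult
  refine ⟨fun _ => vs, _, fun i k j => ρ k ⟨i, j⟩, fun _ _ => rfl, rfl, ?_, fun i k j => hvs i k j,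
    fun i k j => hρ0 k _, fun i k j => hρ1 k ⟨i, j⟩⟩
  ext k
  have := hρ2 k
  rw [Fintype.sum_sigma] at this
  simp only [hγ, WithLp.ofLp_sum, Finset.sum_apply] at this
  simp [grad, force, Finset.sum_sub_distrib]
  linarith

end Problem

/-! ### The Lyapunov and descent functions along solutions. -/

section Derivatives

variable {u v : ℝ → Vec n l} {u' v' : Vec n l} {a : ℝ → Fin n → Fin n → ℝ}
  {a' : Fin n → Fin n → ℝ} {s : Set ℝ} {t : ℝ}

lemma hasDerivWithinAt_dot (hu : HasDerivWithinAt u u' s t) (hv : HasDerivWithinAt v v' s t) :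
    HasDerivWithinAt (fun t => dot (u t) (v t)) (dot (u t) v' + dot u' (v t)) s t := by
  unfold dot
  rw [← Finset.sum_add_distrib]
  exact HasDerivWithinAt.fun_sum fun i _ =>
    (hasDerivWithinAt_pi.mp hu i).inner ℝ (hasDerivWithinAt_pi.mp hv i)

lemma hasDerivWithinAt_nsq (hu : HasDerivWithinAt u u' s t) :
    HasDerivWithinAt (fun t => nsq (u t)) (2 * dot (u t) u') s t := by
  have h := hasDerivWithinAt_dot hu hu
  simp only [dot_self] at h
  exact h.congr_deriv (by rw [dot_comm u']; ring)

lemma hasDerivWithinAt_lap (ha : HasDerivWithinAt a a' s t) (hu : HasDerivWithinAt u u' s t) :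
    HasDerivWithinAt (fun t => lap (a t) (u t)) (lap a' (u t) + lap (a t) u') s t := by
  rw [hasDerivWithinAt_pi]
  intro i
  have h1 : ∀ q, HasDerivWithinAt (fun t => a t i q) (a' i q) s t := fun q =>
    hasDerivWithinAt_pi.mp (hasDerivWithinAt_pi.mp ha i) q
  have h2 : ∀ i, HasDerivWithinAt (fun t => u t i) (u' i) s t := hasDerivWithinAt_pi.mp hu
  have h3 := HasDerivWithinAt.fun_sum fun q (_ : q ∈ Finset.univ) =>
    (h1 q).smul ((h2 i).sub (h2 q))
  refine h3.congr_deriv ?_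
  simp only [Pi.add_apply, lap, Finset.sum_add_distrib, Pi.sub_apply]
  exact add_comm _ _

lemma hasDerivWithinAt_lapForm (ha : HasDerivWithinAt a a' s t) (hu : HasDerivWithinAt u u' s t)
    (hv : HasDerivWithinAt v v' s t) :
    HasDerivWithinAt (fun t => lapForm (a t) (u t) (v t))
      (lapForm a' (u t) (v t) + lapForm (a t) u' (v t) + lapForm (a t) (u t) v') s t := by
  refine (hasDerivWithinAt_dot hu (hasDerivWithinAt_lap ha hv)).congr_deriv ?_
  rw [dot_add_right]
  simp only [lapForm_eq_dot]
  ring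

end Derivatives

lemma continuous_nsq : Continuous (nsq : Vec n l → ℝ) := by unfold nsq; fun_prop

lemma _root_.Continuous.lapForm {X : Type*} [TopologicalSpace X] {a : X → Fin n → Fin n → ℝ}
    {y x : X → Vec n l} (ha : Continuous a) (hy : Continuous y) (hx : Continuous x) :
    Continuous fun t => lapForm (a t) (y t) (x t) := by
  unfold ADPDD.lapForm lap; fun_prop

/-- The sources `h`, shifted so that the potential has total `s`. -/
def shifted (h : Vec n l) (s : EuclideanSpace ℝ (Fin l)) : Vec n l := fun i => h i + s

namespace Problem

variable {P : Problem n l} {μ : ℝ}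

lemma Regular.cast_ne_zero (hP : P.Regular μ) : (n : ℝ) ≠ 0 := by
  have := Fin.pos_iff_nonempty.mpr hP.connected.nonempty
  positivity

/-- Summing the blocks of `lapMap` multiplies the total by `n`. A shift of every source by `s`
therefore prescribes the total of the potential, which selects one solution of `lap a β = h`. -/
lemma Regular.sum_potential_shifted (hP : P.Regular μ) {a : Fin n → Fin n → ℝ}
    (ha : P.IsWeight a) {h : Vec n l} (hh : ∑ i, h i = 0) (s : EuclideanSpace ℝ (Fin l)) :
    ∑ i, potential (shifted h s) a i = s := by
  have h1 := sum_potential ha.symm (ha.isUnit_lapMap hP.connected) (shifted h s)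
  simp only [shifted, Finset.sum_add_distrib, hh, zero_add, Finset.sum_const, Finset.card_univ,
    Fintype.card_fin, ← Nat.cast_smul_eq_nsmul ℝ] at h1
  exact smul_right_injective _ hP.cast_ne_zero h1

lemma Regular.lap_potential_shifted (hP : P.Regular μ) {a : Fin n → Fin n → ℝ}
    (ha : P.IsWeight a) {h : Vec n l} (hh : ∑ i, h i = 0) (s : EuclideanSpace ℝ (Fin l)) :
    lap a (potential (shifted h s) a) = h := by
  have h1 := lapMap_potential (ha.isUnit_lapMap hP.connected) (shifted h s)
  rw [lapMap_apply, hP.sum_potential_shifted ha hh] at h1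
  funext i
  exact add_right_cancel (congrFun h1 i)

/-- The distance-like function relative to a reference point. -/
def lyap (P : Problem n l) (xs : Vec n l) (θs : P.Mult) (c : Vec n l) (z : P.State) : ℝ :=
  2⁻¹ * nsq (z.x - xs) + 2⁻¹ * nsq (z.α - potential c z.a)
    + 2⁻¹ * P.csum fun i k j => (z.θ i k j - θs i k j) ^ 2

/-- The augmented-Lagrangian-like descent function relative to a reference point. -/
def descent (P : Problem n l) (xs : Vec n l) (z : P.State) : ℝ :=
  ∑ i, (P.f i (z.x i) - P.f i (xs i))
    + P.csum (fun i k j => z.θ i k j * (P.g i k j (z.x i k) - 2 * P.g i k j (xs i k)))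
    + lapForm z.a ((2⁻¹ : ℝ) • z.x + z.α) z.x

lemma lyap_nonneg (xs : Vec n l) (θs : P.Mult) (c : Vec n l) (z : P.State) :
    0 ≤ P.lyap xs θs c z := by
  have h1 := nsq_nonneg (z.x - xs)
  have h2 := nsq_nonneg (z.α - potential c z.a)
  have h3 : 0 ≤ P.csum fun i k j => (z.θ i k j - θs i k j) ^ 2 :=
    csum_nonneg fun _ _ _ => sq_nonneg _
  unfold lyap
  linarith

lemma continuous_csum {X : Type*} [TopologicalSpace X] {w : X → P.Mult}
    (h : ∀ i k j, Continuous fun x => w x i k j) : Continuous fun x => P.csum (w x) :=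
  continuous_finsetSum _ fun i _ => continuous_finsetSum _ fun k _ =>
    continuous_finsetSum _ fun j _ => h i k j

lemma continuous_x_apply (i : Fin n) (k : Fin l) : Continuous fun z : P.State => z.x i k :=
  (PiLp.continuous_apply 2 (fun _ : Fin l => ℝ) k).comp
    ((continuous_apply i).comp continuous_fst)

lemma continuous_θ_apply (i : Fin n) (k : Fin l) (j : Fin (P.m i k)) :
    Continuous fun z : P.State => z.θ i k j :=
  (continuous_apply j).comp <| (continuous_apply k).comp <| (continuous_apply i).comp
    (continuous_snd.comp (continuous_snd.comp continuous_snd))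

lemma Regular.continuous_descent (hP : P.Regular μ) (xs : Vec n l) :
    Continuous (P.descent xs) := by
  unfold descent
  refine Continuous.add (Continuous.add ?_ ?_) ?_
  · refine continuous_finsetSum _ fun i _ => Continuous.sub ?_ continuous_const
    exact (hP.f_diff i).continuous.comp ((continuous_apply i).comp continuous_fst)
  · refine continuous_csum fun i k j => (continuous_θ_apply i k j).mul (Continuous.sub ?_
      continuous_const)
    exact (hP.g_diff i k j).continuous.comp (continuous_x_apply i k)
  · have h1 : Continuous fun z : P.State => z.a := continuous_fst.comp continuous_snd
    have h2 : Continuous fun z : P.State => z.x := continuous_fst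
    have h3 : Continuous fun z : P.State => z.α :=
      continuous_fst.comp (continuous_snd.comp continuous_snd)
    exact h1.lapForm ((h2.const_smul (2⁻¹ : ℝ)).add h3) h2

lemma continuousAt_lyap (xs : Vec n l) (θs : P.Mult) (c : Vec n l) {z : P.State}
    (hz : IsUnit (lapMap z.a : Vec n l →L[ℝ] Vec n l)) : ContinuousAt (P.lyap xs θs c) z := by
  unfold lyap
  refine ContinuousAt.add (ContinuousAt.add ?_ ?_) ?_
  · have : Continuous fun z : P.State => z.x - xs := by unfold State.x; fun_prop
    exact (continuous_const.mul (continuous_nsq.comp this)).continuousAt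
  · refine continuousAt_const.mul (continuous_nsq.continuousAt.comp ?_)
    refine ContinuousAt.sub ?_ ?_
    · exact (continuous_fst.comp (continuous_snd.comp continuous_snd)).continuousAt
    · have h1 : ContinuousAt (fun z : P.State => z.a) z :=
        (continuous_fst.comp continuous_snd).continuousAt
      exact ContinuousAt.comp (g := potential c) (continuousAt_potential hz c) h1
  · refine (continuous_const.mul (continuous_csum fun i k j => ?_)).continuousAt
    exact ((continuous_θ_apply i k j).sub continuous_const).pow 2

section AlongSolutions

variable {z : ℝ → P.State} {t₀ t₁ : ℝ}

lemma IsSol.hasDerivWithinAt_lyap (hP : P.Regular μ) (hz : P.IsSol z t₀ t₁) (xs : Vec n l)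
    (θs : P.Mult) (c : Vec n l) {t : ℝ} (ht : t ∈ Ico t₀ t₁) :
    HasDerivWithinAt (fun s => P.lyap xs θs c (z s))
      (dot ((z t).x - xs) (P.xField (z t))
        + dot ((z t).α - potential c (z t).a) (lap (z t).a (z t).x
          - potential (-lap (P.aField (z t)) (potential c (z t).a)) (z t).a)
        + P.csum fun i k j => ((z t).θ i k j - θs i k j) * P.θField (z t) i k j) (Ici t) t := by
  have hu := (hz.adm t ⟨ht.1, ht.2.le⟩).1.isUnit_lapMap hP.connected
  have h1 := hasDerivWithinAt_nsq ((hz.primal t ht).sub_const xs)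
  have h2 := hasDerivWithinAt_nsq
    ((hz.dual t ht).fun_sub (hasDerivWithinAt_potential (hz.weights t ht) c hu))
  have h3 : HasDerivWithinAt (fun s => P.csum fun i k j => ((z s).θ i k j - θs i k j) ^ 2)
      (P.csum fun i k j => 2 * (((z t).θ i k j - θs i k j) * P.θField (z t) i k j)) (Ici t) t := by
    unfold csum
    refine HasDerivWithinAt.fun_sum fun i _ => HasDerivWithinAt.fun_sum fun k _ =>
      HasDerivWithinAt.fun_sum fun j _ => ?_
    exact (((hz.mult t ht i k j).sub_const (θs i k j)).pow 2).congr_deriv (by simp; ring)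
  refine (((h1.const_mul 2⁻¹).add (h2.const_mul 2⁻¹)).add (h3.const_mul 2⁻¹)).congr_deriv ?_
  rw [csum_mul_left]
  ring

/-- The `x`-gradient of `descent` is `-xField`, since the factor `2⁻¹` on `x` compensates the
doubling of the quadratic form; this yields `-nsq xField`. The remaining terms come from the motion
of `α`, `θ` and `a`. -/
lemma IsSol.hasDerivWithinAt_descent (hP : P.Regular μ) (hz : P.IsSol z t₀ t₁) (xs : Vec n l)
    {t : ℝ} (ht : t ∈ Ico t₀ t₁) :
    HasDerivWithinAt (fun s => P.descent xs (z s))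
      (-nsq (P.xField (z t)) + nsq (lap (z t).a (z t).x)
        + P.csum (fun i k j => P.θField (z t) i k j
          * (P.g i k j ((z t).x i k) - 2 * P.g i k j (xs i k)))
        + lapForm (P.aField (z t)) ((2⁻¹ : ℝ) • (z t).x + (z t).α) (z t).x) (Ici t) t := by
  have hsymm := (hz.adm t ⟨ht.1, ht.2.le⟩).1.symm
  have hx : ∀ i, HasDerivWithinAt (fun s => (z s).x i) (P.xField (z t) i) (Ici t) t :=
    hasDerivWithinAt_pi.mp (hz.primal t ht)
  have hxk : ∀ i k, HasDerivWithinAt (fun s => (z s).x i k) (P.xField (z t) i k) (Ici t) t := by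
    intro i k
    exact ((PiLp.proj 2 (fun _ : Fin l => ℝ) k : EuclideanSpace ℝ (Fin l) →L[ℝ] ℝ).hasFDerivAt
      (x := (z t).x i)).comp_hasDerivWithinAt t (hx i)
  have h1 : HasDerivWithinAt (fun s => ∑ i, (P.f i ((z s).x i) - P.f i (xs i)))
      (dot (P.grad (z t).x) (P.xField (z t))) (Ici t) t := by
    refine HasDerivWithinAt.fun_sum fun i _ => HasDerivWithinAt.sub_const _ ?_
    have := (hP.f_diff i ((z t).x i)).hasFDerivAt.comp_hasDerivWithinAt t (hx i)
    rw [← inner_gradient_left] at this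
    exact this
  have h2 : HasDerivWithinAt (fun s => P.csum fun i k j =>
        (z s).θ i k j * (P.g i k j ((z s).x i k) - 2 * P.g i k j (xs i k)))
      (P.csum (fun i k j => P.θField (z t) i k j
          * (P.g i k j ((z t).x i k) - 2 * P.g i k j (xs i k)))
        + dot (P.xField (z t)) (P.force (z t).x (z t).θ)) (Ici t) t := by
    rw [dot_force, ← csum_add]
    unfold csum
    refine HasDerivWithinAt.fun_sum fun i _ => HasDerivWithinAt.fun_sum fun k _ =>
      HasDerivWithinAt.fun_sum fun j _ => ?_
    have hg := (hP.g_diff i k j ((z t).x i k)).hasDerivAt.comp_hasDerivWithinAt t (hxk i k)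
    exact ((hz.mult t ht i k j).mul (hg.sub_const _)).congr_deriv
      (by simp only [Function.comp_apply]; ring)
  have h3 := hasDerivWithinAt_lapForm (hz.weights t ht)
    (((hz.primal t ht).const_smul (2⁻¹ : ℝ)).add (hz.dual t ht)) (hz.primal t ht)
  refine ((h1.add h2).add h3).congr_deriv ?_
  have e1 : dot (P.xField (z t)) (P.xField (z t)) = -dot (P.xField (z t)) (P.grad (z t).x)
      - dot (P.xField (z t)) (lap (z t).a (z t).x) - dot (P.xField (z t)) (lap (z t).a (z t).α)
      - dot (P.xField (z t)) (P.force (z t).x (z t).θ) := by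
    nth_rewrite 2 [xField_eq]
    rw [dot_sub_right, dot_sub_right, dot_sub_right, dot_neg_right]
  have e2 : lapForm (z t).a (lap (z t).a (z t).x) (z t).x = nsq (lap (z t).a (z t).x) := by
    rw [lapForm_eq_dot, dot_self]
  have e3 : lapForm (z t).a (z t).x (P.xField (z t))
      = dot (P.xField (z t)) (lap (z t).a (z t).x) := by rw [lapForm_comm hsymm]; rfl
  have e4 : lapForm (z t).a (z t).α (P.xField (z t))
      = dot (P.xField (z t)) (lap (z t).a (z t).α) := by rw [lapForm_comm hsymm]; rfl
  have e5 : lapForm (z t).a (P.xField (z t)) (z t).x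
      = dot (P.xField (z t)) (lap (z t).a (z t).x) := rfl
  rw [← dot_self (P.xField (z t)), e1]
  simp only [Pi.add_apply, Pi.smul_apply, lapForm_add_left, lapForm_smul_left, e2, e3, e4, e5,
    dot_comm (P.grad (z t).x)]
  ring

lemma IsSol.hasDerivWithinAt_wsum (hz : P.IsSol z t₀ t₁) {t : ℝ} (ht : t ∈ Ico t₀ t₁) :
    HasDerivWithinAt (fun s => wsum (z s).a) (wsum (P.aField (z t))) (Ici t) t := by
  unfold wsum
  exact HasDerivWithinAt.fun_sum fun i _ => HasDerivWithinAt.fun_sum fun q _ =>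
    hasDerivWithinAt_pi.mp (hasDerivWithinAt_pi.mp (hz.weights t ht) i) q

lemma IsSol.continuousOn_lyap (hP : P.Regular μ) (hz : P.IsSol z t₀ t₁) (xs : Vec n l)
    (θs : P.Mult) (c : Vec n l) : ContinuousOn (fun s => P.lyap xs θs c (z s)) (Icc t₀ t₁) :=
  fun t ht => ContinuousAt.comp_continuousWithinAt (g := P.lyap xs θs c)
    (continuousAt_lyap xs θs c ((hz.adm t ht).1.isUnit_lapMap hP.connected)) (hz.cont t ht)

lemma continuous_wsum : Continuous (wsum : (Fin n → Fin n → ℝ) → ℝ) := by unfold wsum; fun_prop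

lemma IsSol.continuousOn_wsum (hz : P.IsSol z t₀ t₁) :
    ContinuousOn (fun s => wsum (z s).a) (Icc t₀ t₁) :=
  (continuous_wsum.comp (continuous_fst.comp continuous_snd)).comp_continuousOn hz.cont

end AlongSolutions

/-! ### Differential inequalities for the two functions. -/

section Estimates

lemma aField_of_eq_zero {z : P.State} (hz : P.IsWeight z.a) {i q : Fin n} (h : z.a i q = 0) :
    P.aField z i q = 0 := by
  unfold aField
  rw [if_neg fun hadj => (hz.pos i q hadj).ne' h]

/-- The derivative of `lyap` along the dynamics. -/
lemma Regular.lyap_deriv_le (hP : P.Regular μ) {xs h : Vec n l} {θs : P.Mult}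
    (href : P.IsRef xs h θs) (s : EuclideanSpace ℝ (Fin l)) {z : P.State}
    (hz : P.IsAdmissible z) :
    dot (z.x - xs) (P.xField z)
        + dot (z.α - potential (shifted h s) z.a) (lap z.a z.x
          - potential (-lap (P.aField z) (potential (shifted h s) z.a)) z.a)
        + P.csum (fun i k j => (z.θ i k j - θs i k j) * P.θField z i k j)
      ≤ -P.diss μ xs z + (∑ i, ‖h i‖) * (∑ i, ‖z.α i - potential (shifted h s) z.a i‖)
        * ∑ i, ∑ q, P.aField z i q / z.a i q ^ 2 := by
  have hβ := hP.lap_potential_shifted hz.1 href.sum_source s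
  have h1 := hP.diss_le href hz hβ
  have h2 := abs_dot_potential_deriv_le hz.1.symm hz.1.nonneg
    (aField_symm hP.d_symm z) (aField_nonneg hP.d_pos z) (fun i q => aField_of_eq_zero hz.1)
    (hz.1.isUnit_lapMap hP.connected) (potential (shifted h s) z.a)
    (z.α - potential (shifted h s) z.a)
  rw [hβ] at h2
  have h3 := (abs_le.mp h2).1
  rw [dot_sub_right]
  simp only [Pi.sub_apply] at h3 ⊢
  linarith

/-- The rate of the weights is controlled by the primal error and the primal velocity. -/
lemma exists_wsum_aField_le (P : Problem n l) :
    ∃ C : ℝ, 0 < C ∧ ∀ (xs : Vec n l), (∀ i q, xs i = xs q) → ∀ z : P.State,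
      wsum (P.aField z) ≤ C * (nsq (z.x - xs) + nsq (P.xField z)) := by
  -- Absolute values because the gains are unconstrained off the edges; the 1 makes the constant
  -- positive.
  refine ⟨4 * wsum (fun i q => |P.d i q|) + 1,
    by have := wsum_nonneg (a := fun i q => |P.d i q|) (fun _ _ => abs_nonneg _); linarith,
    fun xs hxs z => ?_⟩
  have hnn : 0 ≤ nsq (z.x - xs) + nsq (P.xField z) := add_nonneg (nsq_nonneg _) (nsq_nonneg _)
  have h1 : ∀ i q, P.aField z i q
      ≤ |P.d i q| * (4 * (nsq (z.x - xs) + nsq (P.xField z))) := by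
    intro i q
    unfold aField
    split_ifs with h
    · have e1 := norm_sub_sq_le_nsq (z.x - xs) i q
      have e2 := norm_sub_sq_le_nsq (P.xField z) i q
      have e3 : (z.x - xs) i - (z.x - xs) q = z.x i - z.x q := by
        simp only [Pi.sub_apply, hxs i q]; abel
      rw [e3] at e1
      refine mul_le_mul (le_abs_self _) (by linarith) (by positivity) (abs_nonneg _)
    · positivity
  have h2 : wsum (P.aField z)
      ≤ wsum (fun i q => |P.d i q|) * (4 * (nsq (z.x - xs) + nsq (P.xField z))) :=
    (Finset.sum_le_sum fun i _ => Finset.sum_le_sum fun q _ => h1 i q).trans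
      (sum_sum_mul_le (b := fun _ _ => 4 * (nsq (z.x - xs) + nsq (P.xField z)))
        (fun _ _ => abs_nonneg _) fun _ _ => le_rfl)
  linarith

/-- Edge-wise control of the form `(x/2 + α)ᵀ (L(b) ⊗ I) x`. -/
lemma abs_lapForm_half_add_le {b : Fin n → Fin n → ℝ} (hb : ∀ i q, b i q = b q i)
    (h0 : ∀ i q, 0 ≤ b i q) (hz : ∀ i q, ¬ P.G.Adj i q → b i q = 0) {x α : Vec n l} {ω : ℝ}
    (hω : ∀ i q, P.G.Adj i q → ‖x i - x q‖ * (‖x i - x q‖ + ‖α i - α q‖) ≤ ω) :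
    |lapForm b ((2⁻¹ : ℝ) • x + α) x| ≤ wsum b * ω := by
  have h1 : ∀ i q, |b i q * inner ℝ (((2⁻¹ : ℝ) • x + α) i - ((2⁻¹ : ℝ) • x + α) q) (x i - x q)|
      ≤ b i q * ω := by
    intro i q
    by_cases hadj : P.G.Adj i q
    · rw [abs_mul, abs_of_nonneg (h0 i q)]
      refine mul_le_mul_of_nonneg_left ?_ (h0 i q)
      refine (abs_real_inner_le_norm _ _).trans (le_trans ?_ (hω i q hadj))
      rw [mul_comm]
      refine mul_le_mul_of_nonneg_left ?_ (norm_nonneg _)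
      have e : ((2⁻¹ : ℝ) • x + α) i - ((2⁻¹ : ℝ) • x + α) q
          = (2⁻¹ : ℝ) • (x i - x q) + (α i - α q) := by
        simp only [Pi.add_apply, Pi.smul_apply, smul_sub]; abel
      rw [e]
      refine (norm_add_le _ _).trans (add_le_add_left ?_ _)
      rw [norm_smul]
      have : ‖(2⁻¹ : ℝ)‖ ≤ 1 := by norm_num
      nlinarith [norm_nonneg (x i - x q)]
    · rw [hz i q hadj]; simp
  rw [lapForm_eq_sum hb, abs_mul, abs_of_pos (by norm_num : (0 : ℝ) < 2⁻¹)]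
  have h2 : |∑ i, ∑ q, b i q * inner ℝ (((2⁻¹ : ℝ) • x + α) i - ((2⁻¹ : ℝ) • x + α) q) (x i - x q)|
      ≤ wsum b * ω := by
    rw [wsum, Finset.sum_mul]
    refine (Finset.abs_sum_le_sum_abs _ _).trans (Finset.sum_le_sum fun i _ => ?_)
    rw [Finset.sum_mul]
    exact (Finset.abs_sum_le_sum_abs _ _).trans (Finset.sum_le_sum fun q _ => h1 i q)
  have h3 := abs_nonneg
    (∑ i, ∑ q, b i q * inner ℝ (((2⁻¹ : ℝ) • x + α) i - ((2⁻¹ : ℝ) • x + α) q) (x i - x q))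
  linarith

/-- With `v = g(x)` and `w = g(xs)` this explains the factor 2 in `descent`: it completes the
square, so the contribution of the `θ`-motion is quadratic in `x - xs` even for constraints inactive
at `xs`. -/
lemma proj_mul_le (v w y : ℝ) : proj v y * (v - 2 * w) ≤ (v - w) ^ 2 := by
  unfold proj
  split_ifs
  · nlinarith [sq_nonneg w]
  · rw [zero_mul]; positivity

/-- Lipschitz bound for the constraints near the reference point. -/
lemma Regular.exists_csum_sq_le (hP : P.Regular μ) (xs : Vec n l) (R : ℝ) :
    ∃ C : ℝ, 0 ≤ C ∧ ∀ x : Vec n l, nsq (x - xs) ≤ R →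
      P.csum (fun i k j => (P.g i k j (x i k) - P.g i k j (xs i k)) ^ 2) ≤ C * nsq (x - xs) := by
  have hone : ∀ i k j, ∃ C : ℝ, 0 ≤ C ∧ ∀ s ∈ Metric.closedBall (xs i k) (R + 1),
      (P.g i k j s - P.g i k j (xs i k)) ^ 2 ≤ C * (s - xs i k) ^ 2 := by
    intro i k j
    -- `R` bounds a squared distance, and `R + 1` exceeds its root.
    obtain ⟨C, hC⟩ := (isCompact_closedBall (xs i k) (R + 1)).exists_bound_of_continuousOn
      (hP.deriv_cont i k j).continuousOn
    rcases lt_or_ge (R + 1) 0 with hR | hR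
    · refine ⟨0, le_rfl, fun s hs => ?_⟩
      rw [Metric.closedBall_eq_empty.mpr hR] at hs
      exact absurd hs (notMem_empty _)
    refine ⟨C ^ 2, by positivity, fun s hs => ?_⟩
    have h1 := (convex_closedBall (xs i k) (R + 1)).norm_image_sub_le_of_norm_deriv_le
      (fun y _ => hP.g_diff i k j y) hC (Metric.mem_closedBall_self hR) hs
    rw [← mul_pow]
    rw [Real.norm_eq_abs, Real.norm_eq_abs] at h1
    have h0 : 0 ≤ C := (norm_nonneg _).trans (hC _ (Metric.mem_closedBall_self hR))
    rw [← abs_of_nonneg h0, ← abs_mul] at h1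
    exact sq_le_sq.mpr h1
  choose C hC0 hC using hone
  refine ⟨P.csum C, csum_nonneg hC0, fun x hx => ?_⟩
  have hcoord : ∀ i k, (x i k - xs i k) ^ 2 ≤ nsq (x - xs) := by
    intro i k
    refine le_trans ?_ (norm_sq_le_nsq (x - xs) i)
    rw [EuclideanSpace.real_norm_sq_eq]
    exact Finset.single_le_sum (f := fun k => ((x - xs) i k) ^ 2) (fun _ _ => sq_nonneg _)
      (Finset.mem_univ k)
  rw [mul_comm, ← csum_mul_left]
  refine csum_le fun i k j => ?_
  have hmem : x i k ∈ Metric.closedBall (xs i k) (R + 1) := by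
    rw [Metric.mem_closedBall, Real.dist_eq]
    have := (hcoord i k).trans hx
    have h0 := sq_nonneg (x i k - xs i k)
    exact abs_le_of_sq_le_sq (by nlinarith) (by linarith)
  refine (hC i k j _ hmem).trans ?_
  rw [mul_comm]
  exact mul_le_mul_of_nonneg_right (hcoord i k) (hC0 i k j)

/-- The derivative of `descent` along the dynamics. -/
lemma Regular.descent_deriv_le (hP : P.Regular μ) {xs : Vec n l} {z : P.State}
    (hz : P.IsAdmissible z) {C ω : ℝ}
    (hC : P.csum (fun i k j => (P.g i k j (z.x i k) - P.g i k j (xs i k)) ^ 2)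
      ≤ C * nsq (z.x - xs))
    (hω : ∀ i q, P.G.Adj i q → ‖z.x i - z.x q‖ * (‖z.x i - z.x q‖ + ‖z.α i - z.α q‖) ≤ ω) :
    -nsq (P.xField z) + nsq (lap z.a z.x)
        + P.csum (fun i k j => P.θField z i k j
          * (P.g i k j (z.x i k) - 2 * P.g i k j (xs i k)))
        + lapForm (P.aField z) ((2⁻¹ : ℝ) • z.x + z.α) z.x
      ≤ -nsq (P.xField z) + 2 * wsum z.a * lapForm z.a z.x z.x + C * nsq (z.x - xs)
        + wsum (P.aField z) * ω := by
  have h1 := nsq_lap_le hz.1.symm hz.1.nonneg z.x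
  have h2 : P.csum (fun i k j => P.θField z i k j
      * (P.g i k j (z.x i k) - 2 * P.g i k j (xs i k))) ≤ C * nsq (z.x - xs) :=
    (csum_le fun i k j => proj_mul_le _ _ _).trans hC
  have h3 := (abs_le.mp (abs_lapForm_half_add_le (aField_symm hP.d_symm z)
    (aField_nonneg hP.d_pos z) (fun i q hadj => by simp [aField, hadj]) hω)).2
  linarith

end Estimates

end Problem

/-! ### Local Lyapunov stability of KKT states. -/

/-- A continuity argument: a curve that is pushed to half the radius as long as it stays inside a
ball cannot leave the ball. -/
lemma dist_lt_of_trap {X : Type*} [PseudoMetricSpace X] {z : ℝ → X} {zs : X} {t₀ t₁ r : ℝ}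
    (hr : 0 < r) (hc : ContinuousOn z (Icc t₀ t₁)) (h0 : dist (z t₀) zs < r)
    (htrap : ∀ τ ∈ Icc t₀ t₁, (∀ t ∈ Icc t₀ τ, dist (z t) zs < r) → dist (z τ) zs ≤ r / 2) :
    ∀ t ∈ Icc t₀ t₁, dist (z t) zs < r := by
  by_contra! hbad
  obtain ⟨t, ht, htr⟩ := hbad
  have hdc : ContinuousOn (fun t => dist (z t) zs) (Icc t₀ t₁) := (continuous_id.dist continuous_const).comp_continuousOn hc
  have hcomp : IsCompact (Icc t₀ t₁ ∩ (fun t => dist (z t) zs) ⁻¹' Ici r) :=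
    isCompact_Icc.of_isClosed_subset (hdc.preimage_isClosed_of_isClosed isClosed_Icc isClosed_Ici)
      inter_subset_left
  obtain ⟨τ, hτ, hmin⟩ := hcomp.exists_isLeast ⟨t, ht, htr⟩
  have hτr : r ≤ dist (z τ) zs := hτ.2
  have hlt : t₀ < τ := by
    refine lt_of_le_of_ne hτ.1.1 fun h => ?_
    rw [← h] at hτr
    exact absurd h0 (not_lt.mpr hτr)
  have hin : ∀ s ∈ Ico t₀ τ, dist (z s) zs < r := by
    intro s hs
    by_contra! hcon
    exact absurd (hmin ⟨⟨hs.1, hs.2.le.trans hτ.1.2⟩, hcon⟩) (not_le.mpr hs.2)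
  have hhalf : ∀ s ∈ Ico t₀ τ, dist (z s) zs ≤ r / 2 := fun s hs =>
    htrap s ⟨hs.1, hs.2.le.trans hτ.1.2⟩ fun u hu => hin u ⟨hu.1, hu.2.trans_lt hs.2⟩
  have hcl : τ ∈ closure (Ico t₀ τ) := by
    rw [closure_Ico hlt.ne]; exact right_mem_Icc.mpr hlt.le
  have := ContinuousWithinAt.closure_le (f := fun t => dist (z t) zs) (g := fun _ => r / 2) hcl
    ((hdc τ hτ.1).mono fun s hs => ⟨hs.1, hs.2.le.trans hτ.1.2⟩) continuousWithinAt_const hhalf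
  linarith

namespace Problem

variable {P : Problem n l} {μ : ℝ}

lemma IsSol.le_a {z : ℝ → P.State} {t₀ t₁ : ℝ} (hP : P.Regular μ) (hz : P.IsSol z t₀ t₁) {t : ℝ}
    (ht : t ∈ Icc t₀ t₁) (i q : Fin n) : (z t₀).a i q ≤ (z t).a i q := by
  have hc : ContinuousOn (fun t => (z t).a i q) (Icc t₀ t) := by
    have h1 : ContinuousOn (fun t => (z t).a) (Icc t₀ t₁) :=
      (continuous_fst.comp continuous_snd).comp_continuousOn hz.cont
    exact (continuousOn_pi.mp (continuousOn_pi.mp h1 i) q).mono (Icc_subset_Icc_right ht.2)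
  have := le_of_right_deriv_nonpos (f := fun t => -(z t).a i q) ht.1 hc.neg
    (fun s hs => (hasDerivWithinAt_pi.mp (hasDerivWithinAt_pi.mp
      (hz.weights s ⟨hs.1, hs.2.trans_le ht.2⟩) i) q).neg)
    (fun s _ => neg_nonpos.mpr (aField_nonneg hP.d_pos _ _ _))
  linarith

lemma IsSol.a_sub_le {z : ℝ → P.State} {t₀ t₁ : ℝ} (hP : P.Regular μ) (hz : P.IsSol z t₀ t₁)
    {t : ℝ} (ht : t ∈ Icc t₀ t₁) (i q : Fin n) :
    (z t).a i q - (z t₀).a i q ≤ wsum (z t).a - wsum (z t₀).a := by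
  have h := le_wsum (a := fun i q => (z t).a i q - (z t₀).a i q)
    (fun i q => sub_nonneg.mpr (hz.le_a hP ht i q)) i q
  have e : wsum (fun i q => (z t).a i q - (z t₀).a i q) = wsum (z t).a - wsum (z t₀).a := by
    simp [wsum, Finset.sum_sub_distrib]
  linarith

/-- Quadratic lower bound for `descent` in terms of `lyap`, for bounded weights. -/
lemma Regular.exists_descent_ge (hP : P.Regular μ) {xs h : Vec n l} {θs : P.Mult}
    (href : P.IsRef xs h θs) (s : EuclideanSpace ℝ (Fin l)) (A : ℝ) :
    ∃ C : ℝ, 0 ≤ C ∧ ∀ z : P.State, P.IsAdmissible z → wsum z.a ≤ A →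
      -(C * P.lyap xs θs (shifted h s) z) ≤ P.descent xs z := by
  set D := P.csum fun i k j => deriv (P.g i k j) (xs i k) ^ 2 with hD
  have hD0 : 0 ≤ D := csum_nonneg fun _ _ _ => sq_nonneg _
  -- `D` comes from the product of `x - xs` with `θ - θs`, and `4 * A ^ 2` bounds the squared norm
  -- of the Laplacian acting on `α - β`.
  refine ⟨2 + D + 4 * A ^ 2, by positivity, fun z hz hA => ?_⟩
  set β := potential (shifted h s) z.a with hβ
  have hlap : lap z.a β = h := hP.lap_potential_shifted hz.1 href.sum_source s
  have hA0 := wsum_nonneg hz.1.nonneg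
  set y := z.x - xs with hy
  have hyk : ∀ i k, y i k = z.x i k - xs i k := fun i k => rfl
  have h1 : dot y (P.grad xs) ≤ ∑ i, (P.f i (z.x i) - P.f i (xs i)) := by
    rw [dot_comm, dot]
    exact Finset.sum_le_sum fun i _ => by
      have e : inner ℝ (gradient (P.f i) (xs i)) (z.x i - xs i) ≤ P.f i (z.x i) - P.f i (xs i) := by
        linarith [hP.f_convex i (xs i) (z.x i)]
      exact e
  have h2 : dot y (P.force xs z.θ)
      ≤ P.csum fun i k j => z.θ i k j * (P.g i k j (z.x i k) - 2 * P.g i k j (xs i k)) := by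
    rw [dot_force]
    refine csum_le fun i k j => ?_
    have e1 := mul_le_mul_of_nonneg_left (hP.g_lower i k j (xs i k) (z.x i k)) (hz.2 i k j)
    have e2 := mul_nonneg (hz.2 i k j) (neg_nonneg.mpr (href.feasible i k j))
    rw [hyk]
    nlinarith
  have h3 : lapForm z.a ((2⁻¹ : ℝ) • z.x + z.α) z.x
      = 2⁻¹ * lapForm z.a z.x z.x + dot y (lap z.a z.α) := by
    have e : dot y (lap z.a z.α) = lapForm z.a z.x z.α := by
      rw [dot_lap_comm hz.1.symm, hy, lap_sub_consensus z.a href.consensus, lapForm_eq_dot,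
        dot_lap_comm hz.1.symm]
    rw [lapForm_add_left, lapForm_smul_left, lapForm_comm hz.1.symm z.α, e]
  have h4 := lapForm_self_nonneg hz.1.symm hz.1.nonneg z.x
  -- Splitting `α` at `β` brings out `h`, whose definition cancels the first-order terms of the
  -- convexity bounds. Only products of two deviations remain.
  have h5 : dot y (lap z.a z.α) = dot y (lap z.a (z.α - β)) + dot y h := by
    rw [lap_sub, hlap, dot_sub_right]; ring
  have h6 : dot y h = -dot y (P.grad xs) - dot y (P.force xs θs) := by
    rw [href.source, dot_sub_right, dot_neg_right]
  have h7 : -(2⁻¹ * (D * nsq y) + 2⁻¹ * P.csum fun i k j => (z.θ i k j - θs i k j) ^ 2)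
      ≤ dot y (P.force xs z.θ) - dot y (P.force xs θs) := by
    have hcoord : ∀ i k, (y i k) ^ 2 ≤ nsq y := by
      intro i k
      refine le_trans ?_ (norm_sq_le_nsq y i)
      rw [EuclideanSpace.real_norm_sq_eq]
      exact Finset.single_le_sum (f := fun k => (y i k) ^ 2) (fun _ _ => sq_nonneg _)
        (Finset.mem_univ k)
    have e : 2⁻¹ * (D * nsq y) + 2⁻¹ * P.csum (fun i k j => (z.θ i k j - θs i k j) ^ 2)
        = P.csum fun i k j => 2⁻¹ * nsq y * deriv (P.g i k j) (xs i k) ^ 2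
          + 2⁻¹ * (z.θ i k j - θs i k j) ^ 2 := by
      rw [csum_add, csum_mul_left, csum_mul_left]; ring
    rw [e, dot_force, dot_force, ← csum_sub]
    have e2 : ∀ w : P.Mult, -P.csum w = P.csum fun i k j => -w i k j := fun w => by simp [csum]
    rw [e2]
    refine csum_le fun i k j => ?_
    have e3 := mul_le_mul_of_nonneg_right (hcoord i k) (sq_nonneg (deriv (P.g i k j) (xs i k)))
    nlinarith [sq_nonneg (y i k * deriv (P.g i k j) (xs i k) + (z.θ i k j - θs i k j))]
  have h8 := two_mul_abs_dot_le one_pos y (lap z.a (z.α - β))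
  have h9 := (abs_le.mp (le_refl |dot y (lap z.a (z.α - β))|)).1
  have h10 := nsq_lap_le hz.1.symm hz.1.nonneg (z.α - β)
  have h11 := lapForm_self_le hz.1.symm hz.1.nonneg (z.α - β)
  have h12 : nsq (lap z.a (z.α - β)) ≤ 4 * A ^ 2 * nsq (z.α - β) := by
    have e1 : 2 * wsum z.a * lapForm z.a (z.α - β) (z.α - β)
        ≤ 2 * wsum z.a * (2 * wsum z.a * nsq (z.α - β)) := by gcongr
    have e2 : wsum z.a ^ 2 ≤ A ^ 2 := by gcongr
    have e3 := mul_le_mul_of_nonneg_right e2 (nsq_nonneg (z.α - β))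
    nlinarith
  have hV : P.lyap xs θs (shifted h s) z = 2⁻¹ * nsq y + 2⁻¹ * nsq (z.α - β)
    + 2⁻¹ * P.csum fun i k j => (z.θ i k j - θs i k j) ^ 2 := rfl
  have hn1 := nsq_nonneg y
  have hn2 := nsq_nonneg (z.α - β)
  have hn3 : 0 ≤ P.csum fun i k j => (z.θ i k j - θs i k j) ^ 2 :=
    csum_nonneg fun _ _ _ => sq_nonneg _
  have hdes : P.descent xs z = ∑ i, (P.f i (z.x i) - P.f i (xs i))
    + P.csum (fun i k j => z.θ i k j * (P.g i k j (z.x i k) - 2 * P.g i k j (xs i k)))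
    + lapForm z.a ((2⁻¹ : ℝ) • z.x + z.α) z.x := rfl
  rw [div_one, one_mul] at h8
  have p1 := mul_nonneg hD0 hn1
  have p2 := mul_nonneg hD0 hn2
  have p3 := mul_nonneg hD0 hn3
  have p4 := mul_nonneg (sq_nonneg A) hn1
  have p5 := mul_nonneg (sq_nonneg A) hn3
  have p6 := mul_nonneg (sq_nonneg A) hn2
  rw [hV, hdes, h3, h5, h6]
  nlinarith

/-- States with small `lyap` and weights close to those of `zs` are close to `zs`. -/
lemma exists_dist_lt_of_lyap_lt {zs : P.State} {c : Vec n l}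
    (hu : IsUnit (lapMap zs.a : Vec n l →L[ℝ] Vec n l)) (hc : potential c zs.a = zs.α) {ε : ℝ}
    (hε : 0 < ε) : ∃ κ > 0, ∀ z : P.State, P.lyap zs.x zs.θ c z < κ →
      (∀ i q, |z.a i q - zs.a i q| < κ) → dist z zs < ε := by
  have hcont := continuousAt_potential hu c
  rw [Metric.continuousAt_iff] at hcont
  obtain ⟨κ₁, hκ₁, hpot⟩ := hcont (ε / 2) (by positivity)
  rw [hc] at hpot
  -- `lyap < ε ^ 2 / 8` puts each block within `ε / 2` of its target. For `α` the other `ε / 2` pays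
  -- for the displacement of the potential.
  refine ⟨min (min κ₁ ε) (ε ^ 2 / 8), by positivity, fun z hV ha => ?_⟩
  have hV2 : P.lyap zs.x zs.θ c z < ε ^ 2 / 8 := hV.trans_le (min_le_right _ _)
  have ha1 : ∀ i q, |z.a i q - zs.a i q| < κ₁ := fun i q =>
    (ha i q).trans_le ((min_le_left _ _).trans (min_le_left _ _))
  have ha2 : ∀ i q, |z.a i q - zs.a i q| < ε := fun i q =>
    (ha i q).trans_le ((min_le_left _ _).trans (min_le_right _ _))
  have n1 := nsq_nonneg (z.x - zs.x)
  have n2 := nsq_nonneg (z.α - potential c z.a)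
  have hθnn : ∀ i k j, 0 ≤ (z.θ i k j - zs.θ i k j) ^ 2 := fun _ _ _ => sq_nonneg _
  have n3 : 0 ≤ P.csum fun i k j => (z.θ i k j - zs.θ i k j) ^ 2 := csum_nonneg hθnn
  unfold lyap at hV2
  have hx : ∀ i, dist (z.x i) (zs.x i) < ε := by
    intro i
    rw [dist_eq_norm]
    have := norm_sq_le_nsq (z.x - zs.x) i
    rw [Pi.sub_apply] at this
    exact lt_of_pow_lt_pow_left₀ 2 hε.le (by nlinarith)
  have hα : ∀ i, dist (z.α i) (potential c z.a i) < ε / 2 := by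
    intro i
    rw [dist_eq_norm]
    have := norm_sq_le_nsq (z.α - potential c z.a) i
    rw [Pi.sub_apply] at this
    exact lt_of_pow_lt_pow_left₀ 2 (by positivity) (by nlinarith)
  have hθ : ∀ i k j, dist (z.θ i k j) (zs.θ i k j) < ε := by
    intro i k j
    have := le_csum hθnn i k j
    rw [Real.dist_eq]
    exact lt_of_pow_lt_pow_left₀ 2 hε.le (by rw [sq_abs]; nlinarith)
  have hda : dist z.a zs.a < κ₁ := by
    rw [dist_pi_lt_iff hκ₁]; intro i
    rw [dist_pi_lt_iff hκ₁]; intro q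
    exact ha1 i q
  have hpot' := hpot hda
  rw [Prod.dist_eq, max_lt_iff, Prod.dist_eq, max_lt_iff, Prod.dist_eq, max_lt_iff]
  refine ⟨(dist_pi_lt_iff hε).mpr hx, ?_, ?_, ?_⟩
  · rw [dist_pi_lt_iff hε]; intro i
    rw [dist_pi_lt_iff hε]; intro q
    exact ha2 i q
  · rw [dist_pi_lt_iff hε]; intro i
    have h1 := dist_triangle (z.α i) (potential c z.a i) (zs.α i)
    have h2 := dist_le_pi_dist (potential c z.a) zs.α i
    have h3 := hα i
    exact h1.trans_lt (by linarith)
  · rw [dist_pi_lt_iff hε]; intro i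
    rw [dist_pi_lt_iff hε]; intro k
    rw [dist_pi_lt_iff hε]; intro j
    exact hθ i k j

end Problem

namespace Problem

variable {P : Problem n l} {μ : ℝ}

lemma nsq_le_of_dist_le {z zs : P.State} {r : ℝ} (h : dist z zs ≤ r) :
    nsq (z.x - zs.x) ≤ n * r ^ 2 := by
  have h1 : ∀ i, ‖(z.x - zs.x) i‖ ^ 2 ≤ r ^ 2 := by
    intro i
    have h2 : dist (z.x i) (zs.x i) ≤ r :=
      (dist_le_pi_dist z.x zs.x i).trans ((le_max_left _ _).trans h)
    rw [dist_eq_norm] at h2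
    exact pow_le_pow_left₀ (norm_nonneg _) h2 2
  calc nsq (z.x - zs.x) ≤ ∑ _i : Fin n, r ^ 2 := Finset.sum_le_sum fun i _ => h1 i
    _ = n * r ^ 2 := by simp

lemma abs_a_sub_le_dist (z zs : P.State) (i q : Fin n) : |z.a i q - zs.a i q| ≤ dist z zs := by
  rw [← Real.dist_eq]
  exact ((dist_le_pi_dist (z.a i) (zs.a i) q).trans (dist_le_pi_dist z.a zs.a i)).trans
    ((le_max_left _ _).trans (le_max_right _ _))

/-- Uniform bounds near a saddle-point state. -/
lemma Regular.eventually_local_bounds (hP : P.Regular μ) {zs : P.State} (hzs : P.IsAdmissible zs)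
    (hkkt : P.KKT zs.a zs.x zs.α zs.θ) {κ : ℝ} (hκ : 0 < κ) :
    ∃ r > 0, r ≤ 1 ∧ ∀ z : P.State, dist z zs < r → P.IsAdmissible z →
      (∑ i, ‖lap zs.a zs.α i‖) * (∑ i, ‖z.α i
          - potential (shifted (lap zs.a zs.α) (∑ i, zs.α i)) z.a i‖)
        * ∑ i, ∑ q, P.aField z i q / z.a i q ^ 2 ≤ κ * wsum (P.aField z) ∧
      ∀ i q, P.G.Adj i q → ‖z.x i - z.x q‖ * (‖z.x i - z.x q‖ + ‖z.α i - z.α q‖) ≤ κ := by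
  have hu := hzs.1.isUnit_lapMap (l := l) hP.connected
  have hpot : potential (shifted (lap zs.a zs.α) (∑ i, zs.α i)) zs.a = zs.α :=
    eq_potential hu (by rw [lapMap_apply]; rfl)
  have hm : ∀ᶠ m : ℝ in 𝓝[>] 0, ∀ i q, P.G.Adj i q → m < zs.a i q := by
    simp only [eventually_all]
    intro i q hadj
    exact (eventually_lt_nhds (hzs.1.pos i q hadj)).filter_mono nhdsWithin_le_nhds
  obtain ⟨m, hm, hm0⟩ := (hm.and self_mem_nhdsWithin).exists
  have hm0 : (0 : ℝ) < m := hm0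
  have hca : Continuous fun z : P.State => z.a := continuous_fst.comp continuous_snd
  have hcx : Continuous fun z : P.State => z.x := continuous_fst
  have hcα : Continuous fun z : P.State => z.α :=
    continuous_fst.comp (continuous_snd.comp continuous_snd)
  have ev1 : ∀ᶠ z : P.State in 𝓝 zs, ∀ i q, P.G.Adj i q → m < z.a i q := by
    simp only [eventually_all]
    intro i q hadj
    have : Continuous fun z : P.State => z.a i q :=
      (continuous_apply q).comp ((continuous_apply i).comp hca)
    exact this.continuousAt.eventually_const_lt (hm i q hadj)
  -- At `zs` the potential equals `α`, so the drift coefficient vanishes there and is small nearby.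
  -- The lower bound `m` on edge weights turns `∑ a'/a²` into a multiple of the total weight rate.
  have ev2 : ∀ᶠ z : P.State in 𝓝 zs, (∑ i, ‖lap zs.a zs.α i‖) * (∑ i, ‖z.α i
      - potential (shifted (lap zs.a zs.α) (∑ i, zs.α i)) z.a i‖) < κ * m ^ 2 := by
    have hc1 : ContinuousAt (fun z : P.State =>
        potential (shifted (lap zs.a zs.α) (∑ i, zs.α i)) z.a) zs :=
      ContinuousAt.comp (g := potential (shifted (lap zs.a zs.α) (∑ i, zs.α i)))
        (continuousAt_potential hu _) hca.continuousAt
    have hc2 : ContinuousAt (fun z : P.State => (∑ i, ‖lap zs.a zs.α i‖) * (∑ i, ‖z.α i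
        - potential (shifted (lap zs.a zs.α) (∑ i, zs.α i)) z.a i‖)) zs := by
      refine continuousAt_const.mul (tendsto_finsetSum _ fun i _ => ?_)
      exact ((((continuous_apply i).comp hcα).continuousAt).sub
        ((continuous_apply i).continuousAt.comp hc1)).norm
    refine hc2.eventually_lt_const ?_
    beta_reduce
    rw [hpot]
    simp only [sub_self, norm_zero, Finset.sum_const_zero, mul_zero]
    positivity
  have ev3 : ∀ᶠ z : P.State in 𝓝 zs, ∀ i q, P.G.Adj i q →
      ‖z.x i - z.x q‖ * (‖z.x i - z.x q‖ + ‖z.α i - z.α q‖) < κ := by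
    simp only [eventually_all]
    intro i q _
    have hxi : ∀ i, Continuous fun z : P.State => z.x i := fun i => (continuous_apply i).comp hcx
    have hαi : ∀ i, Continuous fun z : P.State => z.α i := fun i => (continuous_apply i).comp hcα
    have hc : Continuous fun z : P.State =>
        ‖z.x i - z.x q‖ * (‖z.x i - z.x q‖ + ‖z.α i - z.α q‖) :=
      ((hxi i).sub (hxi q)).norm.mul
        (((hxi i).sub (hxi q)).norm.add ((hαi i).sub (hαi q)).norm)
    refine hc.continuousAt.eventually_lt_const ?_
    have : zs.x i = zs.x q := by ext k; exact hkkt.consensus i q k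
    beta_reduce
    rw [this]
    simpa using hκ
  obtain ⟨r, hr0, hr⟩ := Metric.eventually_nhds_iff.mp ((ev1.and ev2).and ev3)
  refine ⟨min r 1, by positivity, min_le_right _ _, fun z hz hadm => ?_⟩
  obtain ⟨⟨h1, h2⟩, h3⟩ := hr (hz.trans_le (min_le_left _ _))
  refine ⟨?_, fun i q hadj => (h3 i q hadj).le⟩
  have hS : ∑ i, ∑ q, P.aField z i q / z.a i q ^ 2 ≤ wsum (P.aField z) / m ^ 2 := by
    rw [wsum, Finset.sum_div]
    refine Finset.sum_le_sum fun i _ => ?_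
    rw [Finset.sum_div]
    refine Finset.sum_le_sum fun q _ => ?_
    by_cases hadj : P.G.Adj i q
    · have := h1 i q hadj
      have hnn := aField_nonneg hP.d_pos z i q
      gcongr
    · have : P.aField z i q = 0 := by simp [aField, hadj]
      rw [this]; simp
  have hS0 : 0 ≤ wsum (P.aField z) / m ^ 2 :=
    div_nonneg (wsum_nonneg (aField_nonneg hP.d_pos z)) (by positivity)
  calc _ ≤ (∑ i, ‖lap zs.a zs.α i‖) * (∑ i, ‖z.α i
          - potential (shifted (lap zs.a zs.α) (∑ i, zs.α i)) z.a i‖)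
          * (wsum (P.aField z) / m ^ 2) := by gcongr
    _ ≤ κ * m ^ 2 * (wsum (P.aField z) / m ^ 2) := mul_le_mul_of_nonneg_right h2.le hS0
    _ = κ * wsum (P.aField z) := by field_simp

/-- Lyapunov stability of saddle-point states, uniformly in the initial time. -/
lemma Regular.stable (hP : P.Regular μ) {zs : P.State} (hzs : P.IsAdmissible zs)
    (hkkt : P.KKT zs.a zs.x zs.α zs.θ) {ε : ℝ} (hε : 0 < ε) :
    ∃ δ > 0, ∀ (t₀ t₁ : ℝ) (z : ℝ → P.State), P.IsSol z t₀ t₁ → dist (z t₀) zs < δ →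
      ∀ t ∈ Icc t₀ t₁, dist (z t) zs < ε := by
  have href := hkkt.isRef hzs.1
  have hu := hzs.1.isUnit_lapMap (l := l) hP.connected
  set h := lap zs.a zs.α with hh
  set s := ∑ i, zs.α i with hs
  set c := shifted h s with hc
  have hpot : potential c zs.a = zs.α := eq_potential hu (by rw [lapMap_apply]; rfl)
  have hn0 : (0 : ℝ) ≤ n := Nat.cast_nonneg n
  -- constants
  set A := wsum zs.a + n ^ 2 with hA
  have hA0 : 0 ≤ A := add_nonneg (wsum_nonneg hzs.1.nonneg) (by positivity)
  obtain ⟨C₁, hC₁0, hC₁⟩ := hP.exists_csum_sq_le zs.x n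
  obtain ⟨C₂, hC₂0, hC₂⟩ := hP.exists_descent_ge href s A
  obtain ⟨C₃, hC₃0, hC₃⟩ := exists_wsum_aField_le P
  have hμ := hP.mu_pos
  -- The summands ensure in turn `η ≤ 1`, absorption of `xᵀLx`, absorption of `C₁ ‖x - xs‖²` into
  -- half the strong convexity, and `lyap + η descent ≥ lyap / 2`.
  set η := (1 + 2 * A + 2 * C₁ / μ + 2 * C₂)⁻¹ with hη
  have hden : 0 < 1 + 2 * A + 2 * C₁ / μ + 2 * C₂ := by positivity
  have hη0 : 0 < η := inv_pos.mpr hden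
  have hη1 : η * (1 + 2 * A + 2 * C₁ / μ + 2 * C₂) = 1 := inv_mul_cancel₀ hden.ne'
  have hηA : η * (2 * A) ≤ 1 := by
    rw [← hη1]; gcongr
    have : 0 ≤ 2 * C₁ / μ := by positivity
    linarith
  have hηle : η ≤ 1 := by
    rw [← hη1]; nth_rewrite 1 [← mul_one η]; gcongr
    have : 0 ≤ 2 * C₁ / μ := by positivity
    linarith
  have hηC₁ : η * C₁ ≤ μ / 2 := by
    have h1 : η * (2 * C₁ / μ) ≤ 1 := by
      rw [← hη1]; gcongr
      linarith
    have h2 : η * (2 * C₁ / μ) = (η * C₁) * 2 / μ := by ring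
    rw [h2, div_le_one hμ] at h1
    linarith
  have hηC₂ : η * C₂ ≤ 1 / 2 := by
    have h1 : η * (2 * C₂) ≤ 1 := by
      rw [← hη1]; gcongr
      have : 0 ≤ 2 * C₁ / μ := by positivity
      linarith
    linarith
  set m₀ := min (μ / 2) η with hm₀
  have hm₀0 : 0 < m₀ := lt_min (by linarith) hη0
  -- The weight rate enters at most three times with factor `κ`: from the drift of the potential,
  -- from `descent`, and from the added `κ * wsum`. Together they cost less than `m₀` times the
  -- remaining dissipation.
  set κ := m₀ / (4 * C₃) with hκ
  have hκ0 : 0 < κ := by positivity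
  have hκC : 2 * κ * C₃ = m₀ / 2 := by rw [hκ]; field_simp; ring
  obtain ⟨r₀, hr₀0, hr₀1, hr₀⟩ := hP.eventually_local_bounds hzs hkkt hκ0
  set r := min r₀ ε with hr
  have hrpos : 0 < r := lt_min hr₀0 hε
  obtain ⟨κ', hκ'0, hκ'⟩ := exists_dist_lt_of_lyap_lt hu hpot (half_pos hrpos)
  -- the Lyapunov function
  set Z : P.State → ℝ := fun z => P.lyap zs.x zs.θ c z + η * P.descent zs.x z with hZ
  have hZc : ContinuousAt Z zs :=
    (continuousAt_lyap zs.x zs.θ c hu).add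
      (continuous_const.mul (hP.continuous_descent zs.x)).continuousAt
  have hlap0 : lap zs.a zs.x = 0 := lap_of_consensus zs.a href.consensus
  have hZ0 : Z zs = 0 := by
    have e1 : P.lyap zs.x zs.θ c zs = 0 := by simp [lyap, hpot, nsq, csum]
    have e2 : P.descent zs.x zs = 0 := by
      have : ∀ i k j, zs.θ i k j * (P.g i k j (zs.x i k) - 2 * P.g i k j (zs.x i k)) = 0 := by
        intro i k j
        have := href.complementary i k j
        linear_combination -this
      simp [descent, csum, this, lapForm, hlap0]
    simp only [hZ, e1, e2]; ring
  -- The first entry makes `lyap < κ'`. The second keeps the weight increments below `κ' / 2`; the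
  -- other half is the initial distance.
  set ζ := min (κ' / 2) (κ * κ' / 2) with hζ
  have hζ0 : 0 < ζ := by positivity
  have hev : ∀ᶠ z in 𝓝 zs, Z z < ζ := hZc.eventually_lt_const (by rw [hZ0]; exact hζ0)
  obtain ⟨δ₁, hδ₁0, hδ₁⟩ := Metric.eventually_nhds_iff.mp hev
  refine ⟨min δ₁ (min r (κ' / 2)), by positivity, fun t₀ t₁ z hz hz0 => ?_⟩
  have hd1 : dist (z t₀) zs < δ₁ := hz0.trans_le (min_le_left _ _)
  have hd2 : dist (z t₀) zs < r := hz0.trans_le ((min_le_right _ _).trans (min_le_left _ _))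
  have hd3 : dist (z t₀) zs < κ' / 2 := hz0.trans_le ((min_le_right _ _).trans (min_le_right _ _))
  have hwsum : ∀ z : P.State, dist z zs < r → wsum z.a ≤ A := by
    intro z hz
    have : wsum z.a ≤ ∑ i : Fin n, ∑ q : Fin n, (zs.a i q + 1) :=
      Finset.sum_le_sum fun i _ => Finset.sum_le_sum fun q _ => by
        have h1 := (le_abs_self _).trans (abs_a_sub_le_dist z zs i q)
        have h2 := hz.trans_le ((min_le_left _ _).trans hr₀1)
        linarith
    refine this.trans (le_of_eq ?_)
    simp [Finset.sum_add_distrib, hA, wsum]; ring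
  refine fun t ht => (dist_lt_of_trap hrpos hz.cont hd2 (fun τ hτ hin => ?_) t ht).trans_le
    (min_le_right _ _)
  have hzτ := hz.mono le_rfl hτ.2
  have hbound : ∀ t ∈ Ico t₀ τ, _ := fun t ht => hr₀ (z t)
    ((hin t ⟨ht.1, ht.2.le⟩).trans_le (min_le_left _ _)) (hzτ.adm t ⟨ht.1, ht.2.le⟩)
  have hmono := le_of_right_deriv_nonpos
    (f := fun t => Z (z t) + κ * wsum (z t).a) hτ.1
    (((hzτ.continuousOn_lyap hP zs.x zs.θ c).add (continuousOn_const.mul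
      ((hP.continuous_descent zs.x).comp_continuousOn hzτ.cont))).add
      (continuousOn_const.mul hzτ.continuousOn_wsum))
    (fun t ht => ((hzτ.hasDerivWithinAt_lyap hP zs.x zs.θ c ht).add
      ((hzτ.hasDerivWithinAt_descent hP zs.x ht).const_mul η)).add
      ((hzτ.hasDerivWithinAt_wsum ht).const_mul κ))
    (fun t ht => by
      have hadm := hzτ.adm t ⟨ht.1, ht.2.le⟩
      have hdist := hin t ⟨ht.1, ht.2.le⟩
      obtain ⟨hb1, hb2⟩ := hbound t ht
      have k1 := hP.lyap_deriv_le href s hadm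
      have hnsq : nsq ((z t).x - zs.x) ≤ n := by
        have h1 := nsq_le_of_dist_le (hdist.le.trans ((min_le_left _ _).trans hr₀1))
        simpa using h1
      have k2 := hP.descent_deriv_le hadm (hC₁ _ hnsq) hb2
      have k3 := hC₃ zs.x href.consensus (z t)
      have k4 := wsum_nonneg (aField_nonneg hP.d_pos (z t))
      obtain ⟨k5, k6, -, k7⟩ := hP.diss_ge href hadm
      have k8 := nsq_nonneg ((z t).x - zs.x)
      have k9 := nsq_nonneg (P.xField (z t))
      have k10 : 2 * wsum (z t).a * lapForm (z t).a (z t).x (z t).x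
          ≤ 2 * A * lapForm (z t).a (z t).x (z t).x := by
        have := hwsum _ hdist
        gcongr
      have k11 := mul_le_mul_of_nonneg_left (k2.trans (by gcongr)) hη0.le
        (c := -nsq (P.xField (z t)) + 2 * A * lapForm (z t).a (z t).x (z t).x
          + C₁ * nsq ((z t).x - zs.x) + wsum (P.aField (z t)) * κ)
      have k12 := mul_le_mul_of_nonneg_right hηA k6
      have k13 := mul_le_mul_of_nonneg_right hηC₁ k8
      have k14 := mul_le_mul_of_nonneg_right hηle (mul_nonneg k4 hκ0.le)
      have k15 : m₀ * nsq ((z t).x - zs.x) ≤ μ / 2 * nsq ((z t).x - zs.x) := by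
        gcongr; exact min_le_left _ _
      have k16 : m₀ * nsq (P.xField (z t)) ≤ η * nsq (P.xField (z t)) := by
        gcongr; exact min_le_right _ _
      have k17 : 2 * κ * wsum (P.aField (z t))
          ≤ m₀ / 2 * (nsq ((z t).x - zs.x) + nsq (P.xField (z t))) := by
        rw [← hκC]
        have := mul_le_mul_of_nonneg_left k3 (by positivity : 0 ≤ 2 * κ)
        linarith
      have k18 : κ * wsum (P.aField (z t))
          ≤ m₀ / 2 * (nsq ((z t).x - zs.x) + nsq (P.xField (z t))) := by
        have := mul_nonneg hκ0.le k4
        linarith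
      unfold diss at k1
      linarith)
  have hτr : dist (z τ) zs < r := hin τ ⟨hτ.1, le_rfl⟩
  have hadm0 := hz.adm t₀ ⟨le_rfl, hτ.1.trans hτ.2⟩
  have hadm := hz.adm τ hτ
  have hQ := mul_le_mul_of_nonneg_left (hC₂ (z τ) hadm (hwsum _ hτr)) hη0.le
  have hV0 := lyap_nonneg zs.x zs.θ c (z τ)
  have hηV := mul_le_mul_of_nonneg_right hηC₂ hV0
  have hZ1 : Z (z t₀) < ζ := hδ₁ hd1
  have hZτ : Z (z τ) = P.lyap zs.x zs.θ c (z τ) + η * P.descent zs.x (z τ) := rfl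
  have hdiff : ∀ i q, κ * ((z τ).a i q - (z t₀).a i q) ≤ ζ := by
    intro i q
    have h1 := mul_le_mul_of_nonneg_left (hz.a_sub_le hP hτ i q) hκ0.le
    linarith
  have hwm : 0 ≤ κ * (wsum (z τ).a - wsum (z t₀).a) := by
    obtain ⟨i⟩ := hP.connected.nonempty
    have h1 := hz.a_sub_le hP hτ i i
    have h2 := hz.le_a hP hτ i i
    exact mul_nonneg hκ0.le (by linarith)
  refine (hκ' (z τ) ?_ fun i q => ?_).le
  · have : ζ ≤ κ' / 2 := min_le_left _ _
    linarith
  · have h1 : κ * ((z τ).a i q - (z t₀).a i q) ≤ κ * (κ' / 2) :=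
      (hdiff i q).trans ((min_le_right _ _).trans (le_of_eq (by ring)))
    have h2 := le_of_mul_le_mul_left h1 hκ0
    have h3 := hz.le_a hP hτ i q
    have h4 := abs_lt.mp ((abs_a_sub_le_dist (z t₀) zs i q).trans_lt hd3)
    rw [abs_lt]
    constructor <;> linarith

end Problem

/-! ### Global energy and a priori bounds. -/

namespace Problem

variable {P : Problem n l} {μ : ℝ}

/-- Global Lyapunov function; the exponential factor compensates the drift of the weights. -/
def energy (P : Problem n l) (xs h : Vec n l) (θs : P.Mult) (z : P.State) : ℝ :=
  (1 + P.lyap xs θs (shifted h 0) z)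
    * Real.exp ((∑ i, ‖h i‖) * (n + 1) * ∑ i, ∑ q, (z.a i q)⁻¹)

lemma exponent_nonneg (h : Vec n l) {z : P.State} (hz : P.IsAdmissible z) :
    0 ≤ (∑ i, ‖h i‖) * (n + 1) * ∑ i, ∑ q, (z.a i q)⁻¹ :=
  mul_nonneg (by positivity) (Finset.sum_nonneg fun i _ => Finset.sum_nonneg fun q _ =>
    inv_nonneg.mpr (hz.1.nonneg i q))

lemma one_add_lyap_le_energy (xs h : Vec n l) (θs : P.Mult) {z : P.State}
    (hz : P.IsAdmissible z) : 1 + P.lyap xs θs (shifted h 0) z ≤ P.energy xs h θs z := by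
  have h1 := Real.one_le_exp (exponent_nonneg h hz)
  have h2 := lyap_nonneg xs θs (shifted h 0) z
  unfold energy
  nlinarith

lemma IsSol.hasDerivWithinAt_inv {z : ℝ → P.State} {t₀ t₁ : ℝ} (hz : P.IsSol z t₀ t₁) {t : ℝ}
    (ht : t ∈ Ico t₀ t₁) (i q : Fin n) :
    HasDerivWithinAt (fun s => ((z s).a i q)⁻¹) (-(P.aField (z t) i q / (z t).a i q ^ 2))
      (Ici t) t := by
  have hadm := hz.adm t ⟨ht.1, ht.2.le⟩
  by_cases hadj : P.G.Adj i q
  · have h1 : HasDerivWithinAt (fun s => (z s).a i q) (P.aField (z t) i q) (Ici t) t :=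
      hasDerivWithinAt_pi.mp (hasDerivWithinAt_pi.mp (hz.weights t ht) i) q
    exact (h1.fun_inv (hadm.1.pos i q hadj).ne').congr_deriv (by ring)
  · have h0 : -(P.aField (z t) i q / (z t).a i q ^ 2) = 0 := by
      rw [aField_of_eq_zero hadm.1 (hadm.1.zero i q hadj)]; simp
    rw [h0]
    refine (hasDerivWithinAt_const t (Ici t) (0 : ℝ)).congr_of_eventuallyEq ?_ ?_
    · filter_upwards [Ico_mem_nhdsGE ht.2] with s hs
      rw [(hz.adm s ⟨ht.1.trans hs.1, hs.2.le⟩).1.zero i q hadj, inv_zero]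
    · rw [hadm.1.zero i q hadj, inv_zero]

lemma IsSol.continuousOn_energy (hP : P.Regular μ) {z : ℝ → P.State} {t₀ t₁ : ℝ}
    (hz : P.IsSol z t₀ t₁) (xs h : Vec n l) (θs : P.Mult) :
    ContinuousOn (fun s => P.energy xs h θs (z s)) (Icc t₀ t₁) := by
  unfold energy
  refine (continuousOn_const.add (hz.continuousOn_lyap hP xs θs _)).mul
    (ContinuousOn.rexp (continuousOn_const.mul (continuousOn_finsetSum _ fun i _ =>
      continuousOn_finsetSum _ fun q _ => ?_)))
  have h1 : ContinuousOn (fun t => (z t).a i q) (Icc t₀ t₁) := by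
    have h1 : ContinuousOn (fun t => (z t).a) (Icc t₀ t₁) :=
      (continuous_fst.comp continuous_snd).comp_continuousOn hz.cont
    exact continuousOn_pi.mp (continuousOn_pi.mp h1 i) q
  by_cases hadj : P.G.Adj i q
  · exact h1.inv₀ fun t ht => ((hz.adm t ht).1.pos i q hadj).ne'
  · refine (continuousOn_const (c := (0 : ℝ))).congr fun t ht => ?_
    rw [(hz.adm t ht).1.zero i q hadj, inv_zero]

/-- The energy decreases at least at the dissipation rate. -/
lemma IsSol.exists_energy_deriv (hP : P.Regular μ) {z : ℝ → P.State} {t₀ t₁ : ℝ}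
    (hz : P.IsSol z t₀ t₁) {xs h : Vec n l} {θs : P.Mult} (href : P.IsRef xs h θs) {t : ℝ}
    (ht : t ∈ Ico t₀ t₁) :
    ∃ e', HasDerivWithinAt (fun s => P.energy xs h θs (z s)) e' (Ici t) t ∧
      e' ≤ -P.diss μ xs (z t) := by
  have hadm := hz.adm t ⟨ht.1, ht.2.le⟩
  have hV := hz.hasDerivWithinAt_lyap hP xs θs (shifted h 0) ht
  have hS : HasDerivWithinAt (fun s => ∑ i, ∑ q, ((z s).a i q)⁻¹)
      (∑ i, ∑ q, -(P.aField (z t) i q / (z t).a i q ^ 2)) (Ici t) t :=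
    HasDerivWithinAt.fun_sum fun i _ => HasDerivWithinAt.fun_sum fun q _ =>
      hz.hasDerivWithinAt_inv ht i q
  have hE := (hV.const_add 1).mul (hS.const_mul ((∑ i, ‖h i‖) * (n + 1))).exp
  refine ⟨_, hE, ?_⟩
  have k1 := hP.lyap_deriv_le href 0 hadm
  have k2 := lyap_nonneg xs θs (shifted h 0) (z t)
  have k3 := Real.one_le_exp (exponent_nonneg h hadm)
  set X := Real.exp ((∑ i, ‖h i‖) * (n + 1) * ∑ i, ∑ q, ((z t).a i q)⁻¹)
  set S := ∑ i, ∑ q, P.aField (z t) i q / (z t).a i q ^ 2 with hSdef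
  have hS0 : 0 ≤ S := Finset.sum_nonneg fun i _ => Finset.sum_nonneg fun q _ =>
    div_nonneg (aField_nonneg hP.d_pos _ _ _) (by positivity)
  have hneg : ∑ i, ∑ q, -(P.aField (z t) i q / (z t).a i q ^ 2) = -S := by simp [hSdef]
  rw [hneg]
  -- The `1 +` in the energy is needed here: it makes the norm appearing in the drift linear in `1 +
  -- lyap`, hence absorbable by an exponential factor.
  have k4 : ∑ i, ‖(z t).α i - potential (shifted h 0) (z t).a i‖
      ≤ (n + 1) * (1 + P.lyap xs θs (shifted h 0) (z t)) := by
    have e1 := sum_norm_le ((z t).α - potential (shifted h 0) (z t).a)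
    have e2 : nsq ((z t).α - potential (shifted h 0) (z t).a)
        ≤ 2 * P.lyap xs θs (shifted h 0) (z t) := by
      have e3 := nsq_nonneg ((z t).x - xs)
      have e4 : 0 ≤ P.csum fun i k j => ((z t).θ i k j - θs i k j) ^ 2 :=
        csum_nonneg fun _ _ _ => sq_nonneg _
      unfold lyap
      linarith
    have e5 : (0 : ℝ) ≤ n := Nat.cast_nonneg n
    simp only [Pi.sub_apply] at e1
    nlinarith [mul_nonneg e5 k2]
  have k5 : (∑ i, ‖h i‖) * (∑ i, ‖(z t).α i - potential (shifted h 0) (z t).a i‖) * S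
      ≤ (∑ i, ‖h i‖) * ((n + 1) * (1 + P.lyap xs θs (shifted h 0) (z t))) * S := by gcongr
  obtain ⟨d1, d2, -, d3⟩ := hP.diss_ge href hadm
  have k6 : 0 ≤ P.diss μ xs (z t) := by unfold diss; linarith
  have k7 := mul_le_mul_of_nonneg_right (k1.trans (add_le_add_right k5 _)) (zero_le_one.trans k3)
  -- The derivative of the exponential cancels the drift, and `X ≥ 1` lets the full dissipation
  -- survive.
  nlinarith [mul_le_mul_of_nonneg_right k3 k6]

/-- Boundedness of continuous functions of `(x, θ)` on balls around the reference point. -/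
lemma exists_bound_of_near (P : Problem n l) (xs : Vec n l) (θs : P.Mult) (R : ℝ)
    {φ : Vec n l × P.Mult → ℝ} (hφ : Continuous φ) :
    ∃ B : ℝ, ∀ x θ, nsq (x - xs) ≤ R → P.csum (fun i k j => (θ i k j - θs i k j) ^ 2) ≤ R →
      |φ (x, θ)| ≤ B := by
  obtain ⟨B, hB⟩ := (isCompact_closedBall (xs, θs) (R + 1)).exists_bound_of_continuousOn
    hφ.continuousOn
  refine ⟨B, fun x θ hx hθ => hB _ ?_⟩
  have hR : 0 ≤ R := (nsq_nonneg _).trans hx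
  rw [Metric.mem_closedBall, Prod.dist_eq, max_le_iff]
  constructor
  · rw [dist_pi_le_iff (by linarith)]
    intro i
    have h1 := (norm_sq_le_nsq (x - xs) i).trans hx
    rw [Pi.sub_apply] at h1
    rw [dist_eq_norm]
    exact le_of_sq_le_sq (by nlinarith) (by linarith)
  · rw [dist_pi_le_iff (by linarith)]
    intro i
    rw [dist_pi_le_iff (by linarith)]
    intro k
    rw [dist_pi_le_iff (by linarith)]
    intro j
    have h1 := (le_csum (fun i k j => sq_nonneg (θ i k j - θs i k j)) i k j).trans hθ
    rw [Real.dist_eq]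
    exact abs_le_of_sq_le_sq (by nlinarith) (by linarith)

/-- All-time solutions. -/
def IsGlobalSol (P : Problem n l) (z : ℝ → P.State) : Prop := ∀ T, P.IsSol z 0 T

namespace IsGlobalSol

variable {z : ℝ → P.State} {xs h : Vec n l} {θs : P.Mult}

lemma on (hz : P.IsGlobalSol z) {t₀ t₁ : ℝ} (h0 : 0 ≤ t₀) : P.IsSol z t₀ t₁ :=
  (hz t₁).mono h0 le_rfl

lemma adm (hz : P.IsGlobalSol z) {t : ℝ} (ht : 0 ≤ t) : P.IsAdmissible (z t) :=
  (hz t).adm t ⟨ht, le_rfl⟩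

lemma exists_energy_deriv (hP : P.Regular μ) (hz : P.IsGlobalSol z) (href : P.IsRef xs h θs) :
    ∃ e' : ℝ → ℝ, ∀ t, 0 ≤ t →
      HasDerivWithinAt (fun s => P.energy xs h θs (z s)) (e' t) (Ici t) t ∧
      e' t ≤ -P.diss μ xs (z t) := by
  have hex : ∀ t, ∃ e', 0 ≤ t →
      HasDerivWithinAt (fun s => P.energy xs h θs (z s)) e' (Ici t) t ∧
      e' ≤ -P.diss μ xs (z t) := by
    intro t
    by_cases ht : 0 ≤ t
    · obtain ⟨e', he⟩ := (hz (t + 1)).exists_energy_deriv hP href ⟨ht, lt_add_one t⟩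
      exact ⟨e', fun _ => he⟩
    · exact ⟨0, fun hc => absurd hc ht⟩
  choose e' he' using hex
  exact ⟨e', he'⟩

lemma energy_add_mul_le (hP : P.Regular μ) (hz : P.IsGlobalSol z) (href : P.IsRef xs h θs)
    {t₀ t₁ κ : ℝ} (h0 : 0 ≤ t₀) (h1 : t₀ ≤ t₁)
    (hκ : ∀ t ∈ Ico t₀ t₁, κ ≤ P.diss μ xs (z t)) :
    P.energy xs h θs (z t₁) + κ * (t₁ - t₀) ≤ P.energy xs h θs (z t₀) := by
  have hs := hz.on (t₁ := t₁) h0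
  obtain ⟨e', he'⟩ := hz.exists_energy_deriv hP href
  have := le_of_right_deriv_nonpos (f := fun t => P.energy xs h θs (z t) + κ * (t - t₀)) h1
    ((hs.continuousOn_energy hP xs h θs).add (by fun_prop))
    (fun t ht => (he' t (h0.trans ht.1)).1.add
      (((hasDerivWithinAt_id t _).sub_const t₀).const_mul κ))
    (fun t ht => by have := (he' t (h0.trans ht.1)).2; have := hκ t ht; linarith)
  simp only [sub_self, mul_zero, add_zero] at this
  exact this

lemma diss_nonneg (hP : P.Regular μ) (hz : P.IsGlobalSol z) (href : P.IsRef xs h θs) {t : ℝ}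
    (ht : 0 ≤ t) : 0 ≤ P.diss μ xs (z t) := by
  obtain ⟨d1, d2, -, d3⟩ := hP.diss_ge href (hz.adm ht)
  unfold diss; linarith

lemma energy_anti (hP : P.Regular μ) (hz : P.IsGlobalSol z) (href : P.IsRef xs h θs)
    {t₀ t₁ : ℝ} (h0 : 0 ≤ t₀) (h1 : t₀ ≤ t₁) :
    P.energy xs h θs (z t₁) ≤ P.energy xs h θs (z t₀) := by
  have := hz.energy_add_mul_le hP href h0 h1 (κ := 0)
    fun t ht => hz.diss_nonneg hP href (h0.trans ht.1)
  linarith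

lemma exists_energy_lim (hP : P.Regular μ) (hz : P.IsGlobalSol z) (href : P.IsRef xs h θs) :
    ∃ e : ℝ, (∀ t, 0 ≤ t → e ≤ P.energy xs h θs (z t)) ∧
      ∀ κ > 0, ∃ T ≥ 0, ∀ t ≥ T, P.energy xs h θs (z t) < e + κ := by
  have hbdd : BddBelow ((fun t => P.energy xs h θs (z t)) '' Ici 0) := by
    refine ⟨0, ?_⟩
    rintro _ ⟨t, ht, rfl⟩
    have h1 := one_add_lyap_le_energy xs h θs (hz.adm ht)
    have h2 := lyap_nonneg xs θs (shifted h 0) (z t)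
    exact (by linarith : 0 ≤ P.energy xs h θs (z t))
  have hne : ((fun t => P.energy xs h θs (z t)) '' Ici 0).Nonempty := ⟨_, 0, mem_Ici.mpr le_rfl, rfl⟩
  refine ⟨sInf ((fun t => P.energy xs h θs (z t)) '' Ici 0),
    fun t ht => csInf_le hbdd ⟨t, ht, rfl⟩, fun κ hκ => ?_⟩
  obtain ⟨_, ⟨T, hT, rfl⟩, hlt⟩ := exists_lt_of_csInf_lt hne (lt_add_of_pos_right _ hκ)
  exact ⟨T, hT, fun t ht => (hz.energy_anti hP href hT ht).trans_lt hlt⟩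

/-- A priori bounds for the primal and dual variables. -/
lemma exists_bounds (hP : P.Regular μ) (hz : P.IsGlobalSol z) (href : P.IsRef xs h θs) :
    ∃ B : ℝ, 0 ≤ B ∧ ∀ t, 0 ≤ t → nsq ((z t).x - xs) ≤ B ∧ nsq (z t).α ≤ B ∧
      P.csum (fun i k j => ((z t).θ i k j - θs i k j) ^ 2) ≤ B ∧
      nsq (P.grad (z t).x + P.force (z t).x (z t).θ) ≤ B ∧
      |∑ i, (P.f i ((z t).x i) - P.f i (xs i)) + P.csum (fun i k j => (z t).θ i k j
        * (P.g i k j ((z t).x i k) - 2 * P.g i k j (xs i k)))| ≤ B := by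
  set E₀ := P.energy xs h θs (z 0) with hE₀
  have hV : ∀ t, 0 ≤ t → P.lyap xs θs (shifted h 0) (z t) ≤ E₀ := fun t ht => by
    have h1 := one_add_lyap_le_energy xs h θs (hz.adm ht)
    have h2 := hz.energy_anti hP href le_rfl ht
    linarith
  have hparts : ∀ t, 0 ≤ t → nsq ((z t).x - xs) ≤ 2 * E₀ ∧
      nsq ((z t).α - potential (shifted h 0) (z t).a) ≤ 2 * E₀ ∧
      P.csum (fun i k j => ((z t).θ i k j - θs i k j) ^ 2) ≤ 2 * E₀ := by
    intro t ht
    have h1 := hV t ht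
    have e1 := nsq_nonneg ((z t).x - xs)
    have e2 := nsq_nonneg ((z t).α - potential (shifted h 0) (z t).a)
    have e3 : 0 ≤ P.csum fun i k j => ((z t).θ i k j - θs i k j) ^ 2 :=
      csum_nonneg fun _ _ _ => sq_nonneg _
    unfold lyap at h1
    exact ⟨by linarith, by linarith, by linarith⟩
  -- the potentials stay bounded because the weights increase
  obtain ⟨D, -, hD⟩ := exists_norm_sub_le (l := l) hP.connected
  have hm : ∀ᶠ m : ℝ in 𝓝[>] 0, ∀ i q, P.G.Adj i q → m < (z 0).a i q := by
    simp only [eventually_all]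
    intro i q hadj
    exact (eventually_lt_nhds ((hz.adm le_rfl).1.pos i q hadj)).filter_mono nhdsWithin_le_nhds
  obtain ⟨m, hm, hm0⟩ := (hm.and self_mem_nhdsWithin).exists
  have hm0 : (0 : ℝ) < m := hm0
  -- The weights never fall below `m` on edges, so Kirchhoff's bound and connectivity bound the
  -- zero-total potential by `b` at all times.
  set b := D * ((∑ s, ‖h s‖) / m) with hb
  have hβ : ∀ t, 0 ≤ t → ∀ i, ‖potential (shifted h 0) (z t).a i‖ ≤ b := by
    intro t ht i
    have hadm := hz.adm ht
    have h1 := mul_norm_le_of_lap hD hm0 hadm.1 (fun i q hadj => (hm i q hadj).le.trans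
      ((hz t).le_a hP ⟨ht, le_rfl⟩ i q)) (potential (shifted h 0) (z t).a) i
    rw [hP.lap_potential_shifted hadm.1 href.sum_source,
      hP.sum_potential_shifted hadm.1 href.sum_source, norm_zero, add_zero] at h1
    have hn : (0 : ℝ) < n := lt_of_le_of_ne (Nat.cast_nonneg n) hP.cast_ne_zero.symm
    exact le_of_mul_le_mul_left h1 hn
  have hα : ∀ t, 0 ≤ t → nsq (z t).α ≤ 4 * E₀ + 2 * (n * b ^ 2) := by
    intro t ht
    have h1 := (hparts t ht).2.1
    have h2 : nsq (potential (shifted h 0) (z t).a) ≤ n * b ^ 2 := by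
      calc nsq (potential (shifted h 0) (z t).a) ≤ ∑ _i : Fin n, b ^ 2 :=
            Finset.sum_le_sum fun i _ => pow_le_pow_left₀ (norm_nonneg _) (hβ t ht i) 2
        _ = n * b ^ 2 := by simp
    have h3 : nsq (z t).α ≤ 2 * nsq ((z t).α - potential (shifted h 0) (z t).a)
        + 2 * nsq (potential (shifted h 0) (z t).a) := by
      simp only [nsq, Finset.mul_sum, ← Finset.sum_add_distrib]
      refine Finset.sum_le_sum fun i _ => ?_
      have e1 := norm_add_le ((z t).α i - potential (shifted h 0) (z t).a i)
        (potential (shifted h 0) (z t).a i)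
      rw [sub_add_cancel] at e1
      have e2 := norm_nonneg ((z t).α i)
      simp only [Pi.sub_apply]
      nlinarith [sq_nonneg (‖(z t).α i - potential (shifted h 0) (z t).a i‖
        - ‖potential (shifted h 0) (z t).a i‖)]
    linarith
  have hxk : ∀ i k, Continuous fun p : Vec n l × P.Mult => p.1 i k := fun i k =>
    (PiLp.continuous_apply 2 (fun _ : Fin l => ℝ) k).comp
      ((continuous_apply i).comp continuous_fst)
  have hθk : ∀ i k j, Continuous fun p : Vec n l × P.Mult => p.2 i k j := fun i k j =>
    (continuous_apply j).comp <| (continuous_apply k).comp <|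
      (continuous_apply i).comp continuous_snd
  obtain ⟨B₁, hB₁⟩ := exists_bound_of_near P xs θs (2 * E₀)
    (φ := fun p => nsq (P.grad p.1 + P.force p.1 p.2)) (by
      refine continuous_nsq.comp (Continuous.add ?_ ?_)
      · exact continuous_pi fun i => (hP.grad_cont i).comp
          ((continuous_apply i).comp continuous_fst)
      · refine continuous_pi fun i => (PiLp.continuous_toLp 2 _).comp
          (continuous_pi fun k => continuous_finsetSum _ fun j _ => (hθk i k j).mul ?_)
        exact (hP.deriv_cont i k j).comp (hxk i k))
  obtain ⟨B₂, hB₂⟩ := exists_bound_of_near P xs θs (2 * E₀)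
    (φ := fun p => ∑ i, (P.f i (p.1 i) - P.f i (xs i)) + P.csum (fun i k j => p.2 i k j
        * (P.g i k j (p.1 i k) - 2 * P.g i k j (xs i k)))) (by
      refine Continuous.add (continuous_finsetSum _ fun i _ => Continuous.sub ?_
        continuous_const) (continuous_csum fun i k j => (hθk i k j).mul (Continuous.sub ?_
        continuous_const))
      · exact (hP.f_diff i).continuous.comp ((continuous_apply i).comp continuous_fst)
      · exact (hP.g_diff i k j).continuous.comp (hxk i k))
  have hE0 : 0 ≤ E₀ := (lyap_nonneg _ _ _ _).trans (hV 0 le_rfl)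
  have hBpos : 0 ≤ B₁ ∧ 0 ≤ B₂ := by
    obtain ⟨h1, -, h3⟩ := hparts 0 le_rfl
    exact ⟨(abs_nonneg _).trans (hB₁ _ _ h1 h3), (abs_nonneg _).trans (hB₂ _ _ h1 h3)⟩
  have hnb : 0 ≤ n * b ^ 2 := by positivity
  refine ⟨4 * E₀ + 2 * (n * b ^ 2) + B₁ + B₂, by linarith [hBpos.1, hBpos.2], fun t ht => ?_⟩
  obtain ⟨h1, -, h3⟩ := hparts t ht
  have h4 := (le_abs_self _).trans (hB₁ _ _ h1 h3)
  have h5 := hB₂ _ _ h1 h3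
  exact ⟨by linarith [hBpos.1, hBpos.2], by linarith [hα t ht, hBpos.1, hBpos.2],
    by linarith [hBpos.1, hBpos.2], by linarith [hBpos.2], by linarith [hBpos.1]⟩

end IsGlobalSol

end Problem

/-! ### Vanishing primal error, bounded weights and convergence. -/

namespace Problem

variable {P : Problem n l} {μ : ℝ}

/-- Growth bound for the primal error, corrected by a small multiple of `dot (x - xs) α`. -/
lemma Regular.primal_error_deriv_le (hP : P.Regular μ) {xs h : Vec n l} {θs : P.Mult}
    (href : P.IsRef xs h θs) {z : P.State} (hz : P.IsAdmissible z) {η B : ℝ} (hη0 : 0 < η)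
    (hη1 : η ≤ 1) (hα : nsq z.α ≤ B) (hψ : nsq (P.grad z.x + P.force z.x z.θ) ≤ B) :
    dot (z.x - xs) (P.xField z) + η * (dot (z.x - xs) (lap z.a z.x) + dot (P.xField z) z.α)
      ≤ (1 / μ + 1) / η * P.diss μ xs z + 3 / 2 * η * B := by
  have hsymm := hz.1.symm
  set ψ := P.grad z.x + P.force z.x z.θ with hψdef
  have hv : P.xField z = -ψ - lap z.a z.x - lap z.a z.α := by
    rw [xField_eq, hψdef]; abel
  have e1 : dot (z.x - xs) (lap z.a z.x) = lapForm z.a z.x z.x := by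
    rw [dot_lap_comm hsymm, lap_sub_consensus _ href.consensus, dot_comm]; rfl
  have e2 : dot (z.x - xs) (lap z.a z.α) = lapForm z.a z.α z.x := by
    rw [dot_lap_comm hsymm, lap_sub_consensus _ href.consensus, dot_comm]; rfl
  -- The corrector contributes `-η αᵀLα`. One half absorbs the cross term `αᵀLx` of the primal error
  -- and the other its `η`-multiple, so no constant depends on the weights.
  have e3 : dot (P.xField z) z.α
      = -dot ψ z.α - lapForm z.a z.α z.x - lapForm z.a z.α z.α := by
    rw [hv, dot_sub_left, dot_sub_left, dot_neg_left, dot_comm (lap z.a z.x),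
      dot_comm (lap z.a z.α)]
    rfl
  rw [e3, hv, dot_sub_right, dot_sub_right, dot_neg_right, e1, e2]
  have k1 := two_mul_abs_dot_le hη0 ψ (z.x - xs)
  rw [dot_comm ψ] at k1
  have k2 := two_mul_abs_dot_le one_pos ψ z.α
  have k3 := two_mul_abs_lapForm_le hsymm hz.1.nonneg hη0 z.α z.x
  have k4 := two_mul_abs_lapForm_le hsymm hz.1.nonneg one_pos z.α z.x
  obtain ⟨d1, d2, -, d3⟩ := hP.diss_ge href hz
  have q0 := lapForm_self_nonneg hsymm hz.1.nonneg z.α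
  have hμ := hP.mu_pos
  have hu := nsq_nonneg (z.x - xs)
  have hD : nsq (z.x - xs) + lapForm z.a z.x z.x ≤ (1 / μ + 1) * P.diss μ xs z := by
    have f1 : nsq (z.x - xs) = 1 / μ * (μ * nsq (z.x - xs)) := by field_simp
    have f2 : μ * nsq (z.x - xs) ≤ P.diss μ xs z := by unfold diss; linarith
    have f3 : lapForm z.a z.x z.x ≤ P.diss μ xs z := by unfold diss; linarith
    rw [f1, add_mul, one_mul]
    gcongr
  have hD' : nsq (z.x - xs) / η + lapForm z.a z.x z.x / η
      ≤ (1 / μ + 1) / η * P.diss μ xs z := by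
    rw [← add_div, div_mul_eq_mul_div]
    gcongr
  rw [div_one] at k2 k4
  have hp : lapForm z.a z.x z.x ≤ lapForm z.a z.x z.x / η := by
    rw [le_div_iff₀ hη0]; nlinarith
  have hp' : η * lapForm z.a z.x z.x ≤ lapForm z.a z.x z.x := by nlinarith
  have hu' : 0 ≤ nsq (z.x - xs) / η := by positivity
  have m1 := neg_abs_le (dot (z.x - xs) ψ)
  have m2 := mul_le_mul_of_nonneg_left (neg_abs_le (dot ψ z.α)) hη0.le
  have m2' := mul_le_mul_of_nonneg_left k2 hη0.le
  have m3 := neg_abs_le (lapForm z.a z.α z.x)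
  have m4 := mul_le_mul_of_nonneg_left m3 hη0.le
  have m4' := mul_le_mul_of_nonneg_left k4 hη0.le
  have b1 := mul_le_mul_of_nonneg_left hα hη0.le
  have b2 := mul_le_mul_of_nonneg_left hψ hη0.le
  linarith

lemma Regular.continuous_xField (hP : P.Regular μ) : Continuous P.xField := by
  have hlap : ∀ i, Continuous fun p : (Fin n → Fin n → ℝ) × Vec n l => lap p.1 p.2 i := by
    intro i
    unfold lap
    fun_prop
  have hθk : ∀ i k j, Continuous fun z : P.State => z.θ i k j := continuous_θ_apply
  have hxk : ∀ i k, Continuous fun z : P.State => z.x i k := continuous_x_apply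
  refine continuous_pi fun i => ?_
  refine (((Continuous.neg ?_).sub ?_).sub ?_).sub ?_
  · exact (hP.grad_cont i).comp ((continuous_apply i).comp continuous_fst)
  · exact (hlap i).comp ((continuous_fst.comp continuous_snd).prodMk continuous_fst)
  · exact (hlap i).comp ((continuous_fst.comp continuous_snd).prodMk
      (continuous_fst.comp (continuous_snd.comp continuous_snd)))
  · exact (PiLp.continuous_toLp 2 _).comp (continuous_pi fun k =>
      continuous_finsetSum _ fun j _ => (hθk i k j).mul ((hP.deriv_cont i k j).comp (hxk i k)))

lemma continuous_diss (P : Problem n l) (μ : ℝ) (xs : Vec n l) : Continuous (P.diss μ xs) := by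
  unfold diss
  refine ((continuous_const.mul (continuous_nsq.comp (continuous_fst.sub continuous_const))).add
    (Continuous.lapForm (continuous_fst.comp continuous_snd) continuous_fst
      continuous_fst)).sub (continuous_csum fun i k j => ?_)
  exact (continuous_θ_apply i k j).mul continuous_const

/-- Equilibria with vanishing dissipation satisfy the KKT conditions. -/
lemma Regular.kkt_of_diss_eq_zero (hP : P.Regular μ) {xs h : Vec n l} {θs : P.Mult}
    (href : P.IsRef xs h θs) {z : P.State} (hz : P.IsAdmissible z) (hv : P.xField z = 0)
    (hd : P.diss μ xs z = 0) : P.KKT z.a z.x z.α z.θ := by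
  obtain ⟨d1, d2, d3, d4⟩ := hP.diss_ge href hz
  unfold diss at hd
  have hμ := hP.mu_pos
  have hx : z.x = xs := by
    have h1 : nsq (z.x - xs) = 0 := by
      have : μ * nsq (z.x - xs) = 0 := by linarith
      exact (mul_eq_zero.mp this).resolve_left hμ.ne'
    funext i
    have h2 := norm_sq_le_nsq (z.x - xs) i
    rw [h1] at h2
    exact sub_eq_zero.mp (norm_eq_zero.mp (pow_eq_zero_iff two_ne_zero |>.mp
      (le_antisymm h2 (sq_nonneg _))))
  refine ⟨stationary_iff.mpr ?_, ?_, hz.2, ?_, ?_⟩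
  · rw [xField_eq, lap_of_consensus z.a (x := z.x) (by rw [hx]; exact href.consensus)] at hv
    rw [← neg_eq_zero, ← hv]
    abel
  · rw [hx]; exact href.feasible
  · intro i k j
    have h1 := le_csum d3 i k j
    have h2 : P.csum (fun i k j => -(z.θ i k j * P.g i k j (xs i k)))
        = -P.csum (fun i k j => z.θ i k j * P.g i k j (xs i k)) := by
      simp [csum]
    rw [h2] at h1
    rw [hx]
    linarith [d3 i k j]
  · intro i q k
    rw [hx, href.consensus i q]

/-- A product estimate for small `e` and bounded `A`. -/
lemma mul_add_le_of_sq_le {e A ω B : ℝ} (hω : 0 < ω) (hA : A ^ 2 ≤ 4 * B)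
    (he : e ^ 2 ≤ 4 * (ω / (8 * (1 + 2 * (B + 1) / ω)))) : e * (e + A) ≤ ω := by
  have hB : 0 ≤ B := by nlinarith [sq_nonneg A]
  -- Weight of Young's inequality for `e * A`: it makes `A² / M ≤ ω`, leaving `ω / 2` for the terms
  -- in `e²`.
  set M := 4 * (B + 1) / ω with hM
  have hM0 : 0 < M := by positivity
  have h1 : e ^ 2 * (1 + M / 2) ≤ ω / 2 := by
    have : 4 * (ω / (8 * (1 + 2 * (B + 1) / ω))) * (1 + M / 2) = ω / 2 := by
      have : 1 + M / 2 = 1 + 2 * (B + 1) / ω := by rw [hM]; ring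
      rw [this]
      have : 1 + 2 * (B + 1) / ω ≠ 0 := by positivity
      generalize 1 + 2 * (B + 1) / ω = w at this
      field_simp; ring
    rw [← this]
    gcongr
  have h2 : A ^ 2 / M ≤ ω := by
    rw [div_le_iff₀ hM0, hM]
    have : ω * (4 * (B + 1) / ω) = 4 * (B + 1) := by field_simp
    linarith
  have h3 : 2 * (e * A) ≤ M * e ^ 2 + A ^ 2 / M := by
    have : M * e ^ 2 + A ^ 2 / M - 2 * (e * A) = (M * e - A) ^ 2 / M := by field_simp; ring
    have : 0 ≤ (M * e - A) ^ 2 / M := by positivity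
    linarith
  nlinarith

namespace IsGlobalSol

variable {z : ℝ → P.State} {xs h : Vec n l} {θs : P.Mult}

/-- The velocity might grow with the weights, so integrability of the dissipation does not suffice
by itself. Every unit time window contains an instant of small dissipation, hence of small error.
From there the corrected error grows only by a multiple of the energy drop plus `O(η)`. -/
lemma exists_nsq_lt (hP : P.Regular μ) (hz : P.IsGlobalSol z) (href : P.IsRef xs h θs) {ε : ℝ}
    (hε : 0 < ε) : ∃ T ≥ 0, ∀ t ≥ T, nsq ((z t).x - xs) < ε := by
  obtain ⟨B, hB0, hB⟩ := hz.exists_bounds hP href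
  obtain ⟨e, he, heT⟩ := hz.exists_energy_lim hP href
  obtain ⟨e', he'⟩ := hz.exists_energy_deriv hP href
  have hμ := hP.mu_pos
  set K := 1 / μ + 1 with hK
  have hK0 : 0 < K := by positivity
  -- The corrector at both ends costs `2ηB` and the growth over the window `3ηB/2`. Their sum
  -- `7ηB/2` is at most `ε / 8`.
  set η := min 1 (ε / (28 * (B + 1))) with hη
  have hη0 : 0 < η := by positivity
  have hηB : η * B ≤ ε / 28 := by
    have h1 : η * (B + 1) ≤ ε / (28 * (B + 1)) * (B + 1) := by gcongr; exact min_le_right _ _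
    have h2 : ε / (28 * (B + 1)) * (B + 1) = ε / 28 := by field_simp
    linarith
  set κ := min (μ * ε / 4) (ε * η / (8 * K)) with hκ
  have hκ0 : 0 < κ := by positivity
  obtain ⟨T, hT0, hT⟩ := heT κ hκ0
  refine ⟨T + 1, by linarith, fun t ht => ?_⟩
  have ht0 : 0 ≤ t - 1 := by linarith
  obtain ⟨s, hs, hsd⟩ : ∃ s ∈ Ico (t - 1) t, P.diss μ xs (z s) < κ := by
    by_contra! hcon
    have h1 := hz.energy_add_mul_le hP href ht0 (by linarith) hcon
    have h2 := hT (t - 1) (by linarith)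
    have h3 := he t (by linarith)
    linarith
  have hs0 : 0 ≤ s := ht0.trans hs.1
  have hsol := hz.on (t₁ := t) hs0
  have hmono := le_of_right_deriv_nonpos
    (f := fun t => (1 / 2 * nsq ((z t).x - xs) + η * dot ((z t).x - xs) (z t).α)
      + K / η * P.energy xs h θs (z t) - 3 / 2 * η * B * t) hs.2.le
    ((ContinuousOn.add (by
        have hc : Continuous fun z : P.State =>
            1 / 2 * nsq (z.x - xs) + η * dot (z.x - xs) z.α := by
          have hx : Continuous fun z : P.State => z.x - xs := continuous_fst.sub continuous_const
          refine (continuous_const.mul (continuous_nsq.comp hx)).add (continuous_const.mul ?_)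
          unfold dot
          exact continuous_finsetSum _ fun i _ => ((continuous_apply i).comp hx).inner
            ((continuous_apply i).comp (continuous_fst.comp (continuous_snd.comp continuous_snd)))
        exact hc.comp_continuousOn hsol.cont)
      (continuousOn_const.mul (hsol.continuousOn_energy hP xs h θs))).sub (by fun_prop))
    (fun τ hτ => ((((hasDerivWithinAt_nsq ((hsol.primal τ hτ).sub_const xs)).const_mul
        (1 / 2)).add ((hasDerivWithinAt_dot ((hsol.primal τ hτ).sub_const xs)
          (hsol.dual τ hτ)).const_mul η)).add
      ((he' τ (hs0.trans hτ.1)).1.const_mul (K / η))).sub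
      ((hasDerivWithinAt_id τ _).const_mul (3 / 2 * η * B)))
    (fun τ hτ => by
      have hτ0 := hs0.trans hτ.1
      obtain ⟨-, b2, -, b4, -⟩ := hB τ hτ0
      have k1 := hP.primal_error_deriv_le href (hz.adm hτ0) hη0 (min_le_left _ _) b2 b4
      have k2 := mul_le_mul_of_nonneg_left (he' τ hτ0).2 (by positivity : 0 ≤ K / η)
      linarith)
  have hYb : ∀ t, 0 ≤ t → |η * dot ((z t).x - xs) (z t).α| ≤ η * B := by
    intro t ht
    obtain ⟨b1, b2, -⟩ := hB t ht
    have k1 := two_mul_abs_dot_le one_pos ((z t).x - xs) (z t).α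
    rw [div_one, one_mul] at k1
    rw [abs_mul, abs_of_pos hη0]
    gcongr
    linarith
  have y1 := (abs_le.mp (hYb t (by linarith))).1
  have y2 := (abs_le.mp (hYb s hs0)).2
  have u1 : nsq ((z s).x - xs) < ε / 4 := by
    obtain ⟨-, d2, -, d3⟩ := hP.diss_ge href (hz.adm hs0)
    have h1 : μ * nsq ((z s).x - xs) < μ * (ε / 4) := by
      have h2 : κ ≤ μ * ε / 4 := min_le_left _ _
      unfold diss at hsd
      linarith
    exact lt_of_mul_lt_mul_left h1 hμ.le
  have u2 : K / η * (P.energy xs h θs (z s) - P.energy xs h θs (z t)) ≤ ε / 8 := by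
    have h1 : P.energy xs h θs (z s) - P.energy xs h θs (z t) ≤ ε * η / (8 * K) := by
      have h2 := hT s (by linarith [hs.1])
      have h3 := he t (by linarith)
      have h4 : κ ≤ ε * η / (8 * K) := min_le_right _ _
      linarith
    calc _ ≤ K / η * (ε * η / (8 * K)) := by gcongr
      _ = ε / 8 := by field_simp
  have u3 : η * B * (t - s) ≤ η * B := by
    have : 0 ≤ η * B := by positivity
    nlinarith [hs.1]
  nlinarith

/-- The weights stay bounded, and the velocities and the dissipation get arbitrarily small. -/
lemma exists_weights_bound (hP : P.Regular μ) (hz : P.IsGlobalSol z) (href : P.IsRef xs h θs) :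
    ∃ A T : ℝ, 0 ≤ T ∧ (∀ t ≥ T, wsum (z t).a ≤ A) ∧
      ∀ ε > 0, ∀ T', ∃ t ≥ T', 0 ≤ t ∧ 1 / 2 * nsq (P.xField (z t)) + P.diss μ xs (z t) < ε := by
  obtain ⟨B, hB0, hB⟩ := hz.exists_bounds hP href
  obtain ⟨e, he, heT⟩ := hz.exists_energy_lim hP href
  obtain ⟨e', he'⟩ := hz.exists_energy_deriv hP href
  obtain ⟨C₁, hC₁0, hC₁⟩ := hP.exists_csum_sq_le xs B
  obtain ⟨C₃, hC₃0, hC₃⟩ := exists_wsum_aField_le P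
  have hμ := hP.mu_pos
  -- Here `c = 3ω`. The weight rate appears with factor `ω` from `descent`, `2ω` from the energy gap
  -- and `3ω` from `c`. As `6ωC₃ = 1/2`, half of `‖ẋ‖²` is left.
  set c := 1 / (4 * C₃) with hc
  set ω := 1 / (12 * C₃) with hω
  have hω0 : 0 < ω := by positivity
  have hcω : c = 3 * ω := by rw [hc, hω]; field_simp; norm_num
  have hωC : ω * C₃ = 1 / 12 := by rw [hω]; field_simp
  set K := (C₁ + 1 / 2) / μ + 1 with hK
  have hK0 : 0 < K := by positivity
  have hKμ : K * μ = C₁ + 1 / 2 + μ := by rw [hK]; field_simp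
  obtain ⟨T₁, hT₁0, hT₁⟩ := hz.exists_nsq_lt hP href
    (by positivity : 0 < ω / (8 * (1 + 2 * (B + 1) / ω)))
  obtain ⟨T₂, hT₂0, hT₂⟩ := heT ω hω0
  set T := max T₁ T₂ with hT
  have hT0 : 0 ≤ T := hT₁0.trans (le_max_left _ _)
  have hedge : ∀ t ≥ T, ∀ i q, P.G.Adj i q → ‖(z t).x i - (z t).x q‖
      * (‖(z t).x i - (z t).x q‖ + ‖(z t).α i - (z t).α q‖) ≤ ω := by
    intro t ht i q _
    refine mul_add_le_of_sq_le hω0 ((norm_sub_sq_le_nsq _ i q).trans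
      (mul_le_mul_of_nonneg_left (hB t (hT0.trans ht)).2.1 (by norm_num))) ?_
    have h1 := norm_sub_sq_le_nsq ((z t).x - xs) i q
    have h2 : ((z t).x - xs) i - ((z t).x - xs) q = (z t).x i - (z t).x q := by
      simp only [Pi.sub_apply]; rw [href.consensus i q]; abel
    rw [h2] at h1
    have h3 := hT₁ t ((le_max_left _ _).trans ht)
    linarith
  -- The derivative of `2W(E - e)` contains `2WE' ≤ -2W diss`, which dominates the error `2W xᵀLx`
  -- from `descent`. Its other part `2W'(E - e)` is small because the energy is close to its
  -- infimum. The multiple `K` of the energy pays for the terms in `‖x - xs‖²`.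
  set Θ : ℝ → ℝ := fun t => P.descent xs (z t) + 2 * (wsum (z t).a * (P.energy xs h θs (z t) - e))
    + K * P.energy xs h θs (z t) + c * wsum (z t).a with hΘ
  have hmono : ∀ t₀ t₁ κ, T ≤ t₀ → t₀ ≤ t₁ →
      (∀ t ∈ Ico t₀ t₁, κ ≤ 1 / 2 * nsq (P.xField (z t)) + P.diss μ xs (z t)) →
      Θ t₁ + κ * (t₁ - t₀) ≤ Θ t₀ := by
    intro t₀ t₁ κ h0 h1 hκ
    have h00 : 0 ≤ t₀ := hT0.trans h0
    have hs := hz.on (t₁ := t₁) h00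
    have hE := hs.continuousOn_energy hP xs h θs
    have := le_of_right_deriv_nonpos (f := fun t => Θ t + κ * (t - t₀)) h1
      ((((((hP.continuous_descent xs).comp_continuousOn hs.cont).add
        (continuousOn_const.mul (hs.continuousOn_wsum.mul (hE.sub continuousOn_const)))).add
        (continuousOn_const.mul hE)).add (continuousOn_const.mul hs.continuousOn_wsum)).add
        (by fun_prop))
      (fun t ht => by
        have hW := hs.hasDerivWithinAt_wsum ht
        have hE' := (he' t (h00.trans ht.1)).1
        exact ((((hs.hasDerivWithinAt_descent hP xs ht).add
          ((hW.mul (hE'.sub_const e)).const_mul 2)).add (hE'.const_mul K)).add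
          (hW.const_mul c)).add (((hasDerivWithinAt_id t _).sub_const t₀).const_mul κ))
      (fun t ht => by
        have ht0 := h00.trans ht.1
        have hadm := hz.adm ht0
        have k0 := hκ t ht
        have k1 := hP.descent_deriv_le hadm (hC₁ _ (hB t ht0).1) (hedge t (h0.trans ht.1))
        have k2 := hC₃ xs href.consensus (z t)
        have k3 := wsum_nonneg (aField_nonneg hP.d_pos (z t))
        have k4 := wsum_nonneg hadm.1.nonneg
        have k5 := (he' t ht0).2
        have k6 := mul_le_mul_of_nonneg_left k5 k4
        have k7 := mul_le_mul_of_nonneg_left k5 hK0.le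
        have k8 : P.energy xs h θs (z t) - e ≤ ω := by
          have := hT₂ t (((le_max_right _ _).trans h0).trans ht.1)
          linarith
        have k9 := mul_le_mul_of_nonneg_left k8 k3
        obtain ⟨-, d2, -, d3⟩ := hP.diss_ge href hadm
        have d1 := nsq_nonneg ((z t).x - xs)
        have k10 : lapForm (z t).a (z t).x (z t).x ≤ P.diss μ xs (z t) := by
          have := mul_nonneg hμ.le d1
          unfold diss; linarith
        have k11 := mul_le_mul_of_nonneg_left k10 k4
        have k12 : (C₁ + 1 / 2) * nsq ((z t).x - xs) + P.diss μ xs (z t)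
            ≤ K * P.diss μ xs (z t) := by
          have h1 : μ * nsq ((z t).x - xs) ≤ P.diss μ xs (z t) := by unfold diss; linarith
          have h2 : (C₁ + 1 / 2) * nsq ((z t).x - xs)
              = (C₁ + 1 / 2) / μ * (μ * nsq ((z t).x - xs)) := by field_simp
          rw [h2, hK, add_mul, one_mul]
          gcongr
        have k13 := mul_le_mul_of_nonneg_left k2 hω0.le
        have k14 : ω * (C₃ * (nsq ((z t).x - xs) + nsq (P.xField (z t))))
            = 1 / 12 * (nsq ((z t).x - xs) + nsq (P.xField (z t))) := by
          rw [← mul_assoc, hωC]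
        rw [hcω]
        nlinarith)
    simp only [sub_self, mul_zero, add_zero] at this
    exact this
  -- `descent` can lose at most `B + ωW`, while `cW = 3ωW`. Since `Θ` does not increase, this
  -- surplus of `2ωW` bounds the weights.
  have hlow : ∀ t ≥ T, -B + 2 * ω * wsum (z t).a ≤ Θ t := by
    intro t ht
    have ht0 := hT0.trans ht
    have hadm := hz.adm ht0
    have h1 := (abs_le.mp (hB t ht0).2.2.2.2).1
    have h2 := (abs_le.mp (abs_lapForm_half_add_le hadm.1.symm hadm.1.nonneg hadm.1.zero
      (hedge t ht))).1
    have h3 := wsum_nonneg hadm.1.nonneg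
    have h4 := mul_nonneg h3 (sub_nonneg.mpr (he t ht0))
    have h5 : 0 ≤ P.energy xs h θs (z t) := by
      have h1 := one_add_lyap_le_energy xs h θs hadm
      have h2 := lyap_nonneg xs θs (shifted h 0) (z t)
      linarith
    have h6 := mul_nonneg hK0.le h5
    simp only [hΘ, descent, hcω]
    linarith
  have hrate : ∀ t, 0 ≤ t → 0 ≤ 1 / 2 * nsq (P.xField (z t)) + P.diss μ xs (z t) := fun t ht => by
    have h1 := nsq_nonneg (P.xField (z t))
    have h2 := hz.diss_nonneg hP href ht
    linarith
  refine ⟨(Θ T + B) / (2 * ω), T, hT0, fun t ht => ?_, fun ε hε T' => ?_⟩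
  · have h1 := hmono T t 0 le_rfl ht fun s hs => hrate s (hT0.trans hs.1)
    have h2 := hlow t ht
    rw [le_div_iff₀ (by positivity)]
    linarith
  · by_contra! hcon
    set S := max T T' with hS
    have hTS : T ≤ S := le_max_left _ _
    have h0 : 0 ≤ Θ S + B := by
      have h1 := hlow S hTS
      have h2 := wsum_nonneg (hz.adm (hT0.trans hTS)).1.nonneg
      have h3 := mul_nonneg hω0.le h2
      linarith
    have hl : S ≤ S + ((Θ S + B) / ε + 1) := by
      have : 0 ≤ (Θ S + B) / ε := by positivity
      linarith
    have h1 := hmono S (S + ((Θ S + B) / ε + 1)) ε hTS hl fun t ht =>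
      hcon t ((le_max_right _ _).trans ht.1) ((hT0.trans hTS).trans ht.1)
    have h2 := hlow _ (hTS.trans hl)
    have h3 := mul_nonneg hω0.le
      (wsum_nonneg (hz.adm ((hT0.trans hTS).trans hl)).1.nonneg)
    have h4 : ε * (S + ((Θ S + B) / ε + 1) - S) = Θ S + B + ε := by field_simp; ring
    linarith

/-- Every global solution converges to a state which satisfies the KKT conditions. -/
lemma exists_tendsto (hP : P.Regular μ) (hz : P.IsGlobalSol z) (href : P.IsRef xs h θs) :
    ∃ zl : P.State, Tendsto z atTop (𝓝 zl) ∧ P.IsAdmissible zl ∧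
      P.KKT zl.a zl.x zl.α zl.θ := by
  obtain ⟨B, hB0, hB⟩ := hz.exists_bounds hP href
  obtain ⟨A, T, hT0, hA, hsmall⟩ := hz.exists_weights_bound hP href
  have hA0 : 0 ≤ A := (wsum_nonneg (hz.adm hT0).1.nonneg).trans (hA T le_rfl)
  -- Times along which both the velocity and the dissipation vanish in the limit.
  choose τ hτT hτ0 hτ using fun m : ℕ => hsmall (1 / ((m : ℝ) + 1)) (by positivity) T
  have hmem : ∀ m, z (τ m) ∈ Metric.closedBall ((xs, 0, 0, θs) : P.State) (B + 1 + A) := by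
    intro m
    have hadm := hz.adm (hτ0 m)
    obtain ⟨b1, b2, b3, -⟩ := hB (τ m) (hτ0 m)
    have hR : 0 ≤ B + 1 + A := by linarith
    simp only [Metric.mem_closedBall, Prod.dist_eq, max_le_iff]
    refine ⟨?_, ?_, ?_, ?_⟩
    · refine (dist_pi_le_iff hR).mpr fun i => ?_
      have h1 := (norm_sq_le_nsq ((z (τ m)).x - xs) i).trans b1
      rw [Pi.sub_apply] at h1
      rw [dist_eq_norm]
      exact le_of_sq_le_sq (by nlinarith) hR
    · refine (dist_pi_le_iff hR).mpr fun i => (dist_pi_le_iff hR).mpr fun q => ?_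
      have h1 := (le_wsum hadm.1.nonneg i q).trans (hA _ (hτT m))
      have h2 := hadm.1.nonneg i q
      rw [Pi.zero_apply, Pi.zero_apply, Real.dist_eq, sub_zero, abs_of_nonneg h2]
      linarith
    · refine (dist_pi_le_iff hR).mpr fun i => ?_
      have h1 := (norm_sq_le_nsq (z (τ m)).α i).trans b2
      rw [Pi.zero_apply, dist_zero_right]
      exact le_of_sq_le_sq (by nlinarith) hR
    · refine (dist_pi_le_iff hR).mpr fun i => (dist_pi_le_iff hR).mpr fun k =>
        (dist_pi_le_iff hR).mpr fun j => ?_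
      have h1 := (le_csum (fun i k j => sq_nonneg ((z (τ m)).θ i k j - θs i k j)) i k j).trans b3
      rw [Real.dist_eq]
      exact abs_le_of_sq_le_sq (by nlinarith) hR
  obtain ⟨zl, -, φ, hφ, hlim⟩ := tendsto_subseq_of_bounded Metric.isBounded_closedBall hmem
  have hlim' : Tendsto (fun m => z (τ (φ m))) atTop (𝓝 zl) := hlim
  have ha : ∀ i q, Tendsto (fun m => (z (τ (φ m))).a i q) atTop (𝓝 (zl.a i q)) := fun i q =>
    ((((continuous_apply q).comp ((continuous_apply i).comp
      (continuous_fst.comp continuous_snd)) :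
        Continuous fun z : P.State => z.a i q)).tendsto zl).comp hlim'
  have hθ : ∀ i k j, Tendsto (fun m => (z (τ (φ m))).θ i k j) atTop (𝓝 (zl.θ i k j)) :=
    fun i k j => ((continuous_θ_apply i k j).tendsto zl).comp hlim'
  have hadm : P.IsAdmissible zl := by
    refine ⟨⟨fun i q => ?_, fun i q hadj => ?_, fun i q hadj => ?_⟩, fun i k j => ?_⟩
    · refine tendsto_nhds_unique (ha i q) ?_
      simp_rw [fun m => (hz.adm (hτ0 (φ m))).1.symm i q]
      exact ha q i
    · exact ((hz.adm le_rfl).1.pos i q hadj).trans_le (ge_of_tendsto' (ha i q) fun m =>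
        (hz (τ (φ m))).le_a hP ⟨hτ0 _, le_rfl⟩ i q)
    · refine tendsto_nhds_unique (ha i q) ?_
      simp_rw [fun m => (hz.adm (hτ0 (φ m))).1.zero i q hadj]
      exact tendsto_const_nhds
    · exact ge_of_tendsto' (hθ i k j) fun m => (hz.adm (hτ0 (φ m))).2 i k j
  have hrate : 1 / 2 * nsq (P.xField zl) + P.diss μ xs zl ≤ 0 := by
    have hc : Continuous fun z : P.State => 1 / 2 * nsq (P.xField z) + P.diss μ xs z :=
      (continuous_const.mul (continuous_nsq.comp hP.continuous_xField)).add
        (P.continuous_diss μ xs)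
    exact le_of_tendsto_of_tendsto' ((hc.tendsto zl).comp hlim')
      (tendsto_one_div_add_atTop_nhds_zero_nat.comp hφ.tendsto_atTop) fun m => (hτ (φ m)).le
  have hv0 := nsq_nonneg (P.xField zl)
  have hd0 : 0 ≤ P.diss μ xs zl := by
    obtain ⟨d1, d2, -, d3⟩ := hP.diss_ge href hadm
    unfold diss; linarith
  have hv : P.xField zl = 0 := by
    funext i
    have h1 := norm_sq_le_nsq (P.xField zl) i
    exact norm_eq_zero.mp (pow_eq_zero_iff two_ne_zero |>.mp
      (le_antisymm (by linarith) (sq_nonneg _)))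
  have hkkt := hP.kkt_of_diss_eq_zero href hadm hv (by linarith)
  refine ⟨zl, Metric.tendsto_atTop.mpr fun ε hε => ?_, hadm, hkkt⟩
  -- The limit point satisfies KKT and is thus stable: once the orbit comes within `δ` of it, it
  -- stays within `ε` forever.
  obtain ⟨δ, hδ, hstab⟩ := hP.stable hadm hkkt hε
  obtain ⟨m, hm⟩ := (hlim'.eventually (Metric.ball_mem_nhds zl hδ)).exists
  exact ⟨τ (φ m), fun t ht => hstab _ t z (hz.on (hτ0 _)) hm t ⟨ht, le_rfl⟩⟩

end IsGlobalSol

lemma IsTrajectoryOn.isGlobalSol (hd_symm : ∀ i q, P.d i q = P.d q i)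
    (hd_pos : ∀ i q, P.G.Adj i q → 0 < P.d i q) (hg : ∀ i k j, Continuous (P.g i k j))
    {z : ℝ → P.State} (h : P.IsTrajectoryOn (Ici 0) z) (hadm : P.IsAdmissible (z 0)) :
    P.IsGlobalSol z := fun T =>
  ((h.mono Icc_subset_Ici_self).isSol (T := |T|) hd_symm hd_pos hg hadm).mono le_rfl
    (le_abs_self T)

end Problem

end ADPDD

end

theorem mainTheorem1 (n l : ℕ) (P : ADPDD.Problem n l)
    (hG : P.G.Connected)
    (hd_symm : ∀ i q, P.d i q = P.d q i)
    (hd_pos : ∀ i q, P.G.Adj i q → 0 < P.d i q)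
    (hf_diff : ∀ i, Differentiable ℝ (P.f i) ∧ Differentiable ℝ (gradient (P.f i)))
    (hf_conv : ∀ i, ∃ μ : ℝ, 0 < μ ∧ StrongConvexOn Set.univ μ (P.f i))
    (hg_diff : ∀ i k j, Differentiable ℝ (P.g i k j))
    (hg_conv : ∀ i k j, ConvexOn ℝ Set.univ (P.g i k j))
    (slater : ∃ v : EuclideanSpace ℝ (Fin l), ∀ i k j, P.g i k j (v k) < 0) :
    (∀ z : ℝ → P.State, P.IsTrajectoryOn (Set.Ici 0) z → P.IsAdmissible (z 0) →
      ∃ (x : ADPDD.Vec n l) (a : Fin n → Fin n → ℝ) (α : ADPDD.Vec n l) (θ : P.Mult),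
        Tendsto z atTop (𝓝 (x, a, α, θ)) ∧ P.IsWeight a ∧
        ADPDD.Problem.IsSaddlePoint (P.lagrangian a) x α θ ∧
        ADPDD.Problem.IsSaddlePoint (P.augLagrangian a) x α θ ∧
        P.KKT a x α θ) ∧
    P.IsAsymptoticallyStable P.saddleSet := by
  obtain ⟨μ, hP⟩ := ADPDD.Problem.exists_regular hG hd_symm hd_pos hf_diff hf_conv hg_diff hg_conv
  obtain ⟨xs, h, θs, href⟩ := hP.exists_isRef hg_conv slater
  have hg_cont : ∀ i k j, Continuous (P.g i k j) := fun i k j => (hg_diff i k j).continuous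
  have hconv : ∀ z : ℝ → P.State, P.IsTrajectoryOn (Set.Ici 0) z → P.IsAdmissible (z 0) →
      ∃ zl : P.State, Tendsto z atTop (𝓝 zl) ∧ P.IsAdmissible zl ∧ P.KKT zl.a zl.x zl.α zl.θ :=
    fun z hz hadm => (hz.isGlobalSol hd_symm hd_pos hg_cont hadm).exists_tendsto hP href
  -- Convergence holds from every admissible initial state, so the radius 1 of the neighbourhood is
  -- arbitrary.
  refine ⟨fun z hz hadm => ?_, fun zs hzs => ⟨fun ε hε => ?_, 1, one_pos, fun z hz hadm _ => ?_⟩⟩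
  · obtain ⟨zl, hlim, hadml, hkkt⟩ := hconv z hz hadm
    obtain ⟨h1, h2⟩ := hkkt.isSaddlePoint hP hadml.1
    exact ⟨zl.x, zl.a, zl.α, zl.θ, hlim, hadml.1, h1, h2, hkkt⟩
  · obtain ⟨δ, hδ, hstab⟩ := hP.stable hzs.1 (hzs.2.kkt hP hzs.1.1) hε
    exact ⟨δ, hδ, fun T _ z hz hadm hdist =>
      hstab 0 T z (hz.isSol hd_symm hd_pos hg_cont hadm) hdist⟩
  · obtain ⟨zl, hlim, hadml, hkkt⟩ := hconv z hz hadm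
    exact ⟨zl, ⟨hadml, (hkkt.isSaddlePoint hP hadml.1).2⟩, hlim⟩
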